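/- Let $K$ be a field of characteristic $p>0$, $P_n=K[x_1,\dots,x_n]$, and let $\mathcal D(P_n)\subseteq \mathrm{End}_K(P_n)$ be its ring of differential operators; it has the $K$-basis $x^\alpha\partial^{[\beta]}$, where $\partial_i^{[j]}=\partial_i^j/j!$ are the divided powers ($f(x+t)=\sum_\beta \partial^{[\beta]}(f)\,t^\beta$). Put $F_i=\bigoplus_{|\alpha|+|\beta|\le i}Kx^\alpha\partial^{[\beta]}$. Let $\varepsilon\in\{\pm1\}^n$, $\varepsilon\ne(1,\dots,1)$, and let $\Lambda_\varepsilon\subseteq\mathcal D(P_n)$ be the commutative subalgebra generated by the $x_i$ with $\varepsilon_i=1$ and the $\partial_i^{[j]}$ ($j\ge1$) with $\varepsilon_i=-1$. Let $t\ge1$ be the number of $i$ with $\varepsilon_i=-1$, $s=n-t$, and let $P_t$, $P_s$ be the polynomial algebras in the $x_i$ with $\varepsilon_i=-1$, respectively $\varepsilon_i=1$. Thus $\Lambda_\varepsilon=\Lambda(t)\otimes P_s$, where $\Lambda(t)=\bigoplus_\beta K\partial^{[\beta]}\subseteq\mathcal D(P_t)$; put $\Lambda(t)_+=\bigoplus_{\beta\neq0}K\partial^{[\beta]}$.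 Let $\widehat{\mathcal D(P_n)}(\mathcal L_\varepsilon)$ be the set of isomorphism classes of simple $\mathcal D(P_n)$-modules $M$ with $\dim_K(\Lambda_\varepsilon v)<\infty$ for all $v\in M$. For a commutative ring $R$, $\mathrm{ass}_R(M)$ is the set of prime ideals of $R$ that are annihilators of elements of $M$. For $\mathfrak m\in\mathrm{Max}(P_s)$ let $g_i$ be the monic irreducible generator of $K[x_i]\cap\mathfrak m$ and write $g_i=f_i(x_i^{p^{k_i}})$ with $f_i$ separable. Let $A(\mathfrak m)\subseteq\mathcal D(P_s)$ be the subalgebra generated by all $x_i$ and all $\partial_i^{[j]}$ with $j<p^{k_i}$, and let $V(\mathfrak m)$ be the (up to isomorphism unique) simple $A(\mathfrak m)$-module annihilated by the central elements in $\mathfrak m\cap K[x_1^{p^{k_1}},\dots,x_s^{p^{k_s}}]$. Put $U(\mathfrak m)=\mathcal D(P_s)\otimes_{A(\mathfrak m)}V(\mathfrak m)$ and $\mathcal U(\mathfrak m)=P_t\otimes_K U(\mathfrak m)$. Let $(P_s/\mathfrak m)^{sep}$ be the maximal separable subextension of $P_s/\mathfrak m$ over $K$. A nonzero finitely generated $\mathcal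 D(P_n)$-module $M$ is holonomic if it has a filtration $\{F'_iM_0\}$, with $M_0$ a finite dimensional generating subspace and $\{F'_i\}$ a finite dimensional algebra filtration of $\mathcal D(P_n)$ equivalent to $\{F_i\}$, such that $\dim_K(F'_iM_0)\le q(i)$ for $i\gg0$ for some $q\in\mathbb Q[z]$ of degree $n$. A finitely generated $\mathcal D(P_n)$-module $M$ has dimension $d$ and multiplicity $e(M)=e>0$ if $\dim_K(F_iM_0)=\frac{e}{d!}i^d+o(i^d)$ for every finite dimensional generating subspace $M_0$. An almost polynomial with period $k$ is a function $f:\mathbb N\to\mathbb N$ that for $i\gg0$ agrees on each residue class modulo $k$ with a polynomial in $\mathbb Q[z]$, all these polynomials having the same degree and the same leading coefficient. Then $\mathcal D(P_n)=\mathcal D(P_t)\otimes\mathcal D(P_s)$ and: 1. The map $\mathrm{Max}(P_s)\to\widehat{\mathcal D(P_n)}(\mathcal L_\varepsilon)$, $\mathfrak m\mapsto\mathcal U(\mathfrak m)$, is a bijection with inverse $M\mapsto\mathrm{ass}_{P_s}(M)$; in particular $\mathrm{ass}_{P_s}(\mathcal U(\mathfrak m))=\{\mathfrak m\}$. 2.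 The map $\mathrm{Max}(\Lambda_\varepsilon)\to\widehat{\mathcal D(P_n)}(\mathcal L_\varepsilon)$, $\Lambda(t)_+\otimes P_s+\Lambda(t)\otimes\mathfrak m\mapsto\mathcal U(\mathfrak m)$, is a well-defined bijection with inverse $M\mapsto\mathrm{ass}_{\Lambda_\varepsilon}(M)$; in particular $\mathrm{ass}_{\Lambda_\varepsilon}(\mathcal U(\mathfrak m))=\{\Lambda(t)_+\otimes P_s+\Lambda(t)\otimes\mathfrak m\}$. 3. Every module in $\widehat{\mathcal D(P_n)}(\mathcal L_\varepsilon)$ is holonomic and not finitely presented. 4. $\mathrm{End}_{\mathcal D(P_n)}(\mathcal U(\mathfrak m))\simeq\mathrm{End}_{\mathcal D(P_t)}(P_t)\otimes\mathrm{End}_{\mathcal D(P_s)}(U(\mathfrak m))\simeq K\otimes(P_s/\mathfrak m)^{sep}\simeq(P_s/\mathfrak m)^{sep}$ as $K$-algebras; the first isomorphism is the natural one, and it is the tensor product of $\mathrm{End}_{\mathcal D(P_t)}(P_t)\simeq K$ and $\mathrm{End}_{\mathcal D(P_s)}(U(\mathfrak m))\simeq(P_s/\mathfrak m)^{sep}$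 that gives the second. 5. The subspace $1\otimes1\otimes V(\mathfrak m)$ of $\mathcal U(\mathfrak m)$ is finite dimensional and generates $\mathcal U(\mathfrak m)$. Let $\mathcal U(\mathfrak m)_i=F_i\,(1\otimes1\otimes V(\mathfrak m))$. Then $$\mathcal U(\mathfrak m)_i=\bigoplus_{|\alpha|+\gamma_1p^{k_1}+\cdots+\gamma_sp^{k_s}\le i}x^\alpha\otimes\partial_1^{[\gamma_1p^{k_1}]}\cdots\partial_s^{[\gamma_sp^{k_s}]}\otimes V(\mathfrak m)\qquad(\alpha\in\mathbb N^t,\ \gamma\in\mathbb N^s),$$ these subspaces being isomorphic to $V(\mathfrak m)$ in the obvious way, and $\mathcal U(\mathfrak m)$ is their direct sum over all $(\alpha,\gamma)$. Moreover: (a) with $P_{P_t}$ and $P_{U(\mathfrak m)}$ the Poincaré series of the filtrations $F_i\cdot K1$ of $P_t$ and $F_i(1\otimes V(\mathfrak m))$ of $U(\mathfrak m)$, and $k=k_1+\cdots+k_s$, $$P_{\mathcal U(\mathfrak m)}:=\sum_{i\ge0}\dim_K(\mathcal U(\mathfrak m)_i)\,\omega^i=(1-\omega)P_{P_t}P_{U(\mathfrak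 m)}=\frac{p^k[(P_s/\mathfrak m)^{sep}:K]}{(1-\omega)^{t+1}\prod_{i=1}^s(1-\omega^{p^{k_i}})};$$ (b) $P_t$, $U(\mathfrak m)$ and $\mathcal U(\mathfrak m)$ have dimensions $t$, $s$ and $n$, and their multiplicities satisfy $e(\mathcal U(\mathfrak m))=e(P_t)e(U(\mathfrak m))=[(P_s/\mathfrak m)^{sep}:K]=\dim_K\mathrm{End}_{\mathcal D(P_n)}(\mathcal U(\mathfrak m))$; (c) $i\mapsto\dim_K(\mathcal U(\mathfrak m)_i)$ is an almost polynomial of degree $n$ with leading coefficient $[(P_s/\mathfrak m)^{sep}:K]/n!$ and period $p^{\max\{k_1,\dots,k_s\}}$ (period $1$ if $s=0$). -/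

import Mathlib

open scoped TensorProduct

universe u

namespace TinyDMod

noncomputable section

section DiffOps

variable (K : Type u) [Field K] (A : Type u) [CommRing A] [Algebra K A]

/-- The commutator `f ↦ f ∘ x - x ∘ f` with the multiplication by an element `x` of `A`. -/
def commMul (x : A) : Module.End K A →ₗ[K] Module.End K A :=
  LinearMap.mulRight K (Algebra.lmul K A x) - LinearMap.mulLeft K (Algebra.lmul K A x)

variable {K A} in
theorem commMul_apply (x : A) (f : Module.End K A) :
    commMul K A x f = f * Algebra.lmul K A x - Algebra.lmul K A x * f := rfl

/-- The order filtration, `D(A)_0 = End_A(A)` and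
`D(A)_{i+1} = {f ∈ End_K(A) | f x - x f ∈ D(A)_i for all x ∈ A}`. -/
def diffOrder : ℕ → Submodule K (Module.End K A)
  | 0 => ⨅ x : A, LinearMap.ker (commMul K A x)
  | i + 1 => ⨅ x : A, (diffOrder i).comap (commMul K A x)

variable {K A}

theorem mem_diffOrder_zero {f : Module.End K A} :
    f ∈ diffOrder K A 0 ↔ ∀ x, commMul K A x f = 0 := by
  simp [diffOrder]

theorem mem_diffOrder_succ {i : ℕ} {f : Module.End K A} :
    f ∈ diffOrder K A (i + 1) ↔ ∀ x, commMul K A x f ∈ diffOrder K A i := by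
  simp [diffOrder]

theorem diffOrder_mono : Monotone (diffOrder K A) := by
  refine monotone_nat_of_le_succ fun i => ?_
  induction i with
  | zero =>
    intro f hf
    rw [mem_diffOrder_zero] at hf
    rw [mem_diffOrder_succ]
    intro x
    rw [hf x]
    exact zero_mem _
  | succ i ih =>
    intro f hf
    rw [mem_diffOrder_succ] at hf ⊢
    exact fun x => ih (hf x)

theorem commMul_mul (x : A) (f g : Module.End K A) :
    commMul K A x (f * g) = f * commMul K A x g + commMul K A x f * g := by
  simp only [commMul_apply, mul_sub, sub_mul, mul_assoc]
  abel

theorem diffOrder_mul {i j : ℕ} {f g : Module.End K A}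
    (hf : f ∈ diffOrder K A i) (hg : g ∈ diffOrder K A j) :
    f * g ∈ diffOrder K A (i + j) := by
  induction h : i + j generalizing i j f g with
  | zero =>
    obtain ⟨rfl, rfl⟩ : i = 0 ∧ j = 0 := by omega
    rw [mem_diffOrder_zero] at *
    intro x
    rw [commMul_mul, hf x, hg x]
    simp
  | succ N ih =>
    rw [mem_diffOrder_succ]
    intro x
    rw [commMul_mul]
    refine add_mem ?_ ?_
    · cases j with
      | zero =>
        rw [mem_diffOrder_zero] at hg
        rw [hg x, mul_zero]
        exact zero_mem _
      | succ j =>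
        rw [mem_diffOrder_succ] at hg
        exact ih hf (hg x) (by omega)
    · cases i with
      | zero =>
        rw [mem_diffOrder_zero] at hf
        rw [hf x, zero_mul]
        exact zero_mem _
      | succ i =>
        rw [mem_diffOrder_succ] at hf
        exact ih (hf x) hg (by omega)

theorem lmul_mem_diffOrder (a : A) : Algebra.lmul K A a ∈ diffOrder K A 0 := by
  rw [mem_diffOrder_zero]
  intro x
  rw [commMul_apply, ← map_mul, ← map_mul, mul_comm, sub_self]

variable (K A)

/-- The ring `D(A) = ⋃ i, D(A)_i ⊆ End_K(A)` of differential operators on `A`. -/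
def diffOps : Subalgebra K (Module.End K A) where
  carrier := {f | ∃ i, f ∈ diffOrder K A i}
  mul_mem' := by
    rintro f g ⟨i, hf⟩ ⟨j, hg⟩
    exact ⟨i + j, diffOrder_mul hf hg⟩
  add_mem' := by
    rintro f g ⟨i, hf⟩ ⟨j, hg⟩
    exact ⟨max i j, add_mem (diffOrder_mono (le_max_left i j) hf)
      (diffOrder_mono (le_max_right i j) hg)⟩
  algebraMap_mem' := by
    intro r
    refine ⟨0, ?_⟩
    have h := lmul_mem_diffOrder (K := K) (algebraMap K A r)
    rwa [AlgHom.commutes] at h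

end DiffOps

section Poly

variable (K : Type u) [Field K] (σ : Type)

/-- The ring of differential operators on the polynomial algebra in the variables `x_i`, `i : σ`. -/
def DP : Type u := diffOps K (MvPolynomial σ K)

instance : Ring (DP K σ) := inferInstanceAs (Ring (diffOps K (MvPolynomial σ K)))
instance : Algebra K (DP K σ) := inferInstanceAs (Algebra K (diffOps K (MvPolynomial σ K)))

/-- The natural action of differential operators on polynomials. -/
instance : Module (DP K σ) (MvPolynomial σ K) :=
  inferInstanceAs (Module (diffOps K (MvPolynomial σ K)) (MvPolynomial σ K))

instance : IsScalarTower K (DP K σ) (MvPolynomial σ K) :=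
  inferInstanceAs (IsScalarTower K (diffOps K (MvPolynomial σ K)) (MvPolynomial σ K))

variable {σ}

/-- The polynomial algebra as the subalgebra of multiplication operators. -/
def mulOp : MvPolynomial σ K →ₐ[K] DP K σ :=
  (Algebra.lmul K (MvPolynomial σ K)).codRestrict (diffOps K (MvPolynomial σ K))
    fun a => ⟨0, lmul_mem_diffOrder a⟩

/-- The Taylor expansion `f ↦ f(x + t)`, a polynomial in `t` with coefficients polynomials in
`x`. -/
def taylor : MvPolynomial σ K →ₐ[K] MvPolynomial σ (MvPolynomial σ K) :=
  MvPolynomial.aeval fun i => MvPolynomial.C (MvPolynomial.X i) + MvPolynomial.X i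

/-- The divided power `∂^[β]`: `f(x + t) = ∑ β, ∂^[β](f) t^β`. -/
def hasseEnd (β : σ →₀ ℕ) : Module.End K (MvPolynomial σ K) :=
  ((MvPolynomial.lcoeff (MvPolynomial σ K) β).restrictScalars K) ∘ₗ (taylor K).toLinearMap


theorem hasseEnd_apply (β : σ →₀ ℕ) (f : MvPolynomial σ K) :
    hasseEnd K β f = MvPolynomial.coeff β (taylor K f) := rfl

theorem hasseEnd_zero (f : MvPolynomial σ K) : hasseEnd K 0 f = f := by
  have h : ((MvPolynomial.constantCoeff (R := MvPolynomial σ K) (σ := σ)).comp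
      (taylor K (σ := σ)).toRingHom) = RingHom.id _ := by
    ext i <;> simp [taylor]
  exact congrArg (fun φ => φ f) h

theorem hasseEnd_mul [DecidableEq σ] (β : σ →₀ ℕ) (f g : MvPolynomial σ K) :
    hasseEnd K β (f * g) =
      ∑ ab ∈ Finset.HasAntidiagonal.antidiagonal β, hasseEnd K ab.1 f * hasseEnd K ab.2 g := by
  simp only [hasseEnd_apply, map_mul, MvPolynomial.coeff_mul]

theorem commMul_hasseEnd [DecidableEq σ] (β : σ →₀ ℕ) (f : MvPolynomial σ K) :
    commMul K _ f (hasseEnd K β) =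
      ∑ ab ∈ (Finset.HasAntidiagonal.antidiagonal β).erase (0, β),
        Algebra.lmul K (MvPolynomial σ K) (hasseEnd K ab.1 f) * hasseEnd K ab.2 := by
  refine LinearMap.ext fun g => ?_
  have h0 : ((0, β) : (σ →₀ ℕ) × (σ →₀ ℕ)) ∈ Finset.HasAntidiagonal.antidiagonal β := by simp
  have h1 := hasseEnd_mul K β f g
  rw [← Finset.add_sum_erase _ _ h0, hasseEnd_zero] at h1
  change hasseEnd K β (f * g) - f * hasseEnd K β g = _
  rw [h1, add_sub_cancel_left, LinearMap.sum_apply]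
  rfl

theorem hasseEnd_mem (N : ℕ) (β : σ →₀ ℕ) (hβ : β.degree ≤ N) :
    hasseEnd K β ∈ diffOrder K (MvPolynomial σ K) N := by
  classical
  induction N generalizing β with
  | zero =>
    have hz : β = 0 := by
      rw [← Finsupp.degree_eq_zero_iff]
      omega
    subst hz
    rw [mem_diffOrder_zero]
    intro f
    rw [commMul_hasseEnd]
    refine Finset.sum_eq_zero fun ab hab => ?_
    simp at hab
  | succ N ih =>
    rw [mem_diffOrder_succ]
    intro f
    rw [commMul_hasseEnd]
    refine Submodule.sum_mem _ fun ab hab => ?_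
    rw [Finset.mem_erase, Finset.HasAntidiagonal.mem_antidiagonal] at hab
    obtain ⟨hne, hab⟩ := hab
    have h1 : ab.1 ≠ 0 := by
      intro h
      apply hne
      rw [h, zero_add] at hab
      exact Prod.ext h hab
    have h2 : ab.1.degree ≠ 0 := fun h => h1 ((Finsupp.degree_eq_zero_iff _).1 h)
    have h3 : ab.1.degree + ab.2.degree = β.degree := by rw [← hab, map_add]
    have h4 := diffOrder_mul (lmul_mem_diffOrder (K := K) (hasseEnd K ab.1 f))
      (ih ab.2 (by omega))
    rwa [zero_add] at h4

/-- `∂^[β]` as a differential operator. -/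
def hasse (β : σ →₀ ℕ) : DP K σ := ⟨hasseEnd K β, β.degree, hasseEnd_mem K _ β le_rfl⟩

/-- The operator `∂_i^[j]`. -/
def partialPow (i : σ) (j : ℕ) : DP K σ := hasse K (Finsupp.single i j)

/-- The subalgebra `Λ_ε` of `D(P_n)`: the tensor product of the `K[x_i]` with `ε_i = 1` and of the
`K[∂_i^[1], ∂_i^[2], …]` with `ε_i = -1`. It is commutative. -/
def Lam (ε : σ → ℤˣ) : Subalgebra K (DP K σ) :=
  Algebra.adjoin K ({a | ∃ i, ε i = 1 ∧ a = mulOp K (MvPolynomial.X i)} ∪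
    {a | ∃ i j, ε i = -1 ∧ a = partialPow K i j})

/-- The step `F_i = ⊕ K x^α ∂^[β]`, `|α| + |β| ≤ i`, of the canonical filtration. -/
def canonFil (i : ℕ) : Submodule K (DP K σ) :=
  Submodule.span K {a | ∃ α β : σ →₀ ℕ, α.degree + β.degree ≤ i ∧
    a = mulOp K (MvPolynomial.monomial α 1) * hasse K β}

/-- A finite dimensional algebra filtration. -/
structure IsFinFiltration (F : ℕ → Submodule K (DP K σ)) : Prop where
  mono : Monotone F
  exhaustive : ∀ a, ∃ i, a ∈ F i
  one_mem : 1 ∈ F 0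
  mul_mem : ∀ i j a b, a ∈ F i → b ∈ F j → a * b ∈ F (i + j)
  finite : ∀ i, FiniteDimensional K (F i)

/-- Equivalence of filtrations. -/
def FilEquiv (F G : ℕ → Submodule K (DP K σ)) : Prop :=
  ∃ a b c d : ℕ, 0 < a ∧ 0 < c ∧
    ∀ᶠ i in Filter.atTop, F i ≤ G (a * i + b) ∧ G i ≤ F (c * i + d)

end Poly

section Modules

variable {K : Type u} [Field K] {σ : Type}
variable {M : Type u} [AddCommGroup M] [Module K M] [Module (DP K σ) M]

/-- The subspace `F · W` spanned by all `a w`, `a ∈ F`, `w ∈ W`. -/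
def mulSpace (F : Submodule K (DP K σ)) (W : Submodule K M) : Submodule K M :=
  Submodule.span K {x | ∃ a ∈ F, ∃ w ∈ W, x = a • w}

variable (σ) in
/-- The function `i ↦ dim_K (F_i W)`, `F` the canonical filtration of `D(P_n)`. -/
def hilb (W : Submodule K M) (i : ℕ) : ℕ :=
  Module.finrank K (mulSpace (canonFil K (σ := σ) i) W)

variable (σ) in
/-- The Poincare series `∑ i, dim_K (F_i W) ω^i`. -/
def poincare (W : Submodule K M) : PowerSeries ℚ := PowerSeries.mk fun i => (hilb σ W i : ℚ)

variable (K σ M) in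
/-- `M = D M_0` has a filtration of standard type `{F'_i M_0}` of polynomial growth of degree `n`,
where `F'` is a finite dimensional filtration of `D = D(P_n)` equivalent to the canonical one, and
`M ≠ 0`. -/
def IsHolonomic [Fintype σ] : Prop :=
  Nontrivial M ∧
  ∃ (F : ℕ → Submodule K (DP K σ)) (W : Submodule K M),
    IsFinFiltration K F ∧ FilEquiv K F (canonFil K) ∧
    FiniteDimensional K W ∧ Submodule.span (DP K σ) (W : Set M) = ⊤ ∧
    ∃ q : Polynomial ℚ, q.natDegree = Fintype.card σ ∧
      ∀ᶠ i : ℕ in Filter.atTop, (Module.finrank K (mulSpace (F i) W) : ℚ) ≤ q.eval (i : ℚ)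

variable (K σ M) in
/-- The finitely generated module `M` has dimension `d` and multiplicity `e`:
`dim_K (F_i M_0) = (e / d!) i^d + o(i^d)` with `e > 0`, for every finite dimensional generating
subspace `M_0`. -/
def HasMultiplicity (d : ℕ) (e : ℝ) : Prop :=
  0 < e ∧ Module.Finite (DP K σ) M ∧
  ∀ W : Submodule K M, FiniteDimensional K W → Submodule.span (DP K σ) (W : Set M) = ⊤ →
    Filter.Tendsto (fun i : ℕ => (hilb σ W i : ℝ) / (i : ℝ) ^ d) Filter.atTop
      (nhds (e / (d.factorial : ℝ)))

variable (M) in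
/-- `dim_K (Λ_ε v) < ∞` for all `v ∈ M`. -/
def IsLocFinite (ε : σ → ℤˣ) : Prop :=
  ∀ v : M, FiniteDimensional K (Submodule.span K {w : M | ∃ a ∈ Lam K ε, w = a • v})

end Modules

/-- `f` is an almost polynomial with period `k`, degree `d` and leading coefficient `c`. -/
def IsAlmostPolynomial (f : ℕ → ℕ) (k d : ℕ) (c : ℚ) : Prop :=
  0 < k ∧ c ≠ 0 ∧ ∃ P : ZMod k → Polynomial ℚ,
    (∀ r, (P r).natDegree = d ∧ (P r).leadingCoeff = c) ∧
    ∀ᶠ i : ℕ in Filter.atTop, (f i : ℚ) = (P (i : ZMod k)).eval (i : ℚ)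

/-- The associated primes of the `D`-module `M` as a module over `R`, along `ρ : R → D`: the prime
ideals of `R` that are annihilators of elements of `M`. (`R` is commutative in all uses.) -/
def assPrimes {R D : Type u} [Ring R] [Ring D] (ρ : R →+* D) (M : Type u) [AddCommGroup M]
    [Module D M] : Set (Ideal R) :=
  {I | I.IsPrime ∧ ∃ v : M, ∀ r, r ∈ I ↔ ρ r • v = 0}

section Tiny

open scoped ModuleCat

variable {K : Type u} [Field K] {σ : Type} (ε : σ → ℤˣ)

variable (K) in
/-- The simple `D(P_n)`-modules that are locally finite over `Λ_ε`. -/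
def TinyModule : Type (u + 1) :=
  {M : ModuleCat.{u} (DP K σ) // IsSimpleModule (DP K σ) M ∧ IsLocFinite (K := K) M ε}

instance tinySetoid : Setoid (TinyModule K ε) where
  r M N := Nonempty (M.1 ≃ₗ[DP K σ] N.1)
  iseqv := ⟨fun _ => ⟨LinearEquiv.refl _ _⟩, fun ⟨e⟩ => ⟨e.symm⟩, fun ⟨e⟩ ⟨f⟩ => ⟨e.trans f⟩⟩

variable (K) in
/-- The set of isomorphism classes of simple `D(P_n)`-modules locally finite over `Λ_ε`. -/
def TinyClass : Type (u + 1) := Quotient (tinySetoid (K := K) ε)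

/-- The isomorphism class of a module. -/
def TinyModule.cls {ε : σ → ℤˣ} (M : TinyModule K ε) : TinyClass K ε := Quotient.mk _ M

/-- The underlying `D(P_n)`-module is holonomic (its `K`-structure comes from `K → D(P_n)`). -/
def TinyModule.IsHolonomic [Fintype σ] {ε : σ → ℤˣ} (M : TinyModule K ε) : Prop :=
  TinyDMod.IsHolonomic K σ M.1

end Tiny

section Induced

variable {K : Type u} [Field K] {D : Type u} [Ring D] [Algebra K D] (A : Subalgebra K D)
variable (V : Type u) [AddCommGroup V] [Module K V] [Module A V] [IsScalarTower K A V]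

/-- The relations `d a ⊗ v = d ⊗ a v`, `a ∈ A`. -/
def inducedRel : Submodule D (D ⊗[K] V) :=
  Submodule.span D {z | ∃ (d : D) (a : A) (v : V), z = (d * a) ⊗ₜ[K] v - d ⊗ₜ[K] (a • v)}

/-- The induced module `D ⊗_A V`. -/
def Induced : Type u := (D ⊗[K] V) ⧸ inducedRel A V

instance : AddCommGroup (Induced A V) := inferInstanceAs (AddCommGroup (_ ⧸ inducedRel A V))
instance : Module D (Induced A V) := inferInstanceAs (Module D (_ ⧸ inducedRel A V))
instance : Module K (Induced A V) := inferInstanceAs (Module K (_ ⧸ inducedRel A V))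
instance : IsScalarTower K D (Induced A V) :=
  inferInstanceAs (IsScalarTower K D (_ ⧸ inducedRel A V))

/-- The map `v ↦ 1 ⊗ v`. -/
def Induced.ι : V →ₗ[K] Induced A V :=
  ((inducedRel A V).mkQ.restrictScalars K) ∘ₗ (TensorProduct.mk K D V 1)

end Induced

section Um

variable {K : Type u} [Field K] {σ : Type} (p : ℕ)

instance (m : MaximalSpectrum (MvPolynomial σ K)) : Field (MvPolynomial σ K ⧸ m.asIdeal) :=
  Ideal.Quotient.field m.asIdeal

/-- `(P_s / m)^sep`, the maximal separable subextension of `P_s / m` over `K`. -/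
abbrev ResSep (m : MaximalSpectrum (MvPolynomial σ K)) :
    IntermediateField K (MvPolynomial σ K ⧸ m.asIdeal) :=
  separableClosure K (MvPolynomial σ K ⧸ m.asIdeal)

/-- The exponent `k_i`: the monic irreducible generator `g_i` of `K[x_i] ∩ m` has the form
`f_i(x_i^(p^k_i))` with `f_i` separable. -/
def kExp (m : MaximalSpectrum (MvPolynomial σ K)) (i : σ) : ℕ :=
  sInf {k | ∃ f : Polynomial K, f.Separable ∧ Polynomial.expand K (p ^ k) f =
    minpoly K (Ideal.Quotient.mk m.asIdeal (MvPolynomial.X i))}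

/-- The subalgebra `A(m) = ⊗_i (Λ_{i,[p^k_i]} ⊗ K[x_i])` of `D(P_s)`, generated by the `x_i` and
the `∂_i^[j]` with `j < p^k_i`. -/
def Am (m : MaximalSpectrum (MvPolynomial σ K)) : Subalgebra K (DP K σ) :=
  Algebra.adjoin K (Set.range (fun i => mulOp K (MvPolynomial.X i)) ∪
    {a | ∃ i j, j < p ^ kExp p m i ∧ a = partialPow K i j})

/-- The elements of `m ∩ K[x_1^(p^k_1), …, x_s^(p^k_s)]`, in `A(m)`. -/
def centralSet (m : MaximalSpectrum (MvPolynomial σ K)) : Set (Am p m) :=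
  {a | ∃ f ∈ m.asIdeal,
    f ∈ Algebra.adjoin K (Set.range fun i : σ => (MvPolynomial.X i : MvPolynomial σ K) ^
      p ^ kExp p m i) ∧ (a : DP K σ) = mulOp K f}

/-- The left ideal of `A(m)` generated by `m ∩ K[x_1^(p^k_1), …, x_s^(p^k_s)]` and the `∂^[β]` with
`β ≠ 0`, `β_i < p^k_i`. -/
def vIdeal (m : MaximalSpectrum (MvPolynomial σ K)) : Ideal (Am p m) :=
  Ideal.span (centralSet p m ∪
    {a | ∃ β : σ →₀ ℕ, β ≠ 0 ∧ (∀ i, β i < p ^ kExp p m i) ∧ (a : DP K σ) = hasse K β})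

/-- The `A(m)`-module `V(m)`: the simple module of the factor `M_(p^k)(Γ)`, `Γ = (P_s / m)^sep`, of
the semisimple algebra `A(m) / (g_1, …, g_s)`, that is, of the factor on which the central
subalgebra `K[x_1^(p^k_1), …, x_s^(p^k_s)]` acts through `P_s / m`. -/
def Vm (m : MaximalSpectrum (MvPolynomial σ K)) : Type u := Am p m ⧸ vIdeal p m

instance (m : MaximalSpectrum (MvPolynomial σ K)) : AddCommGroup (Vm p m) :=
  inferInstanceAs (AddCommGroup (Am p m ⧸ vIdeal p m))
instance (m : MaximalSpectrum (MvPolynomial σ K)) : Module (Am p m) (Vm p m) :=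
  inferInstanceAs (Module (Am p m) (Am p m ⧸ vIdeal p m))
instance (m : MaximalSpectrum (MvPolynomial σ K)) : Module K (Vm p m) :=
  inferInstanceAs (Module K (Am p m ⧸ vIdeal p m))
instance (m : MaximalSpectrum (MvPolynomial σ K)) : IsScalarTower K (Am p m) (Vm p m) :=
  inferInstanceAs (IsScalarTower K (Am p m) (Am p m ⧸ vIdeal p m))

/-- The `D(P_s)`-module `U(m) = D(P_s) ⊗_{A(m)} V(m)`. -/
abbrev Um (m : MaximalSpectrum (MvPolynomial σ K)) : Type u := Induced (Am p m) (Vm p m)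

end Um

section Outer

variable {K : Type u} [Field K] {T S σ : Type} (Φ : DP K T ⊗[K] DP K S ≃ₐ[K] DP K σ)
variable (M N : Type u) [AddCommGroup M] [Module K M] [Module (DP K T) M]
  [IsScalarTower K (DP K T) M] [AddCommGroup N] [Module K N] [Module (DP K S) N]
  [IsScalarTower K (DP K S) N]

/-- The tensor product `M ⊗ N` of a `D(P_t)`-module and a `D(P_s)`-module, as a module over
`D(P_n)` through an isomorphism `D(P_t) ⊗ D(P_s) ≃ D(P_n)`. -/
def Outer (_ : DP K T ⊗[K] DP K S ≃ₐ[K] DP K σ) (M N : Type u) [AddCommGroup M] [Module K M]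
    [AddCommGroup N] [Module K N] : Type u := M ⊗[K] N

instance : AddCommGroup (Outer Φ M N) := inferInstanceAs (AddCommGroup (M ⊗[K] N))
instance : Module K (Outer Φ M N) := inferInstanceAs (Module K (M ⊗[K] N))

/-- The action `(a ⊗ b)(u ⊗ v) = a u ⊗ b v`. -/
def outerAct : DP K σ →ₐ[K] Module.End K (M ⊗[K] N) :=
  ((Module.endTensorEndAlgHom (R := K) (S := K) (A := K) (M := M) (N := N)).comp
    (Algebra.TensorProduct.map (Algebra.lsmul K K M) (Algebra.lsmul K K N))).comp
    (Φ.symm : DP K σ →ₐ[K] DP K T ⊗[K] DP K S)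

instance : Module (DP K σ) (Outer Φ M N) :=
  Module.compHom (M ⊗[K] N) (outerAct Φ M N).toRingHom

theorem Outer.smul_def (a : DP K σ) (x : Outer Φ M N) :
    a • x = (outerAct Φ M N a : Module.End K (M ⊗[K] N)) x := rfl

instance : IsScalarTower K (DP K σ) (Outer Φ M N) where
  smul_assoc c a x := by
    rw [Outer.smul_def, Outer.smul_def, map_smul]
    rfl

variable {M N} in
/-- The pure tensor `u ⊗ v`. -/
def Outer.tmul (u : M) : N →ₗ[K] Outer Φ M N := TensorProduct.mk K M N u

end Outer

section Ucal

variable {K : Type u} [Field K] {n : ℕ} (ε : Fin n → ℤˣ)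

/-- The indices with `ε_i = -1`; their number is `t`. -/
abbrev NegIdx : Type := {i : Fin n // ε i = -1}

/-- The indices with `ε_i = 1`; their number is `s = n - t`. -/
abbrev PosIdx : Type := {i : Fin n // ε i = 1}

/-- `Λ(t) ⊗ P_s`, as a subalgebra of `D(P_t) ⊗ D(P_s)`. -/
def lamTensor : Subalgebra K (DP K (NegIdx ε) ⊗[K] DP K (PosIdx ε)) :=
  (Algebra.TensorProduct.map (Lam K (fun _ : NegIdx ε => -1)).val
    (mulOp K (σ := PosIdx ε))).range

variable (K) in
/-- The inclusion of `P_s` into `D(P_n)`. -/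
def psIncl : MvPolynomial (PosIdx ε) K →ₐ[K] DP K (Fin n) :=
  (mulOp K).comp (MvPolynomial.rename Subtype.val)

/-- The ideal `Λ(t)_+ ⊗ P_s + Λ(t) ⊗ m` of `Λ_ε`, generated by `m` and all `∂_i^[j]` with
`ε_i = -1`, `j ≥ 1`. -/
def lamIdeal (m : MaximalSpectrum (MvPolynomial (PosIdx ε) K)) : Ideal (Lam K ε) :=
  Ideal.span ({a | ∃ i j, ε i = -1 ∧ 0 < j ∧ (a : DP K (Fin n)) = partialPow K i j} ∪
    {a | ∃ f ∈ m.asIdeal, (a : DP K (Fin n)) = psIncl K ε f})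

variable {ε}
variable (Φ : DP K (NegIdx ε) ⊗[K] DP K (PosIdx ε) ≃ₐ[K] DP K (Fin n)) (p : ℕ)
  (m : MaximalSpectrum (MvPolynomial (PosIdx ε) K))

/-- The `D(P_n)`-module `𝒰(m) = P_t ⊗ U(m)`. -/
abbrev Ucal : Type u := Outer Φ (MvPolynomial (NegIdx ε) K) (Um p m)

/-- The map `V(m) → 𝒰(m)`, `v ↦ x^α ⊗ ∂_1^[γ_1 p^k_1] ⋯ ∂_s^[γ_s p^k_s] ⊗ v`. -/
def summandMap (α : NegIdx ε →₀ ℕ) (γ : PosIdx ε → ℕ) : Vm p m →ₗ[K] Ucal Φ p m :=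
  (Outer.tmul Φ (MvPolynomial.monomial α (1 : K))) ∘ₗ
    (Algebra.lsmul K K (Um p m)
      (hasse K (Finsupp.equivFunOnFinite.symm fun j => γ j * p ^ kExp p m j))) ∘ₗ
    (Induced.ι (Am p m) (Vm p m))

/-- The subspace `1 ⊗ V(m)` of `U(m)`. -/
def baseU : Submodule K (Um p m) := LinearMap.range (Induced.ι (Am p m) (Vm p m))

/-- The subspace `1 ⊗ 1 ⊗ V(m)` of `𝒰(m)`. -/
def baseUcal : Submodule K (Ucal Φ p m) := (baseU p m).map (Outer.tmul Φ 1)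

end Ucal

end
end TinyDMod

open TinyDMod

namespace TinyDMod
noncomputable section

/-! ### Divided powers: Leibniz rule, action on monomials, products -/

section Basics

open MvPolynomial

variable {K : Type u} [Field K] {σ : Type}

/-! Everything rests on one fact of characteristic p: x_i^{p^N} commutes with ∂^[β] as soon as β_i <
p^N. Hence any given differential operator commutes with all p^N-th powers of polynomials once N is
large (`exists_commute_frobSub`). The exact relation, [∂^[β], x_i^{p^k}] = ∂^[β - p^k e_i] or 0
(`hasse_mul_X_pow`), supplies the lowering operators used below.

The module V(m). Let Z = K[x_i^{p^{k_i}}], which is central in A(m). The map f ↦ f·1 from P_s to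
V(m) is A(m)-linear (`smul_vMap`), so V(m) can be computed with polynomials. The action of ∂^[β] on
monomials is triangular in the degree, which gives V(m) = ⊕ x^α Z/(Z ∩ m) over 0 ≤ α_i < p^{k_i}.
The quotient Z/(Z ∩ m) is (P_s/m)^sep, because a separable element c is a polynomial in c^{p^N}
(`exists_aeval_pow`). Simplicity and the dimension of V(m) follow.

The module U(m). Induction does not collapse V(m): the left ideal generated by m is proper
(`one_notMem_span_mulOp`), and D(P_s)/D(P_s)m receives a nonzero map from U(m). On U(m) the algebra
Z acts twice, by endomorphisms and by left multiplication; the differences lower ∂^[γp^k] ⊗ v to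
∂^[(γ - e_i)p^k] ⊗ v, so they separate the summands. The decisive point is `exists_uι_eq`: vectors
killed by Z ∩ m lie in 1 ⊗ V(m). Since each vector is killed by high p-powers of the elements of m,
every nonzero vector can be moved into V(m). This yields simplicity, and End U(m) = Z/(Z ∩ m).

The factor P_t. The operators ∂^[β] ⊗ 1 extract coefficients from P_t ⊗ N, so simplicity and
endomorphisms pass from U(m) to 𝒰(m).

Classification. The ∂_i^[j] with j ≥ 1 are nilpotent, so a maximal ideal of Λ_ε is determined by its
contraction to P_s. In a locally finite module a nonzero v with Λ_ε v of minimal dimension has a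
maximal annihilator. A suitable ∂^[β₀] v satisfies the defining relations of 𝒰(m), and the resulting
nonzero map between simple modules is an isomorphism.

Growth. 𝒰(m)_i is a sum of copies of V(m) indexed by lattice points of weight at most i, with
weights 1 and p^{k_j}; generating functions and division with remainder give the Poincaré series,
the almost polynomial and the multiplicity. Finite presentation fails because finitely many
relations would commute with some x_i^{p^N}, ε_i = -1, while ∂_i^[p^N] is a relation that does not.
-/

theorem DP.ext_smul {a b : DP K σ} (h : ∀ f : MvPolynomial σ K, a • f = b • f) : a = b :=
  Subtype.ext (LinearMap.ext h)

theorem mulOp_smul (f g : MvPolynomial σ K) : mulOp K f • g = f * g := rfl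

theorem hasse_smul (β : σ →₀ ℕ) (f : MvPolynomial σ K) : hasse K β • f = hasseEnd K β f := rfl

theorem hasse_zero : hasse K (0 : σ →₀ ℕ) = 1 :=
  DP.ext_smul fun f => by rw [hasse_smul, hasseEnd_zero, one_smul]

theorem mulOp_mul_hasse_smul (f : MvPolynomial σ K) (β : σ →₀ ℕ) (g : MvPolynomial σ K) :
    (mulOp K f * hasse K β) • g = f * hasseEnd K β g := rfl

theorem hasse_mul_mulOp [DecidableEq σ] (β : σ →₀ ℕ) (f : MvPolynomial σ K) :
    hasse K β * mulOp K f =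
      ∑ ab ∈ Finset.HasAntidiagonal.antidiagonal β,
        mulOp K (hasseEnd K ab.1 f) * hasse K ab.2 :=
  DP.ext_smul fun g => by
    rw [mul_smul, mulOp_smul, hasse_smul, hasseEnd_mul, Finset.sum_smul]
    rfl

/-- The multi-index binomial coefficient. -/
def multiChoose [Fintype σ] (α β : σ →₀ ℕ) : ℕ := ∏ i, (α i).choose (β i)

theorem multiChoose_self [Fintype σ] (α : σ →₀ ℕ) : multiChoose α α = 1 := by
  simp [multiChoose]

theorem multiChoose_eq_zero [Fintype σ] {α β : σ →₀ ℕ} (h : ¬ β ≤ α) : multiChoose α β = 0 := by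
  obtain ⟨i, hi⟩ : ∃ i, α i < β i := by
    by_contra! hc
    exact h hc
  exact Finset.prod_eq_zero (Finset.mem_univ i) (Nat.choose_eq_zero_of_lt hi)

/-- The Taylor expansion of x^α is the product of the (x_i + t_i)^{α_i}, and the coefficient of t^β
is read off factor by factor. If β ≤ α fails, the subtraction `α - β` is truncated, but the binomial
coefficient is then zero. -/
theorem hasseEnd_monomial [Fintype σ] (β α : σ →₀ ℕ) (c : K) :
    hasseEnd K β (monomial α c) = multiChoose α β • monomial (α - β) c := by
  classical
  rw [hasseEnd_apply]
  have h1 : taylor K (monomial α c) = C (C c) * ∏ i : σ, (X i + C (X i)) ^ α i := by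
    rw [taylor, MvPolynomial.aeval_monomial, Finsupp.prod_fintype _ _ (by simp)]
    simp only [add_comm (X _)]
    rfl
  have h2 : ∀ i : σ, ((X i + C (X i)) ^ α i : MvPolynomial σ (MvPolynomial σ K)) =
      ∑ j ∈ Finset.range (α i + 1),
        X i ^ j * C (X i ^ (α i - j) * ((α i).choose j : MvPolynomial σ K)) := by
    intro i
    rw [add_pow]
    refine Finset.sum_congr rfl fun j _ => ?_
    simp [mul_assoc]
  rw [h1, coeff_C_mul, Finset.prod_congr rfl (fun i _ => h2 i), Finset.prod_univ_sum,
    coeff_sum]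
  have h3 : ∀ x : σ → ℕ, coeff β (∏ i, (X i ^ x i * C (X i ^ (α i - x i) *
        ((α i).choose (x i) : MvPolynomial σ K)))) =
      if Finsupp.equivFunOnFinite.symm x = β then
        multiChoose α β • monomial (α - β) (1 : K) else 0 := by
    intro x
    rw [Finset.prod_mul_distrib]
    have : ∏ i, (X i ^ x i : MvPolynomial σ (MvPolynomial σ K)) =
        monomial (Finsupp.equivFunOnFinite.symm x) 1 := by
      rw [monomial_eq, Finsupp.prod_fintype _ _ (by simp)]
      simp
    rw [this, ← map_prod, mul_comm, coeff_C_mul, coeff_monomial]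
    split_ifs with h
    · subst h
      rw [mul_one, Finset.prod_mul_distrib, monomial_eq, Finsupp.prod_fintype _ _ (by simp)]
      simp [multiChoose, mul_comm]
    · simp
  simp only [h3]
  by_cases hβ : β ≤ α
  · rw [Finset.sum_eq_single (fun i => β i)]
    · rw [if_pos (show Finsupp.equivFunOnFinite.symm (fun i => β i) = β from Finsupp.ext fun i => rfl),
        mul_smul_comm, C_mul_monomial, mul_one]
    · intro x _ hx
      rw [if_neg]
      rintro rfl
      exact hx rfl
    · intro hx
      exact absurd (by simpa [Nat.lt_succ_iff] using fun i => hβ i) hx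
  · rw [multiChoose_eq_zero hβ]
    simp

theorem multiChoose_mul [Fintype σ] (α β β' : σ →₀ ℕ) :
    multiChoose α β' * multiChoose (α - β') β =
      multiChoose (β + β') β * multiChoose α (β + β') := by
  unfold multiChoose
  rw [← Finset.prod_mul_distrib, ← Finset.prod_mul_distrib]
  refine Finset.prod_congr rfl fun i _ => ?_
  have h := Nat.choose_mul (n := α i) (k := β i + β' i) (s := β' i) (by omega)
  rw [Nat.add_sub_cancel] at h
  rw [Finsupp.tsub_apply, ← h, Finsupp.add_apply, mul_comm]
  congr 1
  rw [Nat.choose_symm_add]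

theorem hasse_mul_hasse [Fintype σ] (β β' : σ →₀ ℕ) :
    hasse K β * hasse K β' = multiChoose (β + β') β • hasse K (β + β') := by
  refine DP.ext_smul fun f => ?_
  induction f using MvPolynomial.induction_on' with
  | monomial α c =>
    rw [mul_smul, hasse_smul β', hasseEnd_monomial, smul_comm, hasse_smul, hasseEnd_monomial,
      smul_assoc, hasse_smul, hasseEnd_monomial, smul_smul, smul_smul, multiChoose_mul,
      tsub_tsub, add_comm β']
  | add f g hf hg => rw [smul_add, smul_add, hf, hg]

theorem hasse_comm [Fintype σ] (β β' : σ →₀ ℕ) :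
    hasse K β * hasse K β' = hasse K β' * hasse K β := by
  rw [hasse_mul_hasse, hasse_mul_hasse, add_comm β']
  congr 1
  refine Finset.prod_congr rfl fun i _ => ?_
  rw [Finsupp.add_apply, Nat.choose_symm_add]

end Basics

/-! ### The basis x^α ∂^[β] of the ring of differential operators -/

section Span

open MvPolynomial

variable {K : Type u} [Field K] {σ : Type}

/-- By induction on the order: the commutator with x_i has order one less and kills the monomials of
degree at most N, so it vanishes. Thus f commutes with every x_i, and f(1) = 0. -/
theorem diffOrder_eq_zero_of_monomial {N : ℕ} {f : Module.End K (MvPolynomial σ K)}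
    (hf : f ∈ diffOrder K _ N)
    (h : ∀ α : σ →₀ ℕ, α.degree ≤ N → f (monomial α 1) = 0) : f = 0 := by
  induction N generalizing f with
  | zero =>
    rw [mem_diffOrder_zero] at hf
    refine LinearMap.ext fun g => ?_
    have h1 := LinearMap.congr_fun (hf g) 1
    rw [commMul_apply] at h1
    have h2 := h 0 (by simp)
    change f (g * 1) - g * f 1 = 0 at h1
    change f 1 = 0 at h2
    rw [h2, mul_one, mul_zero, sub_zero] at h1
    exact h1
  | succ N ih =>
    rw [mem_diffOrder_succ] at hf
    have key : ∀ i : σ, ∀ g, f (X i * g) = X i * f g := by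
      intro i g
      have h1 := ih (hf (X i)) (fun α hα => by
        rw [commMul_apply]
        change f (X i * monomial α 1) - X i * f (monomial α 1) = 0
        rw [h α (by omega), mul_zero, sub_zero, X, monomial_mul, one_mul]
        refine h _ ?_
        rw [map_add, Finsupp.degree_single]
        omega)
      exact sub_eq_zero.1 (LinearMap.congr_fun h1 g)
    refine LinearMap.ext fun g => ?_
    rw [LinearMap.zero_apply]
    induction g using MvPolynomial.induction_on with
    | C a =>
      have := h 0 (by simp)
      rw [← mul_one (C a), ← smul_eq_C_mul, map_smul]
      change f 1 = 0 at this
      rw [this, smul_zero]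
    | add p q hp hq => rw [map_add, hp, hq, add_zero]
    | mul_X p i hp => rw [mul_comm, key, hp, mul_zero]

theorem hasseEnd_monomial_of_degree_le [Fintype σ] [DecidableEq σ] {α β : σ →₀ ℕ}
    (h : α.degree ≤ β.degree) :
    hasseEnd K β (monomial α (1 : K)) = if α = β then 1 else 0 := by
  rw [hasseEnd_monomial]
  split_ifs with hab
  · subst hab
    simp [multiChoose_self]
  · rw [multiChoose_eq_zero, zero_smul]
    intro hle
    apply hab
    obtain ⟨γ, rfl⟩ := exists_add_of_le hle
    rw [map_add] at h
    have : γ = 0 := (Finsupp.degree_eq_zero_iff γ).1 (by omega)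
    rw [this, add_zero]

/-- On monomials of degree at most |β|, ∂^[β] sees only x^β. An operator can therefore be corrected
degree by degree until it kills enough monomials for `diffOrder_eq_zero_of_monomial`. -/
theorem span_monomial_hasse [Finite σ] :
    Submodule.span K {a : DP K σ | ∃ α β : σ →₀ ℕ, a = mulOp K (monomial α 1) * hasse K β} = ⊤ := by
  classical
  cases nonempty_fintype σ
  set S := Submodule.span K {a : DP K σ | ∃ α β : σ →₀ ℕ, a = mulOp K (monomial α 1) * hasse K β}
  have hS : ∀ f β, mulOp K f * hasse K β ∈ S := by
    intro f β
    induction f using MvPolynomial.induction_on' with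
    | monomial α c =>
      have : mulOp K (monomial α c) = c • mulOp K (monomial α (1 : K)) := by
        rw [← map_smul, smul_monomial, smul_eq_mul, mul_one]
      rw [this, smul_mul_assoc]
      exact S.smul_mem _ (Submodule.subset_span ⟨α, β, rfl⟩)
    | add f g hf hg => rw [map_add, add_mul]; exact add_mem hf hg
  rw [eq_top_iff]
  rintro f -
  obtain ⟨N, hN⟩ := f.2
  -- The correction for degree d uses ∂^[β] with |β| = d ≤ N, so the difference keeps order at most
  -- N, and it does not disturb monomials of smaller degree.
  have key : ∀ d ≤ N + 1, ∃ g ∈ S, (f - g).1 ∈ diffOrder K (MvPolynomial σ K) N ∧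
      ∀ α : σ →₀ ℕ, α.degree < d → (f - g) • monomial α (1 : K) = 0 := by
    intro d
    induction d with
    | zero => exact fun _ => ⟨0, S.zero_mem, by rwa [sub_zero], by simp⟩
    | succ d ih =>
      intro hd
      obtain ⟨g, hg, hgN, h⟩ := ih (by omega)
      have hfin : {β : σ →₀ ℕ | β.degree = d}.Finite := by
        have hle := Finsupp.finite_of_degree_le (σ := σ) d
        exact hle.subset fun β hβ => le_of_eq hβ
      set t := hfin.toFinset
      have ht : ∀ β, β ∈ t ↔ β.degree = d := fun β => by simp [t]
      set g' := ∑ β ∈ t, mulOp K ((f - g) • monomial β (1 : K)) * hasse K β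
      refine ⟨g + g', add_mem hg (sum_mem fun β _ => hS _ _), ?_, ?_⟩
      · rw [← sub_sub]
        refine sub_mem hgN ?_
        have : g'.1 = ∑ β ∈ t, (mulOp K ((f - g) • monomial β (1 : K)) * hasse K β).1 :=
          map_sum (diffOps K (MvPolynomial σ K)).val _ _
        rw [this]
        refine sum_mem fun β hβ => ?_
        have := diffOrder_mul (lmul_mem_diffOrder (K := K) ((f - g) • monomial β (1 : K)))
          (hasseEnd_mem K N β (by rw [(ht β).1 hβ]; omega))
        rwa [zero_add] at this
      · intro α hα
        rw [← sub_sub, sub_smul, Finset.sum_smul]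
        have : ∀ β ∈ t, (mulOp K ((f - g) • monomial β (1 : K)) * hasse K β) •
            (monomial α (1 : K)) = if α = β then (f - g) • monomial β (1 : K) else 0 := by
          intro β hβ
          rw [mulOp_mul_hasse_smul, hasseEnd_monomial_of_degree_le (by rw [(ht β).1 hβ]; omega)]
          split_ifs <;> simp
        rw [Finset.sum_congr rfl this, Finset.sum_ite_eq]
        split_ifs with hα'
        · exact sub_self _
        · rw [ht] at hα'
          rw [h α (by omega), sub_zero]
  obtain ⟨g, hg, hgN, h⟩ := key (N + 1) le_rfl
  have h0 := diffOrder_eq_zero_of_monomial hgN fun α hα => h α (by omega)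
  have : f = g := sub_eq_zero.1 (Subtype.ext h0)
  rwa [this]

/-- An induction principle for differential operators. -/
theorem DP.induction_mul_hasse [Finite σ] {Q : DP K σ → Prop}
    (h : ∀ (α β : σ →₀ ℕ), Q (mulOp K (monomial α 1) * hasse K β))
    (hadd : ∀ a b, Q a → Q b → Q (a + b)) (hsmul : ∀ (c : K) a, Q a → Q (c • a)) (a : DP K σ) :
    Q a := by
  have ha : a ∈ Submodule.span K
      {a : DP K σ | ∃ α β : σ →₀ ℕ, a = mulOp K (monomial α 1) * hasse K β} := by
    rw [span_monomial_hasse]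
    trivial
  induction ha using Submodule.span_induction with
  | mem x hx => obtain ⟨α, β, rfl⟩ := hx; exact h α β
  | zero => simpa using hsmul 0 _ (h 0 0)
  | add a b _ _ ha hb => exact hadd _ _ ha hb
  | smul c a _ ha => exact hsmul _ _ ha

/-- Among the β with nonzero coefficient take one of least degree and apply the sum to x^β: all
other terms vanish there and f_β remains. -/
theorem sum_mul_hasse_eq_zero [Finite σ] (s : Finset (σ →₀ ℕ))
    (f : (σ →₀ ℕ) → MvPolynomial σ K)
    (h : ∑ β ∈ s, mulOp K (f β) * hasse K β = 0) : ∀ β ∈ s, f β = 0 := by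
  classical
  cases nonempty_fintype σ
  by_contra! hne
  obtain ⟨β₀, hβ₀, hne⟩ := hne
  obtain ⟨β, hβ, hmin⟩ := Finset.exists_min_image (s.filter fun β => f β ≠ 0)
    (fun β => β.degree) ⟨β₀, by simp [hβ₀, hne]⟩
  rw [Finset.mem_filter] at hβ
  have h1 : (∑ β' ∈ s, mulOp K (f β') * hasse K β') • (monomial β (1 : K)) = f β := by
    rw [Finset.sum_smul, Finset.sum_eq_single β]
    · rw [mulOp_mul_hasse_smul, hasseEnd_monomial_of_degree_le le_rfl, if_pos rfl, mul_one]
    · intro β' hβ' hne'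
      rw [mulOp_mul_hasse_smul]
      by_cases h0 : f β' = 0
      · rw [h0, zero_mul]
      · rw [hasseEnd_monomial_of_degree_le (hmin β' (by simp [hβ', h0])), if_neg (Ne.symm hne'),
          mul_zero]
    · intro hh
      exact absurd hβ.1 hh
  rw [h, zero_smul] at h1
  exact hβ.2 h1.symm

theorem linearIndependent_monomial_hasse [Finite σ] :
    LinearIndependent K fun x : (σ →₀ ℕ) × (σ →₀ ℕ) =>
      mulOp K (monomial x.1 (1 : K)) * hasse K x.2 := by
  classical
  rw [linearIndependent_iff']
  intro s c h x hx
  set f : (σ →₀ ℕ) → MvPolynomial σ K := fun β =>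
    ∑ α ∈ s.image Prod.fst, if (α, β) ∈ s then monomial α (c (α, β)) else 0
  have h1 : ∑ β ∈ s.image Prod.snd, mulOp K (f β) * hasse K β = 0 := by
    rw [← h]
    have hs : s ⊆ s.image Prod.fst ×ˢ s.image Prod.snd := by
      intro y hy
      simp only [Finset.mem_product, Finset.mem_image]
      exact ⟨⟨y, hy, rfl⟩, y, hy, rfl⟩
    have h2 : ∀ y ∈ s, c y • (mulOp K (monomial y.1 (1 : K)) * hasse K y.2) =
        (fun y => if y ∈ s then mulOp K (monomial y.1 (c y)) * hasse K y.2 else 0) y := by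
      intro y hy
      simp only [if_pos hy]
      rw [← smul_mul_assoc, ← map_smul, smul_monomial, smul_eq_mul, mul_one]
    rw [Finset.sum_congr rfl h2, Finset.sum_subset hs
      (f := fun y => if y ∈ s then mulOp K (monomial y.1 (c y)) * hasse K y.2 else 0)
      (fun y _ hy => if_neg hy), Finset.sum_product_right]
    refine Finset.sum_congr rfl fun β _ => ?_
    simp only [f, map_sum, Finset.sum_mul]
    refine Finset.sum_congr rfl fun α _ => ?_
    split_ifs <;> simp
  have h2 := sum_mul_hasse_eq_zero _ f h1 x.2 (Finset.mem_image_of_mem _ hx)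
  have h3 := congrArg (coeff x.1) h2
  simp only [f, coeff_sum, coeff_zero] at h3
  rw [Finset.sum_eq_single x.1] at h3
  · simpa [hx] using h3
  · intro α _ hα
    split_ifs
    · rw [coeff_monomial, if_neg hα]
    · simp
  · intro hh
    exact absurd (Finset.mem_image_of_mem _ hx) hh

variable (K σ) in
/-- The basis `x^α ∂^[β]` of `D(P_n)`. -/
def DP.basis [Finite σ] : Module.Basis ((σ →₀ ℕ) × (σ →₀ ℕ)) K (DP K σ) :=
  Module.Basis.mk linearIndependent_monomial_hasse (by
    rw [← span_monomial_hasse]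
    refine Submodule.span_mono ?_
    rintro _ ⟨α, β, rfl⟩
    exact ⟨(α, β), rfl⟩)

theorem DP.basis_apply [Finite σ] (x : (σ →₀ ℕ) × (σ →₀ ℕ)) :
    DP.basis K σ x = mulOp K (monomial x.1 (1 : K)) * hasse K x.2 := by
  rw [DP.basis, Module.Basis.mk_apply]

end Span
end
end TinyDMod

namespace TinyDMod
noncomputable section

/-! ### Characteristic p: Frobenius, Lucas and commutation -/

section Char

open MvPolynomial

variable {K : Type u} [Field K] {σ : Type}

theorem mulOp_commute (f g : MvPolynomial σ K) : Commute (mulOp K f) (mulOp K g) := by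
  rw [commute_iff_eq, ← map_mul, ← map_mul, mul_comm]

/-- By Frobenius the Taylor expansion of x_i^{p^k} has only two terms, x_i^{p^k} + t_i^{p^k};
compare coefficients of t^β. -/
theorem hasseEnd_X_pow_mul (p : ℕ) [Fact p.Prime] [CharP K p] (k : ℕ) (i : σ) (β : σ →₀ ℕ)
    (f : MvPolynomial σ K) :
    hasseEnd K β (X i ^ p ^ k * f) = X i ^ p ^ k * hasseEnd K β f +
      if p ^ k ≤ β i then hasseEnd K (β - Finsupp.single i (p ^ k)) f else 0 := by
  classical
  have : taylor K (X i ^ p ^ k : MvPolynomial σ K) =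
      C (X i ^ p ^ k) + monomial (Finsupp.single i (p ^ k)) 1 := by
    rw [map_pow, taylor, aeval_X, add_pow_char_pow, X_pow_eq_monomial, map_pow]
  rw [hasseEnd_apply, map_mul, this, add_mul, coeff_add, coeff_C_mul, coeff_monomial_mul']
  simp only [Finsupp.single_le_iff, one_mul]
  rfl

theorem hasse_mul_X_pow (p : ℕ) [Fact p.Prime] [CharP K p] (k : ℕ) (i : σ) (β : σ →₀ ℕ) :
    hasse K β * mulOp K (X i ^ p ^ k) = mulOp K (X i ^ p ^ k) * hasse K β +
      if p ^ k ≤ β i then hasse K (β - Finsupp.single i (p ^ k)) else 0 :=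
  DP.ext_smul fun f => by
    rw [mul_smul, hasse_smul, mulOp_smul, hasseEnd_X_pow_mul, add_smul, mulOp_mul_hasse_smul]
    split_ifs
    · rfl
    · rw [zero_smul]

/-- The subalgebra generated by the `x_i ^ (p ^ k_i)`. -/
abbrev frobSub (K : Type u) [Field K] (p : ℕ) (k : σ → ℕ) : Subalgebra K (MvPolynomial σ K) :=
  Algebra.adjoin K (Set.range fun i : σ => (X i : MvPolynomial σ K) ^ p ^ k i)

theorem pow_mem_frobSub (p : ℕ) [Fact p.Prime] [CharP K p] {k : σ → ℕ} {N : ℕ}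
    (hN : ∀ i, k i ≤ N) (f : MvPolynomial σ K) : f ^ p ^ N ∈ frobSub K p k := by
  induction f using MvPolynomial.induction_on with
  | C a =>
    rw [← map_pow]
    exact (frobSub K p k).algebraMap_mem _
  | add f g hf hg => rw [add_pow_char_pow]; exact add_mem hf hg
  | mul_X f i hf =>
    rw [mul_pow]
    refine mul_mem hf ?_
    rw [← Nat.add_sub_cancel' (hN i), pow_add, pow_mul]
    exact pow_mem (Algebra.subset_adjoin (Set.mem_range_self i)) _

theorem commute_mulOp_of_mem_frobSub (p : ℕ) {k : σ → ℕ} {a : DP K σ}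
    (h : ∀ i, Commute a (mulOp K (X i ^ p ^ k i))) {f : MvPolynomial σ K}
    (hf : f ∈ frobSub K p k) : Commute a (mulOp K f) := by
  have : frobSub K p k ≤ (Subalgebra.centralizer K {a}).comap (mulOp K) := by
    rw [Algebra.adjoin_le_iff]
    rintro _ ⟨i, rfl⟩
    change mulOp K _ ∈ Subalgebra.centralizer K {a}
    rw [Subalgebra.mem_centralizer_iff]
    rintro _ rfl
    exact h i
  exact (Subalgebra.mem_centralizer_iff K).1 (this hf) a rfl

theorem hasse_commute_X_pow (p : ℕ) [Fact p.Prime] [CharP K p] {k : ℕ} {i : σ} {β : σ →₀ ℕ}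
    (hβ : β i < p ^ k) : Commute (hasse K β) (mulOp K (X i ^ p ^ k)) := by
  rw [commute_iff_eq, hasse_mul_X_pow, if_neg (by omega), add_zero]

theorem hasse_commute_frobSub (p : ℕ) [Fact p.Prime] [CharP K p] {k : σ → ℕ} {β : σ →₀ ℕ}
    (hβ : ∀ i, β i < p ^ k i) {f : MvPolynomial σ K} (hf : f ∈ frobSub K p k) :
    Commute (hasse K β) (mulOp K f) :=
  commute_mulOp_of_mem_frobSub p (fun i => hasse_commute_X_pow p (hβ i)) hf

/-- A differential operator commutes with all high enough `p`-powers. -/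
theorem exists_commute_frobSub [Finite σ] (p : ℕ) [Fact p.Prime] [CharP K p] (a : DP K σ) :
    ∃ N₀, ∀ N ≥ N₀, ∀ f ∈ frobSub K p (fun _ : σ => N), Commute a (mulOp K f) := by
  have h1 : 1 < p := (Fact.out : p.Prime).one_lt
  cases nonempty_fintype σ
  induction a using DP.induction_mul_hasse with
  | h α β =>
    refine ⟨β.degree, fun N hN f hf => ?_⟩
    refine Commute.mul_left (mulOp_commute _ _) (hasse_commute_frobSub p (fun i => ?_) hf)
    have h2 : β i ≤ β.degree := Finsupp.le_degree i β
    exact (h2.trans hN).trans_lt (Nat.lt_pow_self h1)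
  | hadd a b ha hb =>
    obtain ⟨Na, ha⟩ := ha
    obtain ⟨Nb, hb⟩ := hb
    refine ⟨max Na Nb, fun N hN f hf => Commute.add_left (ha N (by omega) f hf) (hb N (by omega) f hf)⟩
  | hsmul c a ha =>
    obtain ⟨Na, ha⟩ := ha
    exact ⟨Na, fun N hN f hf => (ha N hN f hf).smul_left c⟩

theorem exists_commute_frobSub_finset [Finite σ] (p : ℕ) [Fact p.Prime] [CharP K p]
    (s : Finset (DP K σ)) :
    ∃ N₀, ∀ N ≥ N₀, ∀ a ∈ s, ∀ f ∈ frobSub K p (fun _ : σ => N), Commute a (mulOp K f) := by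
  choose n hn using fun a : DP K σ => exists_commute_frobSub p a
  exact ⟨s.sup n, fun N hN a ha f hf => hn a N ((Finset.le_sup ha).trans hN) f hf⟩

/-- Lucas's theorem with the digits split into the lowest k and the rest. The induction step applies
the one-digit version twice, to n, m and to their residues modulo p^(k+1). -/
theorem choose_modEq_pow (p : ℕ) [Fact p.Prime] (k n m : ℕ) :
    (n.choose m : ℕ) ≡ (n % p ^ k).choose (m % p ^ k) * (n / p ^ k).choose (m / p ^ k) [MOD p] := by
  induction k generalizing n m with
  | zero => simp [Nat.mod_one, Nat.ModEq]
  | succ k ih =>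
    have h1 := Choose.choose_modEq_choose_mod_mul_choose_div_nat (n := n) (k := m) (p := p)
    have h2 := Choose.choose_modEq_choose_mod_mul_choose_div_nat (n := n % p ^ (k + 1))
      (k := m % p ^ (k + 1)) (p := p)
    have e1 : ∀ n, n % p ^ (k + 1) % p = n % p := fun n =>
      Nat.mod_mod_of_dvd _ (dvd_pow_self p (by omega))
    have e2 : ∀ n, n % p ^ (k + 1) / p = n / p % p ^ k := fun n => by
      rw [pow_succ', Nat.mod_mul_right_div_self]
    have e3 : ∀ n, n / p ^ (k + 1) = n / p / p ^ k := fun n => by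
      rw [pow_succ', Nat.div_div_eq_div_mul]
    rw [e1, e1, e2, e2] at h2
    rw [e3, e3]
    refine h1.trans ?_
    refine ((ih (n / p) (m / p)).mul_left _).trans ?_
    rw [← mul_assoc]
    exact h2.symm.mul_right _

/-- `∂^[γ] ∂^[b] = ∂^[γ + b]` if `γ_i` is divisible by `p^k_i` and `b_i < p^k_i`. -/
theorem hasse_mul_hasse_of_dvd [Fintype σ] (p : ℕ) [Fact p.Prime] [CharP K p] {k : σ → ℕ}
    {γ b : σ →₀ ℕ} (hγ : ∀ i, p ^ k i ∣ γ i) (hb : ∀ i, b i < p ^ k i) :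
    hasse K γ * hasse K b = hasse K (γ + b) := by
  rw [hasse_mul_hasse, ← Nat.cast_smul_eq_nsmul K]
  have : (multiChoose (γ + b) γ : K) = (1 : ℕ) := by
    rw [CharP.cast_eq_iff_mod_eq K p]
    change Nat.ModEq p _ _
    rw [multiChoose, ← Finset.prod_const_one (s := (Finset.univ : Finset σ))]
    refine Nat.ModEq.prod fun i _ => ?_
    -- With γ_i = c p^{k_i} the low part is choose(b_i, 0) and the high part choose(c, c), both
    -- equal to 1.
    refine (choose_modEq_pow p (k i) _ _).trans ?_
    obtain ⟨c, hc⟩ := hγ i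
    have hp : 0 < p ^ k i := pow_pos (Fact.out : p.Prime).pos _
    rw [Finsupp.add_apply, hc, Nat.mul_add_mod, Nat.mul_mod_right, Nat.mod_eq_of_lt (hb i),
      Nat.mul_add_div hp, Nat.mul_div_cancel_left _ hp, Nat.div_eq_of_lt (hb i)]
    simp [Nat.ModEq]
  rw [this, Nat.cast_one, one_smul]

/-- `∂^[a] ∂^[b] = 0` if `a_i, b_i < p^k_i` and `a_i + b_i ≥ p^k_i` for some `i`. -/
theorem hasse_mul_hasse_of_overflow [Fintype σ] (p : ℕ) [Fact p.Prime] [CharP K p] {k : σ → ℕ}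
    {a b : σ →₀ ℕ} (ha : ∀ i, a i < p ^ k i) (hb : ∀ i, b i < p ^ k i) {i : σ}
    (hi : p ^ k i ≤ a i + b i) : hasse K a * hasse K b = 0 := by
  rw [hasse_mul_hasse, ← Nat.cast_smul_eq_nsmul K]
  have : (multiChoose (a + b) a : K) = 0 := by
    rw [multiChoose, Nat.cast_prod]
    refine Finset.prod_eq_zero (Finset.mem_univ i) ?_
    rw [CharP.cast_eq_zero_iff K p, ← Nat.modEq_zero_iff_dvd]
    refine (choose_modEq_pow p (k i) _ _).trans ?_
    have h1 := ha i
    have h2 := hb i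
    -- A carry occurs: the low part of a_i + b_i drops below a_i, which makes the low binomial
    -- coefficient zero.
    have : (a i + b i) % p ^ k i = a i + b i - p ^ k i := by
      rw [Nat.mod_eq_sub_mod hi, Nat.mod_eq_of_lt (by omega)]
    rw [Finsupp.add_apply, this, Nat.mod_eq_of_lt h1,
      Nat.choose_eq_zero_of_lt (by omega : a i + b i - p ^ k i < a i), zero_mul]
  rw [this, zero_smul]

/-- The p-fold product is a multiple of ∂_i^[pj], and its last factor contributes the binomial
coefficient of pj over j, which is divisible by p. This forces these operators into every prime
ideal of Λ_ε. -/
theorem partialPow_pow_eq_zero [Fintype σ] (p : ℕ) [Fact p.Prime] [CharP K p] (i : σ) {j : ℕ}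
    (hj : 0 < j) : (partialPow K i j) ^ p = 0 := by
  classical
  have hp : 0 < p := (Fact.out : p.Prime).pos
  have h1 : ∀ r, ∃ c : K, (partialPow K i j) ^ r = c • partialPow K i (r * j) := by
    intro r
    induction r with
    | zero => exact ⟨1, by rw [pow_zero, zero_mul, partialPow, Finsupp.single_zero, hasse_zero, one_smul]⟩
    | succ r ih =>
      obtain ⟨c, hc⟩ := ih
      rw [pow_succ, hc, smul_mul_assoc, partialPow, partialPow, hasse_mul_hasse,
        ← Finsupp.single_add, ← Nat.cast_smul_eq_nsmul K, smul_smul]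
      exact ⟨_, by rw [partialPow, Nat.succ_mul]⟩
  obtain ⟨c, hc⟩ := h1 (p - 1)
  have h2 : partialPow K i ((p - 1) * j) * partialPow K i j = 0 := by
    rw [partialPow, partialPow, hasse_comm, hasse_mul_hasse, ← Finsupp.single_add,
      ← Nat.cast_smul_eq_nsmul K]
    have : j + (p - 1) * j = p * j := by
      obtain ⟨r, rfl⟩ : ∃ r, p = r + 1 := ⟨p - 1, by omega⟩
      rw [Nat.add_sub_cancel]; ring
    rw [this]
    have : (multiChoose (Finsupp.single i (p * j)) (Finsupp.single i j) : K) = 0 := by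
      rw [multiChoose, Nat.cast_prod]
      refine Finset.prod_eq_zero (Finset.mem_univ i) ?_
      rw [Finsupp.single_eq_same, Finsupp.single_eq_same, Nat.choose_mul_right hj.ne',
        Nat.cast_mul, CharP.cast_eq_zero, zero_mul]
    rw [this, zero_smul]
  rw [← Nat.succ_pred_eq_of_pos hp, pow_succ, Nat.pred_eq_sub_one, hc, smul_mul_assoc, h2,
    smul_zero]

end Char

/-! ### The canonical filtration is an algebra filtration -/

section Filtration

open MvPolynomial

variable {K : Type u} [Field K] {σ : Type}

theorem canonFil_mono : Monotone (canonFil K (σ := σ)) := by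
  intro i j hij
  refine Submodule.span_mono ?_
  rintro _ ⟨α, β, h, rfl⟩
  exact ⟨α, β, h.trans hij, rfl⟩

theorem monomial_hasse_mem_canonFil (α β : σ →₀ ℕ) {i : ℕ} (h : α.degree + β.degree ≤ i) :
    mulOp K (monomial α 1) * hasse K β ∈ canonFil K i :=
  Submodule.subset_span ⟨α, β, h, rfl⟩

theorem hasse_mem_canonFil (β : σ →₀ ℕ) {i : ℕ} (h : β.degree ≤ i) :
    hasse K β ∈ canonFil K i := by
  have := monomial_hasse_mem_canonFil (K := K) 0 β (i := i) (by simpa using h)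
  rwa [monomial_zero', map_one, map_one, one_mul] at this

theorem one_mem_canonFil (i : ℕ) : (1 : DP K σ) ∈ canonFil K i := by
  rw [← hasse_zero]
  exact hasse_mem_canonFil 0 (by simp)

/-- Moving ∂^[β] past x^{α'} by the Leibniz rule lowers both exponents, and a product of divided
powers only adds them, so the total degree never grows. -/
theorem canonFil_mul_mem [Fintype σ] (i j : ℕ) (a b : DP K σ) (ha : a ∈ canonFil K i)
    (hb : b ∈ canonFil K j) : a * b ∈ canonFil K (i + j) := by
  classical
  induction ha using Submodule.span_induction with
  | zero => rw [zero_mul]; exact zero_mem _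
  | add x y _ _ hx hy => rw [add_mul]; exact add_mem hx hy
  | smul c x _ hx => rw [smul_mul_assoc]; exact Submodule.smul_mem _ _ hx
  | mem x hx =>
    obtain ⟨α, β, hαβ, rfl⟩ := hx
    induction hb using Submodule.span_induction with
    | zero => rw [mul_zero]; exact zero_mem _
    | add x y _ _ hx hy => rw [mul_add]; exact add_mem hx hy
    | smul c x _ hx => rw [mul_smul_comm]; exact Submodule.smul_mem _ _ hx
    | mem y hy =>
      obtain ⟨α', β', hαβ', rfl⟩ := hy
      have e : mulOp K (monomial α (1 : K)) * hasse K β * (mulOp K (monomial α' 1) * hasse K β') =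
          mulOp K (monomial α (1 : K)) * (hasse K β * mulOp K (monomial α' 1)) * hasse K β' := by
        simp only [mul_assoc]
      rw [e, hasse_mul_mulOp, Finset.mul_sum, Finset.sum_mul]
      refine sum_mem fun ab hab => ?_
      rw [Finset.HasAntidiagonal.mem_antidiagonal] at hab
      have h1 : mulOp K (monomial α 1) * (mulOp K (hasseEnd K ab.1 (monomial α' 1)) *
          hasse K ab.2) * hasse K β' =
          (multiChoose α' ab.1 * multiChoose (ab.2 + β') ab.2) •
            (mulOp K (monomial (α + (α' - ab.1)) (1 : K)) * hasse K (ab.2 + β')) := by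
        rw [← mul_assoc, ← map_mul, hasseEnd_monomial, mul_assoc, hasse_mul_hasse,
          mul_smul_comm, mul_smul_comm, map_nsmul, smul_mul_assoc, smul_smul, monomial_mul, mul_one,
          mul_comm]
      rw [h1]
      refine nsmul_mem (monomial_hasse_mem_canonFil _ _ ?_) _
      have h2 : ab.1.degree + ab.2.degree = β.degree := by rw [← hab, map_add]
      have h3 : (α' - ab.1).degree ≤ α'.degree := Finsupp.degree_mono tsub_le_self
      rw [map_add, map_add]
      omega

theorem isFinFiltration_canonFil [Fintype σ] : IsFinFiltration K (canonFil K (σ := σ)) where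
  mono := canonFil_mono
  exhaustive a := by
    induction a using DP.induction_mul_hasse with
    | h α β => exact ⟨_, monomial_hasse_mem_canonFil α β le_rfl⟩
    | hadd a b ha hb =>
      obtain ⟨i, ha⟩ := ha
      obtain ⟨j, hb⟩ := hb
      exact ⟨max i j, add_mem (canonFil_mono (le_max_left i j) ha)
        (canonFil_mono (le_max_right i j) hb)⟩
    | hsmul c a ha => exact ⟨_, Submodule.smul_mem _ c ha.choose_spec⟩
  one_mem := one_mem_canonFil 0
  mul_mem := canonFil_mul_mem
  finite i := by
    refine FiniteDimensional.span_of_finite K ?_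
    have h1 := Finsupp.finite_of_degree_le (σ := σ) i
    refine ((h1.prod h1).image
      fun x : (σ →₀ ℕ) × (σ →₀ ℕ) => mulOp K (monomial x.1 (1 : K)) * hasse K x.2).subset ?_
    rintro _ ⟨α, β, h, rfl⟩
    refine ⟨(α, β), ⟨?_, ?_⟩, rfl⟩ <;> simp only [Set.mem_ofPred_eq] <;> omega

theorem filEquiv_refl (F : ℕ → Submodule K (DP K σ)) : FilEquiv K F F :=
  ⟨1, 0, 1, 0, one_pos, one_pos, Filter.Eventually.of_forall fun i => by simp⟩

end Filtration
end
end TinyDMod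

namespace TinyDMod
noncomputable section

/-! ### Independence and dimension for families of copies of V -/

section LinAlg

variable {K I V M M' : Type*} [Field K] [AddCommGroup V] [Module K V] [AddCommGroup M] [Module K M]
  [AddCommGroup M'] [Module K M']

theorem range_eq_map_lsingle (s : I → V →ₗ[K] M) (i : I) :
    LinearMap.range (s i) = (LinearMap.range (Finsupp.lsingle i : V →ₗ[K] I →₀ V)).map
      (Finsupp.lsum K s) := by
  rw [← LinearMap.range_comp]
  congr 1
  ext v
  simp

theorem injective_of_lsum {s : I → V →ₗ[K] M}
    (h : Function.Injective (Finsupp.lsum K s)) (i : I) : Function.Injective (s i) := by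
  intro v w hvw
  refine Finsupp.single_injective i (h ?_)
  simpa using hvw

theorem isInternal_of_lsum [DecidableEq I] {s : I → V →ₗ[K] M}
    (h : Function.Bijective (Finsupp.lsum K s)) :
    DirectSum.IsInternal (fun i => LinearMap.range (s i)) := by
  rw [DirectSum.isInternal_submodule_iff_iSupIndep_and_iSup_eq_top]
  simp only [range_eq_map_lsingle s]
  refine ⟨(Finsupp.lsum K s).iSupIndep_map h.1 (iSupIndep_range_lsingle I K V), ?_⟩
  rw [← Submodule.map_iSup, Finsupp.iSup_lsingle_range, Submodule.map_top,
    LinearMap.range_eq_top.2 h.2]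

theorem finrank_iSup_range_of_lsum [FiniteDimensional K V] {s : I → V →ₗ[K] M}
    (h : Function.Injective (Finsupp.lsum K s)) {t : Set I} (ht : t.Finite) :
    Module.finrank K (⨆ i ∈ t, LinearMap.range (s i) : Submodule K M) =
      t.ncard * Module.finrank K V := by
  classical
  have := ht.fintype
  let e : (t →₀ V) →ₗ[K] M := (Finsupp.lsum K s) ∘ₗ (Finsupp.lmapDomain V K Subtype.val)
  have he : Function.Injective e := h.comp (Finsupp.mapDomain_injective Subtype.val_injective)
  have hr : LinearMap.range e = ⨆ i ∈ t, LinearMap.range (s i) := by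
    rw [LinearMap.range_eq_map, ← Finsupp.iSup_lsingle_range, Submodule.map_iSup, iSup_subtype']
    refine iSup_congr fun i => ?_
    rw [← LinearMap.range_comp]
    congr 1
    ext v
    simp [e]
  rw [← hr, LinearMap.finrank_range_of_inj he,
    (Finsupp.linearEquivFunOnFinite K V t).finrank_eq, Module.finrank_pi_fintype]
  rw [Finset.sum_const, smul_eq_mul, Finset.card_univ, ← Nat.card_eq_fintype_card,
    Nat.card_coe_set_eq]

/-- A family of linear maps that is split in a triangular way is independent. -/
theorem lsum_injective_of_triangular (s : I → V →ₗ[K] M) (L : I → M →ₗ[K] M') (d : I → ℕ)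
    (h0 : ∀ i j v, i ≠ j → d j ≤ d i → L i (s j v) = 0)
    (h1 : ∀ i v, L i (s i v) = 0 → v = 0) : Function.Injective (Finsupp.lsum K s) := by
  rw [injective_iff_map_eq_zero]
  intro f hf
  by_contra hne
  -- At an index of maximal d in the support, L_i kills all the other terms of the relation.
  obtain ⟨i, hi, hmax⟩ := Finset.exists_max_image f.support d (Finsupp.support_nonempty_iff.2 hne)
  have h2 : L i (Finsupp.lsum K s f) = L i (s i (f i)) := by
    rw [Finsupp.lsum_apply, Finsupp.sum, map_sum, Finset.sum_eq_single i]
    · exact fun j hj hji => h0 i j _ (Ne.symm hji) (hmax j hj)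
    · exact fun hh => absurd hi hh
  rw [hf, map_zero] at h2
  exact Finsupp.mem_support_iff.1 hi (h1 i _ h2.symm)

end LinAlg

/-! ### Counting weighted lattice points -/

section Count

open PowerSeries

/-- The number of lattice points `δ` with `∑ δ_j w_j ≤ i`. -/
def wcount {ι : Type} [Fintype ι] (w : ι → ℕ) (i : ℕ) : ℕ :=
  {δ : ι → ℕ | ∑ j, δ j * w j ≤ i}.ncard

variable {ι : Type} [Fintype ι]

theorem weight_le_subset [DecidableEq ι] {w : ι → ℕ} (hw : ∀ j, 0 < w j) (i : ℕ) :
    {δ : ι → ℕ | ∑ j, δ j * w j ≤ i} ⊆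
      (Fintype.piFinset fun _ : ι => Finset.range (i + 1) : Finset (ι → ℕ)) := by
  intro δ hδ
  simp only [Finset.mem_coe, Fintype.mem_piFinset, Finset.mem_range, Nat.lt_succ_iff]
  intro j
  have h1 : δ j * w j ≤ ∑ j, δ j * w j :=
    Finset.single_le_sum (f := fun j => δ j * w j) (fun _ _ => Nat.zero_le _) (Finset.mem_univ j)
  exact (Nat.le_mul_of_pos_right _ (hw j)).trans (h1.trans hδ)

theorem finite_weight_le {w : ι → ℕ} (hw : ∀ j, 0 < w j) (i : ℕ) :
    {δ : ι → ℕ | ∑ j, δ j * w j ≤ i}.Finite := by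
  classical
  exact (Finset.finite_toSet _).subset (weight_le_subset hw i)

theorem wcount_le {w : ι → ℕ} (hw : ∀ j, 0 < w j) (i : ℕ) :
    wcount w i ≤ (i + 1) ^ Fintype.card ι := by
  classical
  refine (Set.ncard_le_ncard (weight_le_subset hw i) (Finset.finite_toSet _)).trans ?_
  rw [Set.ncard_coe_finset]
  simp

theorem wcount_congr {κ : Type} [Fintype κ] (e : κ ≃ ι) (w : ι → ℕ) (i : ℕ) :
    wcount (w ∘ e) i = wcount w i := by
  unfold wcount
  rw [← Set.ncard_image_of_injective _ (Equiv.arrowCongr e (Equiv.refl ℕ)).injective]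
  congr 1
  ext δ
  rw [Set.mem_image]
  constructor
  · rintro ⟨δ', h, rfl⟩
    change ∑ j, δ' j * w (e j) ≤ i at h
    change ∑ j, δ' (e.symm j) * w j ≤ i
    rw [← e.sum_comp]
    simpa using h
  · intro h
    refine ⟨δ ∘ e, ?_, ?_⟩
    · change ∑ j, δ (e j) * w (e j) ≤ i
      rwa [e.sum_comp (fun j => δ j * w j)]
    · ext j
      simp [Equiv.arrowCongr]

/-- The points are split by whether the extra coordinate is zero. If it is not, lowering it by one
decreases the weight by `w none`. -/
theorem wcount_option (w : Option ι → ℕ) (hw : ∀ j, 0 < w j) (i : ℕ) :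
    wcount w i = wcount (fun j => w (some j)) i +
      if w none ≤ i then wcount w (i - w none) else 0 := by
  classical
  let f : (ι → ℕ) → (Option ι → ℕ) := fun δ j => j.elim 0 δ
  let g : (Option ι → ℕ) → (Option ι → ℕ) := fun δ j => j.elim (δ none + 1) fun j => δ (some j)
  have hf : Function.Injective f := fun a b h => funext fun j => congrFun h (some j)
  have hg : Function.Injective g := fun a b h => funext fun j => by
    have := congrFun h j
    cases j with
    | none => exact Nat.succ_injective this
    | some j => exact this
  have h1 : ∀ x : ℕ, (if w none ≤ x then wcount w (x - w none) else 0) =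
      {δ : Option ι → ℕ | w none + ∑ j, δ j * w j ≤ x}.ncard := by
    intro x
    split_ifs with h
    · unfold wcount
      congr 1
      ext δ
      simp only [Set.mem_ofPred_eq]
      omega
    · symm
      convert! Set.ncard_empty (Option ι → ℕ)
      ext δ
      simp only [Set.mem_ofPred_eq, Set.mem_empty_iff_false, iff_false]
      omega
  have h2 := Set.ncard_image_of_injective {δ : ι → ℕ | ∑ j, δ j * w (some j) ≤ i} hf
  have h3 := Set.ncard_image_of_injective {δ : Option ι → ℕ | w none + ∑ j, δ j * w j ≤ i} hg
  rw [h1, wcount, wcount, ← h2, ← h3, ← Set.ncard_union_eq ?_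
    ((finite_weight_le (fun j => hw (some j)) i).image _) ?_]
  · congr 1
    ext δ
    simp only [Set.mem_union, Set.mem_image]
    constructor
    · intro h
      change ∑ j, δ j * w j ≤ i at h
      rw [Fintype.sum_option] at h
      by_cases h0 : δ none = 0
      · left
        refine ⟨fun j => δ (some j), ?_, ?_⟩
        · change ∑ j, δ (some j) * w (some j) ≤ i
          omega
        · ext j
          cases j with
          | none => exact h0.symm
          | some j => rfl
      · right
        refine ⟨fun j => j.elim (δ none - 1) fun j => δ (some j), ?_, ?_⟩
        · change w none + ∑ j : Option ι, _ ≤ i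
          rw [Fintype.sum_option]
          obtain ⟨r, hr⟩ := Nat.exists_eq_succ_of_ne_zero h0
          simp only [Option.elim]
          rw [hr, Nat.succ_sub_one]
          rw [hr, Nat.succ_mul] at h
          omega
        · ext j
          cases j with
          | none => exact Nat.succ_pred_eq_of_ne_zero h0
          | some j => rfl
    · rintro (⟨δ', h, rfl⟩ | ⟨δ', h, rfl⟩)
      · change ∑ j, δ' j * w (some j) ≤ i at h
        change ∑ j, f δ' j * w j ≤ i
        rw [Fintype.sum_option]
        simpa [f] using h
      · change w none + ∑ j, δ' j * w j ≤ i at h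
        change ∑ j, g δ' j * w j ≤ i
        rw [Fintype.sum_option] at h ⊢
        simp only [g, Option.elim, Nat.succ_mul]
        omega
  · rw [Set.disjoint_left]
    rintro _ ⟨a, _, rfl⟩ ⟨b, _, h⟩
    exact absurd (congrFun h none) (Nat.succ_ne_zero _)
  · refine ((finite_weight_le hw i).subset fun δ hδ => ?_).image _
    simp only [Set.mem_ofPred_eq] at hδ ⊢
    omega

/-- By `wcount_option`, multiplying the series by 1 - X^{w} for one variable removes that variable.
The factor 1 - X remains at the end because points of weight at most i, not exactly i, are counted.
-/
theorem mk_wcount_mul (w : ι → ℕ) (hw : ∀ j, 0 < w j) :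
    (PowerSeries.mk fun i => (wcount w i : ℚ)) * ((1 - X) * ∏ j, (1 - X ^ w j)) = 1 := by
  refine Finite.induction_empty_option
    (P := fun ι => ∀ [Fintype ι] (w : ι → ℕ), (∀ j, 0 < w j) →
      (PowerSeries.mk fun i => (wcount w i : ℚ)) * ((1 - X) * ∏ j, (1 - X ^ w j)) = 1)
    ?_ ?_ ?_ ι w hw
  · intro α β e ih _ w hw
    have : Fintype α := Fintype.ofEquiv β e.symm
    have := ih (w ∘ e) (fun j => hw _)
    simp only [wcount_congr] at this
    rwa [← e.prod_comp]
  · intro _ w hw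
    rw [Fintype.prod_empty, mul_one]
    convert PowerSeries.mk_one_mul_one_sub_eq_one ℚ using 3
    ext i
    rw [wcount]
    have : {δ : PEmpty → ℕ | ∑ j, δ j * w j ≤ i} = Set.univ := by
      ext δ
      simp
    rw [this, Set.ncard_univ]
    simp
  · intro α _ ih _ w hw
    refine Eq.trans ?_ (ih (fun j => w (some j)) (fun j => hw _))
    rw [show ∏ j, (1 - (X : PowerSeries ℚ) ^ w j) = (1 - X ^ w none) * ∏ j, (1 - X ^ w (some j)) by
      convert Fintype.prod_option _]
    rw [mul_left_comm (1 - X), ← mul_assoc]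
    congr 1
    ext i
    rw [mul_sub, mul_one, map_sub, PowerSeries.coeff_mul_X_pow', PowerSeries.coeff_mk,
      PowerSeries.coeff_mk]
    have h2 := wcount_option w hw i
    split_ifs at h2 ⊢ with h
    · rw [PowerSeries.coeff_mk, sub_eq_iff_eq_add]
      convert congrArg (Nat.cast : ℕ → ℚ) h2 using 1
      · congr!
      · push_cast
        congr!
    · rw [sub_zero, PowerSeries.coeff_mk]
      rw [add_zero] at h2
      convert congrArg (Nat.cast : ℕ → ℚ) h2 using 1
      congr!

theorem wcount_one (i : ℕ) :
    wcount (fun _ : ι => 1) i = (Fintype.card ι + i).choose (Fintype.card ι) := by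
  have h1 := mk_wcount_mul (fun _ : ι => 1) (fun _ => one_pos)
  have h2 := PowerSeries.mk_add_choose_mul_one_sub_pow_eq_one ℚ (d := Fintype.card ι)
  simp only [pow_one, Finset.prod_const, Finset.card_univ, ← pow_succ'] at h1
  have h3 := congrArg (PowerSeries.coeff i) (mul_right_cancel₀ (fun h => by
    rw [h, mul_zero] at h1; exact zero_ne_one h1) (h1.trans h2.symm))
  rw [PowerSeries.coeff_mk, PowerSeries.coeff_mk] at h3
  exact_mod_cast h3

/-- Write δ_j = μ_j (q/w_j) + ρ_j with ρ_j < q/w_j. The weight becomes q ∑ μ_j + ∑ ρ_j w_j, so for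
fixed ρ the points μ are counted without weights. The bound on i ensures that the subtraction is not
truncated. -/
theorem wcount_eq_sum [DecidableEq ι] {w : ι → ℕ} {q : ℕ} (hq : 0 < q) (hw : ∀ j, w j ∣ q) {i : ℕ}
    (hi : ∑ _j : ι, q ≤ i) :
    wcount w i = ∑ ρ : (∀ j, Fin (q / w j)),
      wcount (fun _ : ι => 1) ((i - ∑ j, (ρ j : ℕ) * w j) / q) := by
  have hw0 : ∀ j, 0 < w j := fun j => Nat.pos_of_dvd_of_pos (hw j) hq
  have hqw : ∀ j, q / w j * w j = q := fun j => Nat.div_mul_cancel (hw j)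
  have hpos : ∀ j, 0 < q / w j := fun j => Nat.div_pos (Nat.le_of_dvd hq (hw j)) (hw0 j)
  have key : ∀ (ρ : ∀ j, Fin (q / w j)) (μ : ι → ℕ),
      ∑ j, (μ j * (q / w j) + ρ j) * w j ≤ i ↔
        ∑ j, μ j * 1 ≤ (i - ∑ j, (ρ j : ℕ) * w j) / q := by
    intro ρ μ
    have h1 : ∑ j, (ρ j : ℕ) * w j ≤ i := by
      refine (Finset.sum_le_sum fun j _ => ?_).trans hi
      calc (ρ j : ℕ) * w j ≤ q / w j * w j := Nat.mul_le_mul_right _ (ρ j).2.le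
        _ = q := hqw j
    rw [Nat.le_div_iff_mul_le hq]
    simp only [add_mul, mul_assoc, hqw, mul_one, Finset.sum_add_distrib, ← Finset.sum_mul]
    omega
  have : ∀ ρ : (∀ j, Fin (q / w j)),
      Finite {μ : ι → ℕ // ∑ j, μ j * 1 ≤ (i - ∑ j, (ρ j : ℕ) * w j) / q} := fun ρ =>
    (finite_weight_le (ι := ι) (w := fun _ => 1) (fun _ => one_pos) _).to_subtype
  have hs : ∀ ρ : (∀ j, Fin (q / w j)),
      wcount (fun _ : ι => 1) ((i - ∑ j, (ρ j : ℕ) * w j) / q) =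
        Nat.card {μ : ι → ℕ // ∑ j, μ j * 1 ≤ (i - ∑ j, (ρ j : ℕ) * w j) / q} := fun ρ => rfl
  simp only [hs]
  rw [← Nat.card_sigma]
  refine Nat.card_congr
    { toFun := fun δ => ⟨fun j => ⟨δ.1 j % (q / w j), Nat.mod_lt _ (hpos j)⟩,
        ⟨fun j => δ.1 j / (q / w j), ?_⟩⟩
      invFun := fun x => ⟨fun j => x.2.1 j * (q / w j) + x.1 j, (key _ _).2 x.2.2⟩
      left_inv := ?_
      right_inv := ?_ }
  · rw [← key]
    simp only [Nat.div_add_mod']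
    exact δ.2
  · intro δ
    exact Subtype.ext (funext fun j => Nat.div_add_mod' _ _)
  · rintro ⟨ρ, μ, hμ⟩
    have hm : ∀ j, (μ j * (q / w j) + ρ j) % (q / w j) = ρ j := fun j => by
      rw [Nat.mul_comm, Nat.mul_add_mod, Nat.mod_eq_of_lt (ρ j).2]
    have e1 : (fun j => (⟨(μ j * (q / w j) + ρ j) % (q / w j), Nat.mod_lt _ (hpos j)⟩ :
        Fin (q / w j))) = ρ := funext fun j => Fin.ext (hm j)
    have e2 : (fun j => (μ j * (q / w j) + ρ j) / (q / w j)) = μ := funext fun j => by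
      rw [Nat.mul_comm, Nat.mul_add_div (hpos j), Nat.div_eq_of_lt (ρ j).2, add_zero]
    refine Sigma.ext e1 ?_
    refine (Subtype.heq_iff_coe_eq ?_).2 e2
    intro x
    simp only [hm]

end Count
end
end TinyDMod

namespace TinyDMod
noncomputable section

/-! ### The lattice point count as an almost polynomial -/

section QuasiPolynomial

open Polynomial

/-- The polynomial whose value at `i` is the binomial coefficient `(n + i).choose n`. -/
def choosePoly (n : ℕ) : ℚ[X] := C ((n.factorial : ℚ)⁻¹) * (ascPochhammer ℚ n).comp (X + 1)

theorem choosePoly_eval (n i : ℕ) : (choosePoly n).eval (i : ℚ) = ((n + i).choose n : ℕ) := by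
  rw [choosePoly, eval_mul, eval_C, eval_comp, eval_add, eval_X, eval_one]
  have h1 : (ascPochhammer ℚ n).eval ((i : ℚ) + 1) = ((n.factorial * (n + i).choose n : ℕ) : ℚ) := by
    rw [add_comm n i, ← Nat.ascFactorial_eq_factorial_mul_choose]
    rw [← ascPochhammer_nat_eq_ascFactorial, ascPochhammer_eval_cast]
    push_cast
    rfl
  rw [h1]
  push_cast
  rw [inv_mul_cancel_left₀ (by exact_mod_cast n.factorial_ne_zero)]

/-- The substitution z ↦ (z - b)/q scales the top coefficient by q^{-n} independently of b; hence
all residue classes will share one leading coefficient. Coefficient n is recorded instead of the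
leading coefficient so that such polynomials can be summed. -/
theorem choosePoly_comp_coeff (n q : ℕ) (b : ℚ) (hq : 0 < q) :
    ((choosePoly n).comp (C ((q : ℚ)⁻¹) * (X - C b))).natDegree ≤ n ∧
    ((choosePoly n).comp (C ((q : ℚ)⁻¹) * (X - C b))).coeff n =
      (n.factorial : ℚ)⁻¹ * ((q : ℚ) ^ n)⁻¹ := by
  have hf : (n.factorial : ℚ)⁻¹ ≠ 0 := by simp [n.factorial_ne_zero]
  have hq' : (q : ℚ)⁻¹ ≠ 0 := by simp [hq.ne']
  have h1 : (X + 1 : ℚ[X]).natDegree = 1 := by rw [← C_1, natDegree_X_add_C]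
  have h2 : (choosePoly n).natDegree = n := by
    rw [choosePoly, natDegree_C_mul hf, natDegree_comp, ascPochhammer_natDegree, h1, mul_one]
  have h3 : (choosePoly n).leadingCoeff = (n.factorial : ℚ)⁻¹ := by
    rw [choosePoly, leadingCoeff_mul, leadingCoeff_C, leadingCoeff_comp (by rw [h1]; simp),
      (monic_ascPochhammer ℚ n).leadingCoeff, ← C_1, leadingCoeff_X_add_C]
    simp
  have h4 : (C ((q : ℚ)⁻¹) * (X - C b)).natDegree = 1 := by
    rw [natDegree_C_mul hq', natDegree_X_sub_C]
  have h5 : ((choosePoly n).comp (C ((q : ℚ)⁻¹) * (X - C b))).natDegree = n := by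
    rw [natDegree_comp, h2, h4, mul_one]
  refine ⟨h5.le, ?_⟩
  have h6 : ((choosePoly n).comp (C ((q : ℚ)⁻¹) * (X - C b))).coeff n =
      ((choosePoly n).comp (C ((q : ℚ)⁻¹) * (X - C b))).leadingCoeff := by
    rw [leadingCoeff, h5]
  rw [h6, leadingCoeff_comp (by rw [h4]; simp), h3, leadingCoeff_mul, leadingCoeff_C,
    leadingCoeff_X_sub_C, h2, mul_one, inv_pow]

theorem isAlmostPolynomial_wcount {ι : Type} [Fintype ι] {w : ι → ℕ} {q : ℕ} (hq : 0 < q)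
    (hw : ∀ j, w j ∣ q) {v : ℕ} (hv : 0 < v) :
    IsAlmostPolynomial (fun i => v * wcount w i) q (Fintype.card ι)
      ((v : ℚ) / (((Fintype.card ι).factorial : ℚ) * ∏ j, (w j : ℚ))) := by
  classical
  have hw0 : ∀ j, 0 < w j := fun j => Nat.pos_of_dvd_of_pos (hw j) hq
  set n := Fintype.card ι with hn
  have : NeZero q := ⟨hq.ne'⟩
  have hc : (v : ℚ) / ((n.factorial : ℚ) * ∏ j, (w j : ℚ)) ≠ 0 := by
    refine div_ne_zero (by exact_mod_cast hv.ne') (mul_ne_zero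
      (by exact_mod_cast n.factorial_ne_zero) ?_)
    exact Finset.prod_ne_zero_iff.2 fun j _ => by exact_mod_cast (hw0 j).ne'
  let B : (∀ j, Fin (q / w j)) → ℕ := fun ρ => ∑ j, (ρ j : ℕ) * w j
  have hB : ∀ ρ, B ρ ≤ ∑ _j : ι, q := fun ρ => by
    refine Finset.sum_le_sum fun j _ => ?_
    calc (ρ j : ℕ) * w j ≤ q / w j * w j := Nat.mul_le_mul_right _ (ρ j).2.le
      _ = q := Nat.div_mul_cancel (hw j)
  -- For i in the class r, the remainder of i - B(ρ) modulo q is fixed, namely the representative of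
  -- r - B(ρ). Subtracting it turns the floor of (i - B(ρ))/q into a linear polynomial in i.
  let P : ZMod q → ℚ[X] := fun r => C (v : ℚ) * ∑ ρ : (∀ j, Fin (q / w j)),
    (choosePoly n).comp (C ((q : ℚ)⁻¹) * (X - C ((B ρ + (r - (B ρ : ZMod q)).val : ℕ) : ℚ)))
  have hP1 : ∀ r, (P r).natDegree ≤ n := fun r => by
    refine (natDegree_C_mul_le _ _).trans (natDegree_sum_le_of_forall_le _ _ fun ρ _ => ?_)
    exact (choosePoly_comp_coeff n q _ hq).1
  have hP2 : ∀ r, (P r).coeff n = (v : ℚ) / ((n.factorial : ℚ) * ∏ j, (w j : ℚ)) := fun r => by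
    simp only [P, coeff_C_mul, finsetSum_coeff, (choosePoly_comp_coeff n q _ hq).2]
    rw [Finset.sum_const, Finset.card_univ, Fintype.card_pi, nsmul_eq_mul]
    simp only [Fintype.card_fin]
    -- The number of summands ρ, which cancels the factor q^{-n} of each and leaves the inverse of
    -- the product of the weights.
    have h1 : ((∏ j, (q / w j) : ℕ) : ℚ) = (q : ℚ) ^ n / ∏ j, (w j : ℚ) := by
      rw [Nat.cast_prod, eq_div_iff, ← Finset.prod_mul_distrib]
      · have : ∀ j, ((q / w j : ℕ) : ℚ) * (w j : ℚ) = q := fun j => by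
          exact_mod_cast Nat.div_mul_cancel (hw j)
        simp [this, hn]
      · exact Finset.prod_ne_zero_iff.2 fun j _ => by exact_mod_cast (hw0 j).ne'
    rw [h1]
    have : (q : ℚ) ^ n ≠ 0 := pow_ne_zero _ (by exact_mod_cast hq.ne')
    field_simp
  refine ⟨hq, hc, P, fun r => ?_, ?_⟩
  · have : (P r).natDegree = n := by
      refine le_antisymm (hP1 r) (le_natDegree_of_ne_zero ?_)
      rw [hP2]
      exact hc
    exact ⟨this, by rw [leadingCoeff, this, hP2]⟩
  · filter_upwards [Filter.eventually_ge_atTop (∑ _j : ι, q)] with i hi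
    rw [Nat.cast_mul, wcount_eq_sum hq hw hi]
    simp only [P, eval_mul, eval_C, eval_finsetSum, eval_comp, eval_sub, eval_X, Nat.cast_sum]
    congr 1
    refine Finset.sum_congr rfl fun ρ _ => ?_
    rw [wcount_one, ← choosePoly_eval]
    congr 1
    have h1 : ((i : ZMod q) - (B ρ : ZMod q)).val = (i - B ρ) % q := by
      rw [← Nat.cast_sub ((hB ρ).trans hi), ZMod.val_natCast]
    have h2 := Nat.div_add_mod (i - B ρ) q
    have h3 : ((i - B ρ : ℕ) : ℚ) = i - B ρ := Nat.cast_sub ((hB ρ).trans hi)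
    rw [h1]
    have h4 : (q : ℚ) * ((i - B ρ) / q : ℕ) + ((i - B ρ) % q : ℕ) = (i : ℚ) - B ρ := by
      rw [← h3, ← h2]
      push_cast
      simp only [h2]
    have hq' : (q : ℚ) ≠ 0 := by exact_mod_cast hq.ne'
    rw [eq_inv_mul_iff_mul_eq₀ hq', Nat.cast_add]
    change (q : ℚ) * ((i - B ρ) / q : ℕ) = _
    linarith

/-- Each of the finitely many polynomials has the same limit after division by i^d, so the estimates
hold for all residue classes simultaneously. -/
theorem IsAlmostPolynomial.tendsto {f : ℕ → ℕ} {k d : ℕ} {c : ℚ}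
    (h : IsAlmostPolynomial f k d c) :
    Filter.Tendsto (fun i : ℕ => (f i : ℝ) / (i : ℝ) ^ d) Filter.atTop (nhds (c : ℝ)) := by
  obtain ⟨hk, hc, P, hP, hf⟩ := h
  have : NeZero k := ⟨hk.ne'⟩
  have h1 : ∀ r : ZMod k, Filter.Tendsto
      (fun i : ℕ => ((P r).map (algebraMap ℚ ℝ)).eval (i : ℝ) / (i : ℝ) ^ d) Filter.atTop
        (nhds (c : ℝ)) := by
    intro r
    have hinj := (algebraMap ℚ ℝ).injective
    have h2 : P r ≠ 0 := by
      intro h0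
      have := (hP r).2
      rw [h0, leadingCoeff_zero] at this
      exact hc this.symm
    have h3 := Polynomial.div_tendsto_atTop_leadingCoeff_div_of_degree_eq
      ((P r).map (algebraMap ℚ ℝ)) (X ^ d) (by
        rw [degree_map_eq_of_injective hinj, degree_X_pow, degree_eq_natDegree h2, (hP r).1])
    have h4 := h3.comp tendsto_natCast_atTop_atTop
    rw [leadingCoeff_map_of_injective hinj, (hP r).2, leadingCoeff_X_pow, div_one] at h4
    refine h4.congr fun i => ?_
    simp
  rw [Metric.tendsto_atTop]
  intro e he
  have h2 : ∀ᶠ i : ℕ in Filter.atTop, ∀ r : ZMod k,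
      dist (((P r).map (algebraMap ℚ ℝ)).eval (i : ℝ) / (i : ℝ) ^ d) (c : ℝ) < e :=
    Filter.eventually_all.2 fun r => (Metric.tendsto_nhds.1 (h1 r)) e he
  rw [← Filter.eventually_atTop]
  filter_upwards [h2, hf] with i hi hfi
  have h3 : (f i : ℝ) = ((P (i : ZMod k)).map (algebraMap ℚ ℝ)).eval (i : ℝ) := by
    rw [← map_natCast (algebraMap ℚ ℝ) i, eval_map_algebraMap, aeval_algebraMap_apply]
    rw [← map_natCast (algebraMap ℚ ℝ) (f i), hfi]
    rfl
  rw [h3]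
  exact hi _

end QuasiPolynomial
end
end TinyDMod

namespace TinyDMod
noncomputable section

/-! ### The decompositions D(P_n) = D(P_t) ⊗ D(P_s) and Λ_ε = Λ(t) ⊗ P_s -/

section Splitting

open MvPolynomial

variable {n : ℕ} {ε : Fin n → ℤˣ}

variable (ε) in
/-- The indices are the disjoint union of the negative and the positive ones. -/
def idxEquiv : NegIdx ε ⊕ PosIdx ε ≃ Fin n :=
  Equiv.ofBijective (Sum.elim Subtype.val Subtype.val) (by
    constructor
    · rintro (⟨a, ha⟩ | ⟨a, ha⟩) (⟨b, hb⟩ | ⟨b, hb⟩) h <;> simp only [Sum.elim_inl, Sum.elim_inr] at h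
      · subst h; rfl
      · subst h; rw [ha] at hb; exact absurd hb (by decide)
      · subst h; rw [ha] at hb; exact absurd hb (by decide)
      · subst h; rfl
    · intro i
      rcases Int.units_eq_one_or (ε i) with h | h
      · exact ⟨Sum.inr ⟨i, h⟩, rfl⟩
      · exact ⟨Sum.inl ⟨i, h⟩, rfl⟩)

theorem prod_idx {M : Type*} [CommMonoid M] (f : Fin n → M) :
    ∏ i, f i = (∏ i : NegIdx ε, f i) * ∏ i : PosIdx ε, f i := by
  rw [← (idxEquiv ε).prod_comp, Fintype.prod_sum_type]
  rfl

theorem sum_idx {M : Type*} [AddCommMonoid M] (f : Fin n → M) :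
    ∑ i, f i = (∑ i : NegIdx ε, f i) + ∑ i : PosIdx ε, f i := by
  rw [← (idxEquiv ε).sum_comp, Fintype.sum_sum_type]
  rfl

theorem card_idx : Fintype.card (NegIdx ε) + Fintype.card (PosIdx ε) = n := by
  rw [← Fintype.card_sum, Fintype.card_congr (idxEquiv ε), Fintype.card_fin]

/-- The exponent with given restrictions to the negative and positive indices. -/
def joinIdx (α : NegIdx ε →₀ ℕ) (β : PosIdx ε →₀ ℕ) : Fin n →₀ ℕ :=
  α.mapDomain Subtype.val + β.mapDomain Subtype.val

theorem joinIdx_neg (α : NegIdx ε →₀ ℕ) (β : PosIdx ε →₀ ℕ) (i : NegIdx ε) :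
    joinIdx α β i = α i := by
  rw [joinIdx, Finsupp.add_apply, Finsupp.mapDomain_apply Subtype.val_injective,
    Finsupp.mapDomain_of_notMem_range, add_zero]
  rintro ⟨j, hj⟩
  have h1 := i.2
  rw [← hj, j.2] at h1
  exact absurd h1 (by decide)

theorem joinIdx_pos (α : NegIdx ε →₀ ℕ) (β : PosIdx ε →₀ ℕ) (i : PosIdx ε) :
    joinIdx α β i = β i := by
  rw [joinIdx, Finsupp.add_apply, Finsupp.mapDomain_apply Subtype.val_injective,
    Finsupp.mapDomain_of_notMem_range, zero_add]
  rintro ⟨j, hj⟩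
  have h1 := i.2
  rw [← hj, j.2] at h1
  exact absurd h1 (by decide)

theorem ext_idx {α β : Fin n →₀ ℕ} (h1 : ∀ i : NegIdx ε, α i = β i)
    (h2 : ∀ i : PosIdx ε, α i = β i) : α = β := by
  ext i
  obtain ⟨i, rfl⟩ := (idxEquiv ε).surjective i
  cases i with
  | inl i => exact h1 i
  | inr i => exact h2 i

variable (ε) in
/-- `joinIdx` as an equivalence. -/
def joinEquiv : (NegIdx ε →₀ ℕ) × (PosIdx ε →₀ ℕ) ≃ (Fin n →₀ ℕ) where
  toFun x := joinIdx x.1 x.2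
  invFun α := (α.comapDomain Subtype.val Subtype.val_injective.injOn,
    α.comapDomain Subtype.val Subtype.val_injective.injOn)
  left_inv _ := Prod.ext (Finsupp.ext fun i => joinIdx_neg _ _ i)
    (Finsupp.ext fun i => joinIdx_pos _ _ i)
  right_inv _ := ext_idx (ε := ε) (fun i => joinIdx_neg _ _ i) fun i => joinIdx_pos _ _ i

theorem degree_joinIdx (α : NegIdx ε →₀ ℕ) (β : PosIdx ε →₀ ℕ) :
    (joinIdx α β).degree = α.degree + β.degree := by
  rw [Finsupp.degree_eq_sum, Finsupp.degree_eq_sum, Finsupp.degree_eq_sum, sum_idx (ε := ε)]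
  simp only [joinIdx_neg, joinIdx_pos]

theorem multiChoose_joinIdx (α β : NegIdx ε →₀ ℕ) (α' β' : PosIdx ε →₀ ℕ) :
    multiChoose (joinIdx α α') (joinIdx β β') = multiChoose α β * multiChoose α' β' := by
  unfold multiChoose
  rw [prod_idx (ε := ε)]
  simp only [joinIdx_neg, joinIdx_pos]

theorem joinIdx_sub (α β : NegIdx ε →₀ ℕ) (α' β' : PosIdx ε →₀ ℕ) :
    joinIdx α α' - joinIdx β β' = joinIdx (α - β) (α' - β') := by
  refine ext_idx (ε := ε) (fun i => ?_) fun i => ?_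
  · simp only [Finsupp.tsub_apply, joinIdx_neg]
  · simp only [Finsupp.tsub_apply, joinIdx_pos]

variable (K : Type u) [Field K]

theorem rename_mul_rename (α : NegIdx ε →₀ ℕ) (β : PosIdx ε →₀ ℕ) (c d : K) :
    (rename Subtype.val (monomial α c) * rename Subtype.val (monomial β d) :
      MvPolynomial (Fin n) K) = monomial (joinIdx α β) (c * d) := by
  rw [rename_monomial, rename_monomial, monomial_mul]
  rfl

/-- On monomials the binomial coefficient, the exponent and the monomial all factor along the
splitting of the variables. -/
theorem hasseEnd_rename (β : NegIdx ε →₀ ℕ) (β' : PosIdx ε →₀ ℕ)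
    (f : MvPolynomial (NegIdx ε) K) (g : MvPolynomial (PosIdx ε) K) :
    hasseEnd K (joinIdx β β') (rename Subtype.val f * rename Subtype.val g) =
      rename Subtype.val (hasseEnd K β f) * rename Subtype.val (hasseEnd K β' g) := by
  induction f using MvPolynomial.induction_on' with
  | monomial α c =>
    induction g using MvPolynomial.induction_on' with
    | monomial α' d =>
      rw [rename_mul_rename, hasseEnd_monomial, hasseEnd_monomial, hasseEnd_monomial, map_nsmul,
        map_nsmul, smul_mul_smul_comm, rename_mul_rename, multiChoose_joinIdx, joinIdx_sub]
    | add f g hf hg => simp only [map_add, mul_add, hf, hg]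
  | add f g hf hg => simp only [map_add, add_mul, hf, hg]

variable (ε) in
/-- `P_t ⊗ P_s = P_n`. -/
def polyEquiv : MvPolynomial (NegIdx ε) K ⊗[K] MvPolynomial (PosIdx ε) K ≃ₐ[K]
    MvPolynomial (Fin n) K :=
  (MvPolynomial.tensorEquivSum K (NegIdx ε) (PosIdx ε) K).trans
    (MvPolynomial.renameEquiv K (idxEquiv ε))

theorem polyEquiv_tmul (f : MvPolynomial (NegIdx ε) K) (g : MvPolynomial (PosIdx ε) K) :
    polyEquiv ε K (f ⊗ₜ g) = rename Subtype.val f * rename Subtype.val g := by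
  have h : (polyEquiv ε K).toAlgHom =
      Algebra.TensorProduct.productMap (rename (Subtype.val : NegIdx ε → Fin n))
        (rename (Subtype.val : PosIdx ε → Fin n)) := by
    refine Algebra.TensorProduct.ext' fun f g => ?_
    rw [Algebra.TensorProduct.productMap_apply_tmul]
    have e1 : (polyEquiv ε K).toAlgHom.comp
        Algebra.TensorProduct.includeLeft = rename (Subtype.val : NegIdx ε → Fin n) := by
      ext i
      simp [polyEquiv, idxEquiv]
      rfl
    have e2 : (polyEquiv ε K).toAlgHom.comp
        Algebra.TensorProduct.includeRight = rename (Subtype.val : PosIdx ε → Fin n) := by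
      ext i
      simp [polyEquiv, idxEquiv]
      rfl
    rw [← e1, ← e2]
    simp [← map_mul]
  have := DFunLike.congr_fun h (f ⊗ₜ g)
  rwa [Algebra.TensorProduct.productMap_apply_tmul] at this

variable (ε) in
/-- The action of `D(P_t) ⊗ D(P_s)` on `P_n`. -/
def tensorAct : DP K (NegIdx ε) ⊗[K] DP K (PosIdx ε) →ₐ[K]
    Module.End K (MvPolynomial (Fin n) K) :=
  ((LinearEquiv.conjAlgEquiv K (polyEquiv ε K).toLinearEquiv : _ →ₐ[K] _).comp
    (Module.endTensorEndAlgHom (R := K) (S := K) (A := K) (M := MvPolynomial (NegIdx ε) K)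
      (N := MvPolynomial (PosIdx ε) K))).comp
    (Algebra.TensorProduct.map (Algebra.lsmul K K _) (Algebra.lsmul K K _))

theorem tensorAct_apply (a : DP K (NegIdx ε)) (b : DP K (PosIdx ε))
    (f : MvPolynomial (NegIdx ε) K) (g : MvPolynomial (PosIdx ε) K) :
    tensorAct ε K (a ⊗ₜ b) (rename Subtype.val f * rename Subtype.val g) =
      rename Subtype.val (a • f) * rename Subtype.val (b • g) := by
  rw [← polyEquiv_tmul, ← polyEquiv_tmul]
  simp [tensorAct, LinearEquiv.conjAlgEquiv_apply]
  rfl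

theorem monomial_end_ext {φ ψ : Module.End K (MvPolynomial (Fin n) K)}
    (h : ∀ (f : MvPolynomial (NegIdx ε) K) (g : MvPolynomial (PosIdx ε) K),
      φ (rename Subtype.val f * rename Subtype.val g) =
        ψ (rename Subtype.val f * rename Subtype.val g)) : φ = ψ := by
  refine LinearMap.ext fun f => ?_
  induction f using MvPolynomial.induction_on' with
  | monomial α c =>
    obtain ⟨⟨α, β⟩, rfl⟩ := (joinEquiv ε).surjective α
    change φ (monomial (joinIdx α β) c) = ψ (monomial (joinIdx α β) c)
    rw [← mul_one c, ← rename_mul_rename, h]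
  | add f g hf hg => rw [map_add, map_add, hf, hg]

theorem tensorAct_mulOp_hasse (f : MvPolynomial (NegIdx ε) K) (g : MvPolynomial (PosIdx ε) K)
    (β : NegIdx ε →₀ ℕ) (β' : PosIdx ε →₀ ℕ) :
    tensorAct ε K ((mulOp K f * hasse K β) ⊗ₜ (mulOp K g * hasse K β')) =
      (mulOp K (rename Subtype.val f * rename Subtype.val g) * hasse K (joinIdx β β')).1 := by
  refine monomial_end_ext (ε := ε) K fun x y => ?_
  rw [tensorAct_apply]
  change _ = (mulOp K (rename Subtype.val f * rename Subtype.val g) * hasse K (joinIdx β β')) •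
    (rename Subtype.val x * rename Subtype.val y : MvPolynomial (Fin n) K)
  rw [mulOp_mul_hasse_smul, mulOp_mul_hasse_smul, mulOp_mul_hasse_smul, hasseEnd_rename, map_mul,
    map_mul]
  ring

theorem tensorAct_mem (z : DP K (NegIdx ε) ⊗[K] DP K (PosIdx ε)) :
    tensorAct ε K z ∈ diffOps K (MvPolynomial (Fin n) K) := by
  induction z using TensorProduct.induction_on with
  | zero => rw [map_zero]; exact zero_mem _
  | add x y hx hy => rw [map_add]; exact add_mem hx hy
  | tmul a b =>
    induction a using DP.induction_mul_hasse with
    | hadd a a' h h' => rw [TensorProduct.add_tmul, map_add]; exact add_mem h h'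
    | hsmul c a h => rw [← TensorProduct.smul_tmul', map_smul]; exact Subalgebra.smul_mem _ h c
    | h α β =>
      induction b using DP.induction_mul_hasse with
      | hadd a a' h h' => rw [TensorProduct.tmul_add, map_add]; exact add_mem h h'
      | hsmul c a h => rw [TensorProduct.tmul_smul, map_smul]; exact Subalgebra.smul_mem _ h c
      | h α' β' =>
        rw [tensorAct_mulOp_hasse]
        exact Subtype.prop (p := (· ∈ diffOps K (MvPolynomial (Fin n) K)))
          (mulOp K (rename Subtype.val (monomial α 1) * rename Subtype.val (monomial α' 1)) *
            hasse K (joinIdx β β'))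

variable (ε) in
/-- The natural homomorphism from `D(P_t) ⊗ D(P_s)` to `D(P_n)`. -/
def tensorHom : DP K (NegIdx ε) ⊗[K] DP K (PosIdx ε) →ₐ[K] DP K (Fin n) :=
  (tensorAct ε K).codRestrict (diffOps K (MvPolynomial (Fin n) K)) (tensorAct_mem K)

theorem tensorHom_mulOp_hasse (f : MvPolynomial (NegIdx ε) K) (g : MvPolynomial (PosIdx ε) K)
    (β : NegIdx ε →₀ ℕ) (β' : PosIdx ε →₀ ℕ) :
    tensorHom ε K ((mulOp K f * hasse K β) ⊗ₜ (mulOp K g * hasse K β')) =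
      mulOp K (rename Subtype.val f * rename Subtype.val g) * hasse K (joinIdx β β') :=
  Subtype.ext (tensorAct_mulOp_hasse K f g β β')

/-- The tensor product of the two bases x^α ∂^[β] is carried to the basis of the same kind in all
variables, by a bijection of the index sets. -/
theorem tensorHom_bijective : Function.Bijective (tensorHom ε K) := by
  let b := (DP.basis K (NegIdx ε)).tensorProduct (DP.basis K (PosIdx ε))
  let e : ((NegIdx ε →₀ ℕ) × (NegIdx ε →₀ ℕ)) × ((PosIdx ε →₀ ℕ) × (PosIdx ε →₀ ℕ)) ≃
      (Fin n →₀ ℕ) × (Fin n →₀ ℕ) :=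
    (Equiv.prodProdProdComm _ _ _ _).trans ((joinEquiv ε).prodCongr (joinEquiv ε))
  have h : (tensorHom ε K).toLinearMap = (b.equiv (DP.basis K (Fin n)) e).toLinearMap := by
    refine b.ext fun x => ?_
    rw [LinearEquiv.coe_coe, Module.Basis.equiv_apply, Module.Basis.tensorProduct_apply,
      DP.basis_apply, DP.basis_apply, DP.basis_apply]
    change tensorHom ε K _ = _
    rw [tensorHom_mulOp_hasse, rename_mul_rename, mul_one]
    rfl
  have h2 : ⇑(tensorHom ε K) = ⇑(b.equiv (DP.basis K (Fin n)) e) :=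
    congrArg DFunLike.coe h
  rw [h2]
  exact LinearEquiv.bijective _

variable (ε) in
/-- The isomorphism `D(P_t) ⊗ D(P_s) = D(P_n)`. -/
def tensorIso : DP K (NegIdx ε) ⊗[K] DP K (PosIdx ε) ≃ₐ[K] DP K (Fin n) :=
  AlgEquiv.ofBijective (tensorHom ε K) (tensorHom_bijective K)

theorem tensorIso_smul (a : DP K (NegIdx ε)) (b : DP K (PosIdx ε))
    (f : MvPolynomial (NegIdx ε) K) (g : MvPolynomial (PosIdx ε) K) :
    tensorIso ε K (a ⊗ₜ b) •
      (rename Subtype.val f * rename Subtype.val g : MvPolynomial (Fin n) K) =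
      rename Subtype.val (a • f) * rename Subtype.val (b • g) :=
  tensorAct_apply K a b f g

theorem tensorIso_mulOp_hasse (f : MvPolynomial (NegIdx ε) K) (g : MvPolynomial (PosIdx ε) K)
    (β : NegIdx ε →₀ ℕ) (β' : PosIdx ε →₀ ℕ) :
    tensorIso ε K ((mulOp K f * hasse K β) ⊗ₜ (mulOp K g * hasse K β')) =
      mulOp K (rename Subtype.val f * rename Subtype.val g) * hasse K (joinIdx β β') :=
  tensorHom_mulOp_hasse K f g β β'

theorem tensorIso_mulOp_right (g : MvPolynomial (PosIdx ε) K) :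
    tensorIso ε K (1 ⊗ₜ mulOp K g) = psIncl K ε g := by
  have := tensorIso_mulOp_hasse K (ε := ε) 1 g 0 0
  simp only [hasse_zero, joinIdx, map_one, one_mul, mul_one, Finsupp.mapDomain_zero, add_zero]
    at this
  exact this

theorem tensorIso_hasse_left (β : NegIdx ε →₀ ℕ) :
    tensorIso ε K (hasse K β ⊗ₜ 1) = hasse K (joinIdx β 0) := by
  have := tensorIso_mulOp_hasse K (ε := ε) 1 1 β 0
  simpa [hasse_zero] using this

theorem tensorIso_partialPow (i : NegIdx ε) (j : ℕ) :
    tensorIso ε K (partialPow K i j ⊗ₜ 1) = partialPow K (i : Fin n) j := by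
  rw [partialPow, tensorIso_hasse_left, partialPow, joinIdx, Finsupp.mapDomain_zero, add_zero,
    Finsupp.mapDomain_single]

theorem X_mem_Lam {i : Fin n} (hi : ε i = 1) : mulOp K (X i) ∈ Lam K ε :=
  Algebra.subset_adjoin (Or.inl ⟨i, hi, rfl⟩)

theorem partialPow_mem_Lam {i : Fin n} (hi : ε i = -1) (j : ℕ) : partialPow K i j ∈ Lam K ε :=
  Algebra.subset_adjoin (Or.inr ⟨i, j, hi, rfl⟩)

theorem psIncl_mem_Lam (g : MvPolynomial (PosIdx ε) K) : psIncl K ε g ∈ Lam K ε := by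
  have : (⊤ : Subalgebra K (MvPolynomial (PosIdx ε) K)) ≤ (Lam K ε).comap (psIncl K ε) := by
    rw [← MvPolynomial.adjoin_range_X, Algebra.adjoin_le_iff]
    rintro _ ⟨i, rfl⟩
    change mulOp K (rename Subtype.val (X i)) ∈ Lam K ε
    rw [rename_X]
    exact X_mem_Lam K i.2
  exact this trivial

/-- It suffices to compare generators. In the case where all signs are -1, the generators x_i of
`Lam` do not occur, so the left tensor factor really is Λ(t). -/
theorem lamTensor_map_tensorIso :
    (lamTensor ε).map (tensorIso ε K : _ →ₐ[K] DP K (Fin n)) = Lam K ε := by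
  refine le_antisymm ?_ ?_
  · rintro _ ⟨_, ⟨z, rfl⟩, rfl⟩
    change tensorIso ε K (Algebra.TensorProduct.map (Lam K (fun _ : NegIdx ε => -1)).val
      (mulOp K (σ := PosIdx ε)) z) ∈ Lam K ε
    induction z using TensorProduct.induction_on with
    | zero => rw [map_zero, map_zero]; exact zero_mem _
    | add x y hx hy => rw [map_add, map_add]; exact add_mem hx hy
    | tmul l g =>
      rw [Algebra.TensorProduct.map_tmul, ← mul_one ((Lam K _).val l), ← one_mul (mulOp K g),
        ← Algebra.TensorProduct.tmul_mul_tmul, map_mul, tensorIso_mulOp_right]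
      refine mul_mem ?_ (psIncl_mem_Lam K g)
      have : Lam K (fun _ : NegIdx ε => -1) ≤ (Lam K ε).comap
          ((tensorIso ε K).toAlgHom.comp Algebra.TensorProduct.includeLeft) := by
        refine Algebra.adjoin_le ?_
        rintro _ (⟨i, hi, rfl⟩ | ⟨i, j, -, rfl⟩)
        · exact absurd (show (-1 : ℤˣ) = 1 from hi) (by decide)
        · change tensorIso ε K (partialPow K i j ⊗ₜ 1) ∈ Lam K ε
          rw [tensorIso_partialPow]
          exact partialPow_mem_Lam K i.2 j
      exact this l.2
  · refine Algebra.adjoin_le ?_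
    rintro _ (⟨i, hi, rfl⟩ | ⟨i, j, hi, rfl⟩)
    · refine ⟨1 ⊗ₜ mulOp K (X ⟨i, hi⟩), ⟨1 ⊗ₜ X ⟨i, hi⟩, ?_⟩, ?_⟩
      · change Algebra.TensorProduct.map _ _ _ = _
        rw [Algebra.TensorProduct.map_tmul, map_one]
      · change tensorIso ε K _ = _
        rw [tensorIso_mulOp_right, psIncl, AlgHom.comp_apply, rename_X]
    · refine ⟨partialPow K ⟨i, hi⟩ j ⊗ₜ 1,
        ⟨⟨partialPow K ⟨i, hi⟩ j, Algebra.subset_adjoin (Or.inr ⟨_, _, rfl, rfl⟩)⟩ ⊗ₜ 1, ?_⟩, ?_⟩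
      · change Algebra.TensorProduct.map _ _ _ = _
        rw [Algebra.TensorProduct.map_tmul, map_one]
        rfl
      · exact tensorIso_partialPow K ⟨i, hi⟩ j

end Splitting
end
end TinyDMod

namespace TinyDMod
noncomputable section

/-! ### The simple A(m)-module V(m) -/

section Vmod

set_option linter.unusedSectionVars false

open MvPolynomial

variable {K : Type u} [Field K] {σ : Type} (p : ℕ)
  (m : MaximalSpectrum (MvPolynomial σ K))

theorem X_mem_Am (i : σ) : mulOp K (X i) ∈ Am p m :=
  Algebra.subset_adjoin (Or.inl ⟨i, rfl⟩)

theorem partialPow_mem_Am {i : σ} {j : ℕ} (hj : j < p ^ kExp p m i) : partialPow K i j ∈ Am p m :=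
  Algebra.subset_adjoin (Or.inr ⟨i, j, hj, rfl⟩)

theorem mulOp_mem_Am (f : MvPolynomial σ K) : mulOp K f ∈ Am p m := by
  have : (⊤ : Subalgebra K (MvPolynomial σ K)) ≤ (Am p m).comap (mulOp K) := by
    rw [← MvPolynomial.adjoin_range_X, Algebra.adjoin_le_iff]
    rintro _ ⟨i, rfl⟩
    exact X_mem_Am p m i
  exact this trivial

theorem hasse_add_of_disjoint [Fintype σ] {a b : σ →₀ ℕ} (h : ∀ i, a i = 0 ∨ b i = 0) :
    hasse K a * hasse K b = hasse K (a + b) := by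
  rw [hasse_mul_hasse]
  have : multiChoose (a + b) a = 1 := by
    refine Finset.prod_eq_one fun i _ => ?_
    rcases h i with h | h <;> simp [h]
  rw [this, one_smul]

theorem hasse_mem_Am [Fintype σ] {β : σ →₀ ℕ} (hβ : ∀ i, β i < p ^ kExp p m i) :
    hasse K β ∈ Am p m := by
  induction β using Finsupp.induction with
  | zero => rw [hasse_zero]; exact one_mem _
  | single_add i j β hi hj ih =>
    classical
    rw [← hasse_add_of_disjoint]
    · refine mul_mem (partialPow_mem_Am p m ?_) (ih fun i' => ?_)
      · have := hβ i
        simp only [Finsupp.add_apply, Finsupp.single_eq_same] at this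
        omega
      · have := hβ i'
        simp only [Finsupp.add_apply] at this
        omega
    · intro i'
      by_cases h : i = i'
      · subst h
        exact Or.inr (Finsupp.notMem_support_iff.1 hi)
      · exact Or.inl (by rw [Finsupp.single_apply, if_neg h])

/-- Multiplication operators as elements of `A(m)`. -/
def amMul : MvPolynomial σ K →ₐ[K] Am p m := (mulOp K).codRestrict (Am p m) (mulOp_mem_Am p m)

/-- The exponents `α` with `α_i < p^k_i`. -/
abbrev Box : Type := {α : σ →₀ ℕ // ∀ i, α i < p ^ kExp p m i}

open Classical in
/-- `∂^[β]` as an element of `A(m)`, if all `β_i < p^k_i`. -/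
def amHasse [Fintype σ] (β : σ →₀ ℕ) : Am p m :=
  if h : ∀ i, β i < p ^ kExp p m i then ⟨hasse K β, hasse_mem_Am p m h⟩ else 0

variable {p m} in
theorem coe_amHasse [Fintype σ] {β : σ →₀ ℕ} (h : ∀ i, β i < p ^ kExp p m i) :
    (amHasse p m β : DP K σ) = hasse K β := by
  rw [amHasse, dif_pos h]

/-- The central subalgebra `K[x_1^(p^k_1), …, x_s^(p^k_s)]`. -/
abbrev Zm : Subalgebra K (MvPolynomial σ K) := frobSub K p (kExp p m)

variable {p m} in
theorem mem_centralSet_amMul {z : MvPolynomial σ K} (hz : z ∈ Zm p m) (hm : z ∈ m.asIdeal) :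
    amMul p m z ∈ centralSet p m := ⟨z, hm, hz, rfl⟩

theorem mem_centralSet_iff {a : Am p m} :
    a ∈ centralSet p m ↔ ∃ z ∈ Zm p m, z ∈ m.asIdeal ∧ a = amMul p m z := by
  constructor
  · rintro ⟨z, h1, h2, h3⟩
    exact ⟨z, h2, h1, Subtype.ext h3⟩
  · rintro ⟨z, h1, h2, rfl⟩
    exact ⟨z, h2, h1, rfl⟩

section Commute

variable [Fact p.Prime] [CharP K p]

variable {p m} in
-- The only generators of A(m) to check are ∂_i^[j] with j < p^{k_i}, and these commute with
-- x_i^{p^{k_i}}: the Frobenius power is invisible to low divided powers.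
theorem Am_commute {a : DP K σ} (ha : a ∈ Am p m) {z : MvPolynomial σ K} (hz : z ∈ Zm p m) :
    Commute a (mulOp K z) := by
  have : Am p m ≤ Subalgebra.centralizer K {mulOp K z} := by
    refine Algebra.adjoin_le ?_
    rintro _ (⟨i, rfl⟩ | ⟨i, j, hj, rfl⟩)
    · change _ ∈ Subalgebra.centralizer K {mulOp K z}
      rw [Subalgebra.mem_centralizer_iff]
      rintro _ rfl
      exact mulOp_commute _ _
    · change _ ∈ Subalgebra.centralizer K {mulOp K z}
      rw [Subalgebra.mem_centralizer_iff]
      rintro _ rfl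
      refine (hasse_commute_frobSub p (fun i' => ?_) hz).symm
      classical
      rw [Finsupp.single_apply]
      split_ifs with h
      · rwa [← h]
      · exact pow_pos (Fact.out : p.Prime).pos _
  exact ((Subalgebra.mem_centralizer_iff K).1 (this ha) _ rfl).symm

variable {p m} in
theorem amMul_commute (a : Am p m) {z : MvPolynomial σ K} (hz : z ∈ Zm p m) :
    Commute a (amMul p m z) :=
  Subtype.ext (Am_commute a.2 hz)

variable {p m} in
theorem Zm_smul_comm (a : DP K σ) (ha : a ∈ Am p m) {z : MvPolynomial σ K} (hz : z ∈ Zm p m)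
    (f : MvPolynomial σ K) : a • (z * f) = z * (a • f) := by
  rw [← mulOp_smul, ← mul_smul, (Am_commute ha hz).eq, mul_smul, mulOp_smul]

end Commute

/-- The generator of `V(m)`. -/
def vOne : Vm p m := Submodule.Quotient.mk (p := vIdeal p m) 1

/-- The map from the polynomial algebra to `V(m)`. -/
def vMap : MvPolynomial σ K →ₗ[K] Vm p m :=
  (LinearMap.toSpanSingleton (Am p m) (Vm p m) (vOne p m)).restrictScalars K ∘ₗ
    (amMul p m).toLinearMap

theorem vMap_apply (f : MvPolynomial σ K) : vMap p m f = amMul p m f • vOne p m := rfl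

theorem vMap_one : vMap p m 1 = vOne p m := by rw [vMap_apply, map_one, one_smul]

theorem amMul_smul_vMap (f g : MvPolynomial σ K) : amMul p m f • vMap p m g = vMap p m (f * g) := by
  rw [vMap_apply, vMap_apply, map_mul, mul_smul]

theorem smul_vOne_eq_zero {a : Am p m} (ha : a ∈ vIdeal p m) : a • vOne p m = 0 := by
  change (Submodule.Quotient.mk (a • 1) : Am p m ⧸ vIdeal p m) = 0
  rw [Submodule.Quotient.mk_eq_zero, smul_eq_mul, mul_one]
  exact ha

variable {p m} in
theorem amHasse_smul_vOne [Fintype σ] {β : σ →₀ ℕ} (hβ : β ≠ 0) :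
    amHasse p m β • vOne p m = 0 := by
  by_cases h : ∀ i, β i < p ^ kExp p m i
  · exact smul_vOne_eq_zero p m (Ideal.subset_span (Or.inr ⟨β, hβ, h, coe_amHasse h⟩))
  · rw [amHasse, dif_neg h, zero_smul]

theorem vMap_eq_zero {z : MvPolynomial σ K} (hz : z ∈ Zm p m) (hm : z ∈ m.asIdeal) :
    vMap p m z = 0 :=
  smul_vOne_eq_zero p m (Ideal.subset_span (Or.inl (mem_centralSet_amMul hz hm)))

variable [Fact p.Prime] [CharP K p] [Fintype σ]

theorem amHasse_zero : amHasse p m 0 = 1 :=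
  Subtype.ext (by
    rw [coe_amHasse fun i => pow_pos (Fact.out : p.Prime).pos _, hasse_zero]
    rfl)

variable {p m} in
-- In the Leibniz expansion of ∂^[β] f every term with a remaining divided power kills the generator
-- of V(m); only the term where all of ∂^[β] falls on f survives.
theorem amHasse_smul_vMap {β : σ →₀ ℕ} (h : ∀ i, β i < p ^ kExp p m i) (f : MvPolynomial σ K) :
    amHasse p m β • vMap p m f = vMap p m (hasseEnd K β f) := by
  classical
  have h1 : amHasse p m β * amMul p m f =
      ∑ ab ∈ Finset.HasAntidiagonal.antidiagonal β,
        amMul p m (hasseEnd K ab.1 f) * amHasse p m ab.2 := by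
    refine Subtype.ext ?_
    have : (↑(∑ ab ∈ Finset.HasAntidiagonal.antidiagonal β,
        amMul p m (hasseEnd K ab.1 f) * amHasse p m ab.2) : DP K σ) =
        ∑ ab ∈ Finset.HasAntidiagonal.antidiagonal β,
          ((amMul p m (hasseEnd K ab.1 f) * amHasse p m ab.2 : Am p m) : DP K σ) :=
      map_sum (Am p m).val _ _
    rw [this]
    change (amHasse p m β : DP K σ) * mulOp K f = _
    rw [coe_amHasse h, hasse_mul_mulOp]
    refine Finset.sum_congr rfl fun ab hab => ?_
    rw [Finset.HasAntidiagonal.mem_antidiagonal] at hab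
    change _ = mulOp K _ * (amHasse p m ab.2 : DP K σ)
    rw [coe_amHasse fun i => ?_]
    refine lt_of_le_of_lt ?_ (h i)
    rw [← hab]
    exact Nat.le_add_left _ _
  rw [vMap_apply, ← mul_smul, h1, Finset.sum_smul, Finset.sum_eq_single (β, 0)]
  · rw [amHasse_zero, mul_one, vMap_apply]
  · rintro ⟨a, b⟩ hab hne
    rw [Finset.HasAntidiagonal.mem_antidiagonal] at hab
    rw [mul_smul, amHasse_smul_vOne, smul_zero]
    rintro rfl
    apply hne
    rw [← hab, add_zero]
  · intro hh
    exact absurd (by simp) hh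

/-- Checked on generators of A(m). It makes V(m) a quotient of the natural module P_s, so that V(m)
can be studied by differentiating polynomials. -/
theorem smul_vMap (a : Am p m) (f : MvPolynomial σ K) :
    a • vMap p m f = vMap p m ((a : DP K σ) • f) := by
  obtain ⟨a, ha⟩ := a
  change (⟨a, ha⟩ : Am p m) • vMap p m f = vMap p m (a • f)
  induction ha using Algebra.adjoin_induction generalizing f with
  | mem x hx =>
    rcases hx with ⟨i, rfl⟩ | ⟨i, j, hj, rfl⟩
    · exact amMul_smul_vMap p m (X i) f
    · have hb : ∀ i', Finsupp.single i j i' < p ^ kExp p m i' := by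
        classical
        intro i'
        rw [Finsupp.single_apply]
        split_ifs with h
        · rwa [← h]
        · exact pow_pos (Fact.out : p.Prime).pos _
      have h1 := amHasse_smul_vMap hb f
      rw [amHasse, dif_pos hb] at h1
      exact h1
  | algebraMap r =>
    change (algebraMap K (Am p m) r) • vMap p m f = vMap p m (algebraMap K (DP K σ) r • f)
    rw [algebraMap_smul, algebraMap_smul, map_smul]
  | add x y hx hy h1 h2 =>
    rw [add_smul, map_add, ← h1, ← h2, ← add_smul]
    rfl
  | mul x y hx hy h1 h2 =>
    rw [mul_smul, ← h1, ← h2, ← mul_smul]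
    rfl

theorem vMap_surjective : Function.Surjective (vMap p m) := by
  intro v
  obtain ⟨a, rfl⟩ := Submodule.Quotient.mk_surjective (vIdeal p m) v
  refine ⟨(a : DP K σ) • 1, ?_⟩
  rw [← smul_vMap, vMap_one]
  change (Submodule.Quotient.mk (a • 1) : Am p m ⧸ vIdeal p m) = _
  rw [smul_eq_mul, mul_one]

/-- The generators behave well on the polynomial 1: ∂^[β] kills it, and elements of Z ∩ m are
central and land in m. Its purpose is to show that V(m) is not zero. -/
theorem smul_one_mem_of_mem_vIdeal {a : Am p m} (ha : a ∈ vIdeal p m) :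
    (a : DP K σ) • (1 : MvPolynomial σ K) ∈ m.asIdeal := by
  -- The ideal m need not be stable under A(m), so the induction carries an arbitrary left factor b.
  have h : ∀ b : Am p m, ((b * a : Am p m) : DP K σ) • (1 : MvPolynomial σ K) ∈ m.asIdeal := by
    refine Submodule.span_induction (p := fun a _ => ∀ b : Am p m,
      ((b * a : Am p m) : DP K σ) • (1 : MvPolynomial σ K) ∈ m.asIdeal) ?_ ?_ ?_ ?_ ha
    · rintro x (hx | ⟨β, hβ, hβ', hx⟩) b
      · obtain ⟨z, hz, hzm, rfl⟩ := (mem_centralSet_iff p m).1 hx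
        change ((b : DP K σ) * mulOp K z) • (1 : MvPolynomial σ K) ∈ m.asIdeal
        rw [mul_smul, mulOp_smul, Zm_smul_comm _ b.2 hz]
        exact Ideal.mul_mem_right _ _ hzm
      · change ((b : DP K σ) * (x : DP K σ)) • (1 : MvPolynomial σ K) ∈ m.asIdeal
        have h1 : hasseEnd K β (1 : MvPolynomial σ K) = 0 := by
          have := hasseEnd_monomial (K := K) β 0 1
          rw [multiChoose_eq_zero (by simpa using hβ), zero_smul] at this
          exact this
        rw [hx, mul_smul, hasse_smul, h1, smul_zero]
        exact zero_mem _
    · intro b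
      rw [mul_zero]
      change (0 : DP K σ) • (1 : MvPolynomial σ K) ∈ _
      rw [zero_smul]
      exact zero_mem _
    · intro x y _ _ hx hy b
      rw [mul_add]
      change ((b * x : Am p m) + (b * y : Am p m) : DP K σ) • (1 : MvPolynomial σ K) ∈ _
      rw [add_smul]
      exact add_mem (hx b) (hy b)
    · intro c x _ hx b
      rw [smul_eq_mul, ← mul_assoc]
      exact hx _
  have := h 1
  rwa [one_mul] at this

theorem vOne_ne_zero : vOne p m ≠ 0 := by
  intro h
  have h1 : (1 : Am p m) ∈ vIdeal p m := (Submodule.Quotient.mk_eq_zero (vIdeal p m)).1 h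
  have h2 := smul_one_mem_of_mem_vIdeal p m h1
  change (1 : DP K σ) • (1 : MvPolynomial σ K) ∈ _ at h2
  rw [one_smul] at h2
  exact m.isMaximal.ne_top ((Ideal.eq_top_iff_one _).2 h2)

variable {p m} in
/-- Elements of the central subalgebra outside of `m` are invertible modulo `m`. -/
theorem exists_inv_of_notMem {z : MvPolynomial σ K} (hz : z ∈ Zm p m)
    (hm : z ∉ m.asIdeal) : ∃ z' ∈ Zm p m, z' * z - 1 ∈ m.asIdeal := by
  have := m.isMaximal
  obtain ⟨g, hg⟩ := Ideal.Quotient.exists_inv (I := m.asIdeal) (a := Ideal.Quotient.mk _ z)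
    (by rwa [Ne, Ideal.Quotient.eq_zero_iff_mem])
  obtain ⟨g, rfl⟩ := Ideal.Quotient.mk_surjective g
  set N := Finset.univ.sup (kExp p m)
  have hN : ∀ i, kExp p m i ≤ N := fun i => Finset.le_sup (Finset.mem_univ i)
  have hp := (Fact.out : p.Prime).pos
  -- With g inverse to z modulo m, the product of this element and z is (gz)^{p^N} ≡ 1; the exponent
  -- p^N brings g into Z.
  refine ⟨g ^ p ^ N * z ^ (p ^ N - 1), mul_mem (pow_mem_frobSub p hN g) (pow_mem hz _), ?_⟩
  rw [mul_assoc, ← pow_succ, Nat.sub_add_cancel (pow_pos hp N), ← mul_pow,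
    ← Ideal.Quotient.eq_zero_iff_mem, map_sub, map_pow, map_mul, mul_comm, hg, one_pow, map_one,
    sub_self]

variable {p m} in
theorem exists_smul_vMap_eq_vOne {z : MvPolynomial σ K} (hz : z ∈ Zm p m)
    (hm : z ∉ m.asIdeal) : ∃ z', amMul p m z' • vMap p m z = vOne p m := by
  obtain ⟨z', hz', h⟩ := exists_inv_of_notMem hz hm
  refine ⟨z', ?_⟩
  have h1 := vMap_eq_zero p m (sub_mem (mul_mem hz' hz) (one_mem _)) h
  rw [map_sub, vMap_one, sub_eq_zero] at h1
  rw [amMul_smul_vMap, h1]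

variable {p m} in
theorem vMap_eq_zero_iff {z : MvPolynomial σ K} (hz : z ∈ Zm p m) :
    vMap p m z = 0 ↔ z ∈ m.asIdeal := by
  refine ⟨fun h => ?_, vMap_eq_zero p m hz⟩
  by_contra hm
  obtain ⟨z', hz'⟩ := exists_smul_vMap_eq_vOne hz hm
  rw [h, smul_zero] at hz'
  exact vOne_ne_zero p m hz'.symm

/-- The map from the central subalgebra to `V(m)`. -/
def zMap : Zm p m →ₗ[K] Vm p m := vMap p m ∘ₗ (Zm p m).val.toLinearMap

/-- The lines `x^α Z ⊆ V(m)`. -/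
def boxMap (α : Box p m) : LinearMap.range (zMap p m) →ₗ[K] Vm p m :=
  (Algebra.lsmul K K (Vm p m) (amMul p m (monomial α.1 1))) ∘ₗ (LinearMap.range (zMap p m)).subtype

variable {p m} in
-- Coefficients in Z pass through ∂^[β], so only the value of ∂^[β] on x^α matters, and this is 1 or
-- 0 in the given range of degrees.
theorem amHasse_boxMap (α β : Box p m) (h : α.1.degree ≤ β.1.degree)
    (v : LinearMap.range (zMap p m)) [Decidable (α = β)] :
    amHasse p m β.1 • boxMap p m α v = if α = β then (v : Vm p m) else 0 := by
  classical
  obtain ⟨_, z, rfl⟩ := v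
  change amHasse p m β.1 • amMul p m (monomial α.1 1) • vMap p m z = if _ then vMap p m z else _
  rw [amMul_smul_vMap, amHasse_smul_vMap β.2, ← hasse_smul, mul_comm,
    Zm_smul_comm _ (hasse_mem_Am p m β.2) z.2, hasse_smul, hasseEnd_monomial_of_degree_le h]
  have h1 : α = β ↔ α.1 = β.1 := Subtype.ext_iff
  simp only [h1]
  split_ifs
  · rw [mul_one]
  · rw [mul_zero, map_zero]

theorem lsum_boxMap_injective : Function.Injective (Finsupp.lsum K (boxMap p m)) := by
  classical
  refine lsum_injective_of_triangular _
    (fun β => Algebra.lsmul K K (Vm p m) (amHasse p m β.1)) (fun α => α.1.degree) ?_ ?_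
  · intro β α v hne h
    exact (amHasse_boxMap _ _ h v).trans (if_neg hne.symm)
  · intro β v h
    exact Subtype.ext (((amHasse_boxMap _ _ le_rfl v).trans (if_pos rfl)).symm.trans h)

theorem lsum_boxMap_surjective : Function.Surjective (Finsupp.lsum K (boxMap p m)) := by
  classical
  intro v
  obtain ⟨f, rfl⟩ := vMap_surjective p m v
  rw [← LinearMap.mem_range]
  have hp : ∀ i, 0 < p ^ kExp p m i := fun i => pow_pos (Fact.out : p.Prime).pos _
  induction f using MvPolynomial.induction_on' with
  | add f g hf hg => rw [map_add]; exact add_mem hf hg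
  | monomial α c =>
    -- Division of each exponent by p^{k_i}: the remainder gives the box index, the quotient goes
    -- into Z.
    let r : Box p m := ⟨Finsupp.equivFunOnFinite.symm fun i => α i % p ^ kExp p m i,
      fun i => Nat.mod_lt _ (hp i)⟩
    let z : MvPolynomial σ K := C c * ∏ i, (X i ^ p ^ kExp p m i) ^ (α i / p ^ kExp p m i)
    have hz : z ∈ Zm p m := mul_mem ((Zm p m).algebraMap_mem c)
      (prod_mem fun i _ => pow_mem (Algebra.subset_adjoin (Set.mem_range_self i)) _)
    have e : monomial α c = monomial r.1 1 * z := by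
      rw [monomial_eq, monomial_eq, Finsupp.prod_fintype _ _ (by simp),
        Finsupp.prod_fintype _ _ (by simp), map_one, one_mul, mul_left_comm,
        ← Finset.prod_mul_distrib]
      congr 1
      refine Finset.prod_congr rfl fun i _ => ?_
      rw [← pow_mul, ← pow_add]
      congr 1
      exact (Nat.mod_add_div _ _).symm
    refine ⟨Finsupp.single r ⟨vMap p m z, ⟨z, hz⟩, rfl⟩, ?_⟩
    rw [Finsupp.lsum_single]
    exact (amMul_smul_vMap p m (monomial r.1 1) z).trans (congrArg (vMap p m) e.symm)

variable {p m} in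
/-- Every nonzero element of `V(m)` is mapped to a nonzero element of `Z` by some `∂^[β]`, which
can be taken different from `1` unless the element is in `Z`. -/
theorem exists_amHasse_smul {v : Vm p m} (hv : v ≠ 0) :
    ∃ β : Box p m, ∃ z ∈ Zm p m, z ∉ m.asIdeal ∧ amHasse p m β.1 • v = vMap p m z ∧
      (β.1 = 0 → v = vMap p m z) := by
  classical
  obtain ⟨f, rfl⟩ := lsum_boxMap_surjective p m v
  have hf : f ≠ 0 := fun h => hv (by rw [h, map_zero])
  obtain ⟨β, hβ, hmax⟩ := Finset.exists_max_image f.support (fun α => α.1.degree)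
    (Finsupp.support_nonempty_iff.2 hf)
  have h1 : amHasse p m β.1 • Finsupp.lsum K (boxMap p m) f = f β := by
    rw [Finsupp.lsum_apply, Finsupp.sum, Finset.smul_sum, Finset.sum_eq_single β]
    · rw [amHasse_boxMap _ _ le_rfl, if_pos rfl]
    · exact fun α hα hne => by rw [amHasse_boxMap _ _ (hmax α hα), if_neg hne]
    · exact fun hh => absurd hβ hh
  obtain ⟨z, hz⟩ := (f β).2
  have hz' : vMap p m z = f β := hz
  refine ⟨β, z, z.2, ?_, by rw [h1, hz'], ?_⟩
  · rw [← vMap_eq_zero_iff z.2, hz']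
    exact fun h => Finsupp.mem_support_iff.1 hβ (Subtype.ext h)
  · intro h0
    rw [hz', ← h1, h0, amHasse_zero, one_smul]

variable {p m} in
theorem exists_smul_eq_vOne {v : Vm p m} (hv : v ≠ 0) : ∃ a : Am p m, a • v = vOne p m := by
  obtain ⟨β, z, hz, hzm, h, -⟩ := exists_amHasse_smul hv
  obtain ⟨z', hz'⟩ := exists_smul_vMap_eq_vOne hz hzm
  exact ⟨amMul p m z' * amHasse p m β.1, by rw [mul_smul, h, hz']⟩

variable {p m} in
-- If the operator provided by `exists_amHasse_smul` were not ∂^[0] = 1, it would kill v,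
-- contradicting that its value is a class outside m. This will confine the images of the generator
-- under endomorphisms of U(m).
theorem exists_vMap_eq {v : Vm p m}
    (hv : ∀ β : σ →₀ ℕ, β ≠ 0 → (∀ i, β i < p ^ kExp p m i) → amHasse p m β • v = 0) :
    ∃ z ∈ Zm p m, v = vMap p m z := by
  by_cases h : v = 0
  · exact ⟨0, zero_mem _, by rw [h, map_zero]⟩
  obtain ⟨β, z, hz, hzm, h1, h2⟩ := exists_amHasse_smul h
  refine ⟨z, hz, h2 ?_⟩
  by_contra h0
  rw [hv β.1 h0 β.2, eq_comm, vMap_eq_zero_iff hz] at h1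
  exact hzm h1

theorem exists_smul_vOne (v : Vm p m) : ∃ a : Am p m, a • vOne p m = v := by
  obtain ⟨f, rfl⟩ := vMap_surjective p m v
  exact ⟨_, rfl⟩

instance isSimpleModule_Vm : IsSimpleModule (Am p m) (Vm p m) := by
  rw [isSimpleModule_iff_toSpanSingleton_surjective]
  refine ⟨⟨⟨_, _, vOne_ne_zero p m⟩⟩, fun v hv w => ?_⟩
  obtain ⟨a, ha⟩ := exists_smul_eq_vOne hv
  obtain ⟨b, hb⟩ := exists_smul_vOne p m w
  exact ⟨b * a, by rw [LinearMap.toSpanSingleton_apply, mul_smul, ha, hb]⟩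

theorem centralSet_smul {a : Am p m} (ha : a ∈ centralSet p m) (v : Vm p m) : a • v = 0 := by
  obtain ⟨z, hz, hzm, rfl⟩ := (mem_centralSet_iff p m).1 ha
  obtain ⟨b, rfl⟩ := exists_smul_vOne p m v
  rw [← mul_smul, ← (amMul_commute b hz).eq, mul_smul]
  change b • vMap p m z = 0
  rw [vMap_eq_zero p m hz hzm, smul_zero]

section Universal

variable {W : Type*} [AddCommGroup W] [Module (Am p m) W]

variable {p m} in
/-- An `A(m)`-module with an element annihilated by the generators of the ideal defining `V(m)`
receives a homomorphism from `V(m)`. -/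
def vLift (w : W) (h1 : ∀ a ∈ centralSet p m, a • w = 0)
    (h2 : ∀ β : σ →₀ ℕ, β ≠ 0 → (∀ i, β i < p ^ kExp p m i) → amHasse p m β • w = 0) :
    Vm p m →ₗ[Am p m] W :=
  Submodule.liftQ (vIdeal p m) (LinearMap.toSpanSingleton (Am p m) W w) (by
    refine Submodule.span_le.2 ?_
    rintro a (ha | ⟨β, hβ, hβ', ha⟩)
    · exact h1 a ha
    · have : a = amHasse p m β := Subtype.ext (by rw [ha, coe_amHasse hβ'])
      rw [this]
      exact h2 β hβ hβ')

variable {p m} in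
theorem vLift_vOne (w : W) (h1 : ∀ a ∈ centralSet p m, a • w = 0)
    (h2 : ∀ β : σ →₀ ℕ, β ≠ 0 → (∀ i, β i < p ^ kExp p m i) → amHasse p m β • w = 0) :
    vLift w h1 h2 (vOne p m) = w :=
  one_smul _ w

variable {p m} in
-- Take β₀ of maximal degree in the box with ∂^[β₀] w ≠ 0. A further ∂^[β] either gives a multiple
-- of ∂^[β + β₀] w, zero by maximality, or leaves the box, where the product of the two operators is
-- already zero. Centrality of Z preserves annihilation by Z ∩ m.
theorem exists_amHasse_annihilated {w : W} (hw : w ≠ 0) (h1 : ∀ a ∈ centralSet p m, a • w = 0) :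
    ∃ β₀ : σ →₀ ℕ, (∀ i, β₀ i < p ^ kExp p m i) ∧ amHasse p m β₀ • w ≠ 0 ∧
      (∀ a ∈ centralSet p m, a • amHasse p m β₀ • w = 0) ∧
      ∀ β : σ →₀ ℕ, β ≠ 0 → (∀ i, β i < p ^ kExp p m i) →
        amHasse p m β • amHasse p m β₀ • w = 0 := by
  classical
  have hfin : {β : σ →₀ ℕ | (∀ i, β i < p ^ kExp p m i) ∧ amHasse p m β • w ≠ 0}.Finite := by
    refine (Finsupp.finite_of_degree_le (σ := σ) (∑ i, p ^ kExp p m i)).subset fun β hβ => ?_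
    change β.degree ≤ _
    rw [Finsupp.degree_eq_sum]
    exact Finset.sum_le_sum fun i _ => (hβ.1 i).le
  obtain ⟨β₀, hβ₀, hmax⟩ := Finset.exists_max_image hfin.toFinset (fun β => β.degree)
    ⟨0, by
      rw [Set.Finite.mem_toFinset]
      exact ⟨fun i => pow_pos (Fact.out : p.Prime).pos _, by rwa [amHasse_zero, one_smul]⟩⟩
  rw [Set.Finite.mem_toFinset] at hβ₀
  refine ⟨β₀, hβ₀.1, hβ₀.2, fun a ha => ?_, fun β hβ hβ' => ?_⟩
  · obtain ⟨z, hz, hzm, rfl⟩ := (mem_centralSet_iff p m).1 ha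
    rw [← mul_smul, ← (amMul_commute _ hz).eq, mul_smul, h1 _ ha, smul_zero]
  · rw [← mul_smul]
    by_cases hbox : ∀ i, (β + β₀) i < p ^ kExp p m i
    · have e : amHasse p m β * amHasse p m β₀ =
          multiChoose (β + β₀) β • amHasse p m (β + β₀) := Subtype.ext (by
        change (amHasse p m β : DP K σ) * (amHasse p m β₀ : DP K σ) = _
        have : ((multiChoose (β + β₀) β • amHasse p m (β + β₀) : Am p m) : DP K σ) =
          multiChoose (β + β₀) β • (amHasse p m (β + β₀) : DP K σ) :=
            map_nsmul (Am p m).val _ _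
        rw [this, coe_amHasse hβ', coe_amHasse hβ₀.1, coe_amHasse hbox, hasse_mul_hasse])
      have h2 : amHasse p m (β + β₀) • w = 0 := by
        by_contra hne
        have h3 := hmax (β + β₀) (by
          rw [Set.Finite.mem_toFinset]
          exact ⟨hbox, hne⟩)
        rw [map_add] at h3
        exact hβ ((Finsupp.degree_eq_zero_iff β).1 (by omega))
      rw [e, smul_assoc, h2, smul_zero]
    · push Not at hbox
      obtain ⟨i, hi⟩ := hbox
      have e : amHasse p m β * amHasse p m β₀ = 0 := Subtype.ext (by
        change (amHasse p m β : DP K σ) * (amHasse p m β₀ : DP K σ) = _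
        rw [coe_amHasse hβ', coe_amHasse hβ₀.1,
          hasse_mul_hasse_of_overflow p hβ' hβ₀.1 (i := i) hi]
        rfl)
      rw [e, zero_smul]

theorem nonempty_equiv_Vm [IsSimpleModule (Am p m) W]
    (h : ∀ a ∈ centralSet p m, ∀ w : W, a • w = 0) : Nonempty (W ≃ₗ[Am p m] Vm p m) := by
  have := IsSimpleModule.nontrivial (Am p m) W
  obtain ⟨w, hw⟩ := exists_ne (0 : W)
  obtain ⟨β, -, h1, h2, h3⟩ := exists_amHasse_annihilated hw fun a ha => h a ha w
  refine ⟨(LinearEquiv.ofBijective (vLift _ h2 h3) (LinearMap.bijective_of_ne_zero ?_)).symm⟩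
  intro h0
  apply h1
  rw [← vLift_vOne _ h2 h3, h0, LinearMap.zero_apply]

end Universal

end Vmod
end
end TinyDMod

namespace TinyDMod
noncomputable section

/-! ### The residue field, its separable part, and the dimension of V(m) -/

section Residue

set_option linter.unusedSectionVars false

open MvPolynomial

variable {K : Type u} [Field K] {σ : Type} (p : ℕ)
  (m : MaximalSpectrum (MvPolynomial σ K)) [Fact p.Prime] [CharP K p] [Fintype σ]

instance finiteDimensional_residue : FiniteDimensional K (MvPolynomial σ K ⧸ m.asIdeal) :=
  finite_of_finite_type_of_isJacobsonRing K (MvPolynomial σ K ⧸ m.asIdeal)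

theorem kExp_spec (i : σ) : ∃ f : Polynomial K, f.Separable ∧
    Polynomial.expand K (p ^ kExp p m i) f =
      minpoly K (Ideal.Quotient.mk m.asIdeal (MvPolynomial.X i)) := by
  have h : {k | ∃ f : Polynomial K, f.Separable ∧ Polynomial.expand K (p ^ k) f =
    minpoly K (Ideal.Quotient.mk m.asIdeal (MvPolynomial.X i))}.Nonempty := by
    have hi : IsIntegral K (Ideal.Quotient.mk m.asIdeal (MvPolynomial.X i)) :=
      Algebra.IsIntegral.isIntegral _
    obtain ⟨k, f, hf⟩ := Polynomial.exists_separable_of_irreducible p (minpoly.irreducible hi)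
      (Fact.out : p.Prime).ne_zero
    exact ⟨k, f, hf⟩
  exact Nat.sInf_mem h

/-- The map from the central subalgebra to the residue field. -/
def zRes : Zm p m →ₐ[K] MvPolynomial σ K ⧸ m.asIdeal :=
  (Ideal.Quotient.mkₐ K m.asIdeal).comp (Zm p m).val

theorem zRes_apply (z : Zm p m) : zRes p m z = Ideal.Quotient.mk m.asIdeal (z : MvPolynomial σ K) :=
  rfl

/-- The class of x_i^{p^{k_i}} is a root of the separable polynomial f_i, so the generators of Z map
to separable elements. -/
theorem zRes_mem (z : Zm p m) : zRes p m z ∈ ResSep m := by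
  have : Zm p m ≤ (ResSep m).toSubalgebra.comap (Ideal.Quotient.mkₐ K m.asIdeal) := by
    refine Algebra.adjoin_le ?_
    rintro _ ⟨i, rfl⟩
    change Ideal.Quotient.mk m.asIdeal (X i ^ p ^ kExp p m i) ∈ ResSep m
    rw [mem_separableClosure_iff, map_pow]
    obtain ⟨f, hf, h⟩ := kExp_spec p m i
    refine hf.of_dvd (minpoly.dvd _ _ ?_)
    rw [← Polynomial.expand_aeval, h, minpoly.aeval]
  exact this z.2

variable {m} in
-- For c separable, K(c) = K(c^{p^N}). This allows an element of Z to be replaced, modulo m, by one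
-- in arbitrarily high p-powers.
theorem exists_aeval_pow {c : MvPolynomial σ K ⧸ m.asIdeal} (hc : c ∈ ResSep m) (N : ℕ) :
    ∃ h : Polynomial K, Polynomial.aeval (c ^ p ^ N) h = c := by
  rw [mem_separableClosure_iff] at hc
  have : ExpChar K p := ExpChar.prime (Fact.out : p.Prime)
  have h1 := IntermediateField.adjoin_simple_eq_adjoin_pow_expChar_pow_of_isSeparable K
    (MvPolynomial σ K ⧸ m.asIdeal) hc p N
  have h2 : c ∈ (IntermediateField.adjoin K {c ^ p ^ N}).toSubalgebra := by
    rw [← h1]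
    exact IntermediateField.mem_adjoin_simple_self K c
  rw [IntermediateField.adjoin_simple_toSubalgebra_of_isAlgebraic (Algebra.IsAlgebraic.isAlgebraic _),
    Algebra.adjoin_singleton_eq_range_aeval] at h2
  exact h2

/-- Lift c to a polynomial g. Although g need not lie in Z, its p^N-th power does for N ≥ max k_i,
and c is a polynomial in c^{p^N}. -/
theorem exists_zRes_eq {c : MvPolynomial σ K ⧸ m.asIdeal} (hc : c ∈ ResSep m) :
    ∃ z, zRes p m z = c := by
  set N := Finset.univ.sup (kExp p m)
  obtain ⟨h, hh⟩ := exists_aeval_pow p hc N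
  obtain ⟨g, hg⟩ := Ideal.Quotient.mk_surjective c
  refine ⟨Polynomial.aeval
    (⟨g ^ p ^ N, pow_mem_frobSub p (fun i => Finset.le_sup (Finset.mem_univ i)) g⟩ : Zm p m) h, ?_⟩
  rw [← Polynomial.aeval_algHom_apply, zRes_apply]
  change Polynomial.aeval (Ideal.Quotient.mk m.asIdeal (g ^ p ^ N)) h = c
  rw [map_pow, hg, hh]

/-- The map from the central subalgebra onto `(P_s / m)^sep`. -/
def zSep : Zm p m →ₐ[K] ResSep m :=
  (zRes p m).codRestrict (ResSep m).toSubalgebra (zRes_mem p m)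

theorem zSep_surjective : Function.Surjective (zSep p m) := by
  rintro ⟨c, hc⟩
  obtain ⟨z, hz⟩ := exists_zRes_eq p m hc
  exact ⟨z, Subtype.ext hz⟩

theorem zSep_eq_zero_iff {z : Zm p m} : zSep p m z = 0 ↔ (z : MvPolynomial σ K) ∈ m.asIdeal := by
  rw [← Ideal.Quotient.eq_zero_iff_mem]
  exact Subtype.ext_iff

theorem exists_aeval_pow_sub_mem {z : MvPolynomial σ K} (hz : z ∈ Zm p m) (N : ℕ) :
    ∃ h : Polynomial K, z - Polynomial.aeval (z ^ p ^ N) h ∈ m.asIdeal := by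
  obtain ⟨h, hh⟩ := exists_aeval_pow p (zRes_mem p m ⟨z, hz⟩) N
  refine ⟨h, ?_⟩
  rw [← Ideal.Quotient.eq_zero_iff_mem, map_sub, sub_eq_zero]
  conv_lhs => rw [← zRes_apply p m ⟨z, hz⟩, ← hh]
  rw [zRes_apply, ← map_pow]
  exact Polynomial.aeval_algHom_apply (Ideal.Quotient.mkₐ K m.asIdeal) _ _

theorem zMap_eq_zero_iff {z : Zm p m} : zMap p m z = 0 ↔ (z : MvPolynomial σ K) ∈ m.asIdeal :=
  vMap_eq_zero_iff z.2

/-- The line `Z ⊆ V(m)` is `(P_s / m)^sep`. -/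
def rangeZMapEquiv : LinearMap.range (zMap p m) ≃ₗ[K] ResSep m :=
  (LinearMap.quotKerEquivRange (zMap p m)).symm.trans
    ((Submodule.quotEquivOfEq _ _ (by
      ext z
      rw [LinearMap.mem_ker, LinearMap.mem_ker, zMap_eq_zero_iff, ← zSep_eq_zero_iff]
      rfl)).trans ((zSep p m).toLinearMap.quotKerEquivOfSurjective (zSep_surjective p m)))

/-- The exponents in the box as functions. -/
def boxEquiv : Box p m ≃ ∀ i, Fin (p ^ kExp p m i) where
  toFun α i := ⟨α.1 i, α.2 i⟩
  invFun f := ⟨Finsupp.equivFunOnFinite.symm fun i => f i, fun i => (f i).2⟩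
  left_inv _ := Subtype.ext (Finsupp.ext fun _ => rfl)
  right_inv _ := rfl

instance finite_Box : Finite (Box p m) := by
  classical
  exact Finite.of_equiv _ (boxEquiv p m).symm

theorem card_Box : Nat.card (Box p m) = p ^ ∑ i, kExp p m i := by
  classical
  rw [Nat.card_congr (boxEquiv p m), Nat.card_pi]
  simp [Finset.prod_pow_eq_pow_sum]

/-- `V(m)` is the direct sum of the `x^α Z`. -/
def boxLinearEquiv : (Box p m → ResSep m) ≃ₗ[K] Vm p m :=
  ((LinearEquiv.piCongrRight fun _ => (rangeZMapEquiv p m).symm).trans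
    (Finsupp.linearEquivFunOnFinite K _ (Box p m)).symm).trans
    (LinearEquiv.ofBijective (Finsupp.lsum K (boxMap p m))
      ⟨lsum_boxMap_injective p m, lsum_boxMap_surjective p m⟩)

instance finiteDimensional_Vm : FiniteDimensional K (Vm p m) :=
  Module.Finite.equiv (boxLinearEquiv p m)

theorem finrank_Vm :
    Module.finrank K (Vm p m) = p ^ (∑ i, kExp p m i) * Module.finrank K (ResSep m) := by
  have := Fintype.ofFinite (Box p m)
  rw [← (boxLinearEquiv p m).finrank_eq, Module.finrank_pi_fintype, Finset.sum_const,
    Finset.card_univ, ← Nat.card_eq_fintype_card, card_Box, smul_eq_mul]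

end Residue
end
end TinyDMod

namespace TinyDMod
noncomputable section

/-! ### The universal property of the induced module -/

section InducedModule

set_option linter.unusedSectionVars false

variable {K : Type u} [Field K] {D : Type u} [Ring D] [Algebra K D] {A : Subalgebra K D}
  {V : Type u} [AddCommGroup V] [Module K V] [Module A V] [IsScalarTower K A V]

theorem Induced.ι_smul (a : A) (v : V) :
    Induced.ι A V (a • v) = (a : D) • Induced.ι A V v := by
  symm
  refine sub_eq_zero.1 ?_
  have h : ((1 : D) * a) ⊗ₜ[K] v - (1 : D) ⊗ₜ[K] (a • v) ∈ inducedRel A V :=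
    Submodule.subset_span ⟨1, a, v, rfl⟩
  rw [one_mul] at h
  have h1 := (Submodule.Quotient.mk_eq_zero (inducedRel A V)).2 h
  rw [Submodule.Quotient.mk_sub] at h1
  refine Eq.trans ?_ h1
  congr 1
  change (Submodule.Quotient.mk ((a : D) • ((1 : D) ⊗ₜ[K] v)) : _ ⧸ inducedRel A V) = _
  rw [TensorProduct.smul_tmul', smul_eq_mul, mul_one]

theorem Induced.induction {Q : Induced A V → Prop} (hadd : ∀ x y, Q x → Q y → Q (x + y))
    (h : ∀ (d : D) (v : V), Q (d • Induced.ι A V v)) (x : Induced A V) : Q x := by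
  obtain ⟨z, rfl⟩ := Submodule.Quotient.mk_surjective (inducedRel A V) x
  induction z using TensorProduct.induction_on with
  | zero =>
    have h0 := h 0 0
    rw [zero_smul] at h0
    exact h0
  | add x y hx hy => exact hadd _ _ hx hy
  | tmul d v =>
    have e : (Submodule.Quotient.mk (d ⊗ₜ[K] v) : _ ⧸ inducedRel A V) =
        Submodule.Quotient.mk (d • ((1 : D) ⊗ₜ[K] v)) := by
      rw [TensorProduct.smul_tmul', smul_eq_mul, mul_one]
    exact Eq.mpr (congrArg Q e) (h d v)

variable {N : Type*} [AddCommGroup N] [Module K N] [Module D N] [IsScalarTower K D N]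

/-- The universal property of the induced module. -/
def Induced.lift (φ : V →ₗ[K] N) (hφ : ∀ (a : A) v, φ (a • v) = (a : D) • φ v) :
    Induced A V →ₗ[D] N :=
  Submodule.liftQ (inducedRel A V)
    (TensorProduct.AlgebraTensorModule.lift (LinearMap.toSpanSingleton D (V →ₗ[K] N) φ)) (by
      refine Submodule.span_le.2 ?_
      rintro _ ⟨d, a, v, rfl⟩
      rw [SetLike.mem_coe, LinearMap.mem_ker, map_sub, TensorProduct.AlgebraTensorModule.lift_tmul,
        TensorProduct.AlgebraTensorModule.lift_tmul, sub_eq_zero]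
      change (d * (a : D)) • φ v = d • φ (a • v)
      rw [hφ, mul_smul])

theorem Induced.lift_ι (φ : V →ₗ[K] N) (hφ : ∀ (a : A) v, φ (a • v) = (a : D) • φ v) (v : V) :
    Induced.lift φ hφ (Induced.ι A V v) = φ v :=
  one_smul D (φ v)

end InducedModule

/-! ### The D(P_s)-module U(m): decomposition, simplicity, endomorphisms -/

section Umod

set_option linter.unusedSectionVars false

open MvPolynomial

variable {K : Type u} [Field K] {σ : Type} (p : ℕ)
  (m : MaximalSpectrum (MvPolynomial σ K)) [Fact p.Prime] [CharP K p] [Fintype σ]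

/-- The map from `V(m)` to `U(m)`. -/
abbrev uι : Vm p m →ₗ[K] Um p m := Induced.ι (Am p m) (Vm p m)

theorem amMul_uι (f : MvPolynomial σ K) (v : Vm p m) :
    uι p m (amMul p m f • v) = mulOp K f • uι p m v :=
  Induced.ι_smul _ _

variable {p m} in
theorem amHasse_uι {β : σ →₀ ℕ} (hβ : ∀ i, β i < p ^ kExp p m i) (v : Vm p m) :
    uι p m (amHasse p m β • v) = hasse K β • uι p m v := by
  rw [← coe_amHasse hβ]
  exact Induced.ι_smul _ _

variable {p m} in
-- Combines the presentation of V(m) by its left ideal with the universal property of induction: a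
-- vector satisfying the relations of the generator of V(m) receives a map from U(m).
theorem exists_uLift {N : Type u} [AddCommGroup N] [Module K N] [Module (DP K σ) N]
    [IsScalarTower K (DP K σ) N] (w : N)
    (h1 : ∀ z ∈ Zm p m, z ∈ m.asIdeal → mulOp K z • w = 0)
    (h2 : ∀ β : σ →₀ ℕ, β ≠ 0 → (∀ i, β i < p ^ kExp p m i) → hasse K β • w = 0) :
    ∃ ψ : Um p m →ₗ[DP K σ] N, ψ (uι p m (vOne p m)) = w := by
  have e1 : ∀ a ∈ centralSet p m, a • w = 0 := by
    intro a ha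
    obtain ⟨z, hz, hzm, rfl⟩ := (mem_centralSet_iff p m).1 ha
    exact h1 z hz hzm
  have e2 : ∀ β : σ →₀ ℕ, β ≠ 0 → (∀ i, β i < p ^ kExp p m i) → amHasse p m β • w = 0 := by
    intro β hβ hβ'
    have := h2 β hβ hβ'
    rwa [← coe_amHasse hβ'] at this
  let φ : Vm p m →ₗ[K] N :=
    { toFun := vLift w e1 e2
      map_add' := map_add _
      map_smul' := fun c v => by
        have h3 : c • v = (algebraMap K (Am p m) c) • v := (algebraMap_smul _ _ _).symm
        rw [h3, map_smul]
        exact algebraMap_smul (DP K σ) c (vLift w e1 e2 v) }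
  refine ⟨Induced.lift φ fun a v => map_smul (vLift w e1 e2) a v, ?_⟩
  rw [Induced.lift_ι]
  exact vLift_vOne w e1 e2

/-- The ideal generated by the `p^N`-th powers of elements of `m`. -/
def frobIdeal (N : ℕ) : Ideal (MvPolynomial σ K) :=
  Ideal.span ((fun f => f ^ p ^ N) '' (m.asIdeal : Set (MvPolynomial σ K)))

/-- For N large the operator a is linear over p^N-th powers, and these generate the ideal. -/
theorem exists_smul_mem_frobIdeal (a : DP K σ) :
    ∃ N₀, ∀ N ≥ N₀, ∀ f ∈ frobIdeal p m N, a • f ∈ frobIdeal p m N := by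
  obtain ⟨N₀, h⟩ := exists_commute_frobSub p a
  refine ⟨N₀, fun N hN f hf => ?_⟩
  -- The operator a is not linear over all polynomials, so the induction over the ideal carries an
  -- arbitrary factor g.
  have key : ∀ g : MvPolynomial σ K, a • (g * f) ∈ frobIdeal p m N := by
    refine Submodule.span_induction (p := fun f _ => ∀ g : MvPolynomial σ K,
      a • (g * f) ∈ frobIdeal p m N) ?_ ?_ ?_ ?_ hf
    · rintro _ ⟨x, hx, rfl⟩ g
      have h1 := h N hN (x ^ p ^ N) (pow_mem_frobSub p (fun _ => le_rfl) x)
      simp only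
      rw [mul_comm g, ← mulOp_smul, ← mul_smul, h1.eq, mul_smul, mulOp_smul]
      exact Ideal.mul_mem_right _ _ (Ideal.subset_span ⟨x, hx, rfl⟩)
    · intro g
      rw [mul_zero, smul_zero]
      exact zero_mem _
    · intro x y _ _ hx hy g
      rw [mul_add, smul_add]
      exact add_mem (hx g) (hy g)
    · intro c x _ hx g
      rw [smul_eq_mul, ← mul_assoc]
      exact hx _
  simpa using key 1

/-- Some power of m lies in J; an element of the last power that does not is killed by m modulo J.
-/
theorem exists_pow_le_of_le_radical {J : Ideal (MvPolynomial σ K)} (hJ : J ≠ ⊤)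
    (h : m.asIdeal ≤ J.radical) :
    ∃ f ∉ J, ∀ g ∈ m.asIdeal, f * g ∈ J := by
  classical
  have hex := Ideal.exists_pow_le_of_le_radical_of_fg h (IsNoetherian.noetherian _)
  have hmin := Nat.find_spec hex
  have h0 : Nat.find hex ≠ 0 := by
    intro h0
    rw [h0, pow_zero, Ideal.one_eq_top, top_le_iff] at hmin
    exact hJ hmin
  obtain ⟨r, hr⟩ := Nat.exists_eq_succ_of_ne_zero h0
  have h1 : ¬ m.asIdeal ^ r ≤ J := Nat.find_min hex (by omega)
  obtain ⟨f, hf, hfJ⟩ := SetLike.not_le_iff_exists.1 h1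
  refine ⟨f, hfJ, fun g hg => hmin ?_⟩
  rw [hr, pow_succ]
  exact Ideal.mul_mem_mul hf hg

theorem exists_notMem_frobIdeal (N : ℕ) :
    ∃ f ∉ frobIdeal p m N, ∀ g ∈ m.asIdeal, f * g ∈ frobIdeal p m N := by
  have hp := (Fact.out : p.Prime).pos
  refine exists_pow_le_of_le_radical m ?_ ?_
  · intro h
    refine m.isMaximal.ne_top (top_le_iff.1 (h ▸ Ideal.span_le.2 ?_))
    rintro _ ⟨x, hx, rfl⟩
    exact Ideal.pow_mem_of_mem _ hx _ (pow_pos hp N)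
  · intro f hf
    exact ⟨p ^ N, Ideal.subset_span ⟨f, hf, rfl⟩⟩

/-- The left ideal of `D(P_s)` generated by `m` is proper. -/
theorem one_notMem_span_mulOp (p : ℕ) [Fact p.Prime] [CharP K p]
    (m : MaximalSpectrum (MvPolynomial σ K)) :
    (1 : DP K σ) ∉ Ideal.span (mulOp K '' (m.asIdeal : Set (MvPolynomial σ K))) := by
  intro h1
  -- Every element of the left ideal sends the part of P_s modulo `frobIdeal p m N` killed by m to
  -- zero, for N large depending on the element. For 1 this fails, as that part is nonzero for every
  -- N.
  have key : ∀ a ∈ Ideal.span (mulOp K '' (m.asIdeal : Set (MvPolynomial σ K))),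
      ∃ N₀, ∀ N ≥ N₀, ∀ f : MvPolynomial σ K, (∀ g ∈ m.asIdeal, f * g ∈ frobIdeal p m N) →
        a • f ∈ frobIdeal p m N := by
    intro a ha
    induction ha using Submodule.span_induction with
    | mem x hx =>
      obtain ⟨g, hg, rfl⟩ := hx
      refine ⟨0, fun N _ f hf => ?_⟩
      rw [mulOp_smul, mul_comm]
      exact hf g hg
    | zero => exact ⟨0, fun N _ f _ => by rw [zero_smul]; exact zero_mem _⟩
    | add x y _ _ hx hy =>
      obtain ⟨N₁, h1⟩ := hx
      obtain ⟨N₂, h2⟩ := hy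
      refine ⟨max N₁ N₂, fun N hN f hf => ?_⟩
      rw [add_smul]
      exact add_mem (h1 N (by omega) f hf) (h2 N (by omega) f hf)
    | smul b x _ hx =>
      obtain ⟨N₁, h1⟩ := hx
      obtain ⟨N₂, h2⟩ := exists_smul_mem_frobIdeal p m b
      refine ⟨max N₁ N₂, fun N hN f hf => ?_⟩
      rw [smul_assoc]
      exact h2 N (by omega) _ (h1 N (by omega) f hf)
  obtain ⟨N, hN⟩ := key 1 h1
  obtain ⟨f, hf, hfg⟩ := exists_notMem_frobIdeal p m N
  have := hN N le_rfl f hfg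
  rw [one_smul] at this
  exact hf this

theorem exists_hasse_annihilated {W : Type*} [AddCommGroup W] [Module (DP K σ) W] {w : W}
    (hw : w ≠ 0) (h1 : ∀ z ∈ Zm p m, z ∈ m.asIdeal → mulOp K z • w = 0) :
    ∃ β₀ : σ →₀ ℕ, hasse K β₀ • w ≠ 0 ∧
      (∀ z ∈ Zm p m, z ∈ m.asIdeal → mulOp K z • hasse K β₀ • w = 0) ∧
      ∀ β : σ →₀ ℕ, β ≠ 0 → (∀ i, β i < p ^ kExp p m i) → hasse K β • hasse K β₀ • w = 0 := by
  obtain ⟨β₀, e0, e1, e2, e3⟩ := exists_amHasse_annihilated (p := p) (m := m) hw (fun a ha => by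
    obtain ⟨z, hz, hzm, rfl⟩ := (mem_centralSet_iff p m).1 ha
    exact h1 z hz hzm)
  have c0 : ∀ w : W, amHasse p m β₀ • w = hasse K β₀ • w := fun w => by
    rw [← coe_amHasse e0]; rfl
  simp only [c0] at e1 e2 e3
  refine ⟨β₀, e1, fun z hz hzm => e2 _ (mem_centralSet_amMul hz hzm), fun β hβ hβ' => ?_⟩
  have := e3 β hβ hβ'
  rw [← coe_amHasse hβ']
  exact this

/-- The test module is D(P_s)/D(P_s)m, nonzero since its left ideal is proper. A divided power of
its generator satisfies the relations of V(m) and is nonzero, so it is the image of the generator of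
U(m). -/
theorem uι_vOne_ne_zero : uι p m (vOne p m) ≠ 0 := by
  set J : Ideal (DP K σ) := Ideal.span (mulOp K '' (m.asIdeal : Set (MvPolynomial σ K)))
  have h1 : (Submodule.Quotient.mk 1 : DP K σ ⧸ J) ≠ 0 := by
    rw [Ne, Submodule.Quotient.mk_eq_zero]
    exact one_notMem_span_mulOp p m
  obtain ⟨β₀, e1, e2, e3⟩ := exists_hasse_annihilated p m h1 (fun z _ hzm => by
    change (Submodule.Quotient.mk (mulOp K z • 1) : DP K σ ⧸ J) = 0
    rw [Submodule.Quotient.mk_eq_zero, smul_eq_mul, mul_one]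
    exact Ideal.subset_span ⟨z, hzm, rfl⟩)
  obtain ⟨ψ, hψ⟩ := exists_uLift _ e2 e3
  intro h0
  rw [h0, map_zero] at hψ
  exact e1 hψ.symm

theorem uι_injective : Function.Injective (uι p m) := by
  rw [injective_iff_map_eq_zero]
  intro v hv
  by_contra hne
  obtain ⟨a, ha⟩ := exists_smul_eq_vOne hne
  apply uι_vOne_ne_zero p m
  rw [← ha]
  exact (Induced.ι_smul a v).trans (by rw [hv, smul_zero])

theorem exists_smul_uι_vOne (u : Um p m) : ∃ d : DP K σ, d • uι p m (vOne p m) = u := by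
  induction u using Induced.induction with
  | hadd x y hx hy =>
    obtain ⟨d, rfl⟩ := hx
    obtain ⟨e, rfl⟩ := hy
    exact ⟨d + e, add_smul _ _ _⟩
  | h d v =>
    obtain ⟨a, rfl⟩ := exists_smul_vOne p m v
    exact ⟨d * a, by rw [Induced.ι_smul, mul_smul]⟩

variable {p m} in
theorem Um_hom_ext {N : Type*} [AddCommGroup N] [Module (DP K σ) N] {f g : Um p m →ₗ[DP K σ] N}
    (h : f (uι p m (vOne p m)) = g (uι p m (vOne p m))) : f = g := by
  ext u
  obtain ⟨d, rfl⟩ := exists_smul_uι_vOne p m u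
  rw [map_smul, map_smul, h]

/-- The endomorphism `d ⊗ v ↦ d ⊗ z v` of `U(m)`. -/
def uT (z : Zm p m) : Module.End (DP K σ) (Um p m) :=
  Induced.lift (uι p m ∘ₗ Algebra.lsmul K K (Vm p m) (amMul p m z)) fun a v => by
    change uι p m (amMul p m z • a • v) = (a : DP K σ) • uι p m (amMul p m z • v)
    rw [← Induced.ι_smul, ← mul_smul, ← mul_smul, (amMul_commute a z.2).eq]

theorem uT_uι (z : Zm p m) (v : Vm p m) : uT p m z (uι p m v) = mulOp K (z : MvPolynomial σ K) • uι p m v := by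
  rw [← amMul_uι]
  exact Induced.lift_ι _ _ _

theorem uT_uι_vOne (z : Zm p m) : uT p m z (uι p m (vOne p m)) = uι p m (vMap p m z) := by
  rw [uT_uι, ← amMul_uι, vMap_apply]

/-- The endomorphisms of `U(m)` given by the central subalgebra. -/
def uTHom : Zm p m →ₐ[K] Module.End (DP K σ) (Um p m) :=
  AlgHom.ofLinearMap
    { toFun := uT p m
      map_add' := fun x y => Um_hom_ext (by
        rw [LinearMap.add_apply, uT_uι_vOne, uT_uι_vOne, uT_uι_vOne, ← map_add, ← map_add]
        rfl)
      map_smul' := fun c x => Um_hom_ext (by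
        rw [LinearMap.smul_apply, uT_uι_vOne, RingHom.id_apply, uT_uι_vOne, ← map_smul, ← map_smul]
        rfl) }
    (Um_hom_ext (by
      change uT p m 1 _ = _
      rw [uT_uι_vOne, Module.End.one_apply]
      exact congrArg _ (vMap_one p m)))
    (fun x y => Um_hom_ext (by
      change uT p m (x * y) (uι p m (vOne p m)) = uT p m x (uT p m y (uι p m (vOne p m)))
      rw [uT_uι_vOne, uT_uι_vOne, uT_uι, ← amMul_uι, amMul_smul_vMap]
      rfl))

theorem uT_eq_zero_iff (z : Zm p m) : uT p m z = 0 ↔ (z : MvPolynomial σ K) ∈ m.asIdeal := by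
  rw [← vMap_eq_zero_iff z.2, ← (uι_injective p m).eq_iff, map_zero, ← uT_uι_vOne]
  exact ⟨fun h => by rw [h, LinearMap.zero_apply],
    fun h => Um_hom_ext (by rw [h, LinearMap.zero_apply])⟩

/-- The exponent `(γ_j p^k_j)`. -/
def qExp (γ : σ → ℕ) : σ →₀ ℕ := Finsupp.equivFunOnFinite.symm fun j => γ j * p ^ kExp p m j

/-- The map `v ↦ ∂^[γ p^k] ⊗ v`. -/
def uMap (γ : σ → ℕ) : Vm p m →ₗ[K] Um p m :=
  (Algebra.lsmul K K (Um p m) (hasse K (qExp p m γ))) ∘ₗ uι p m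

theorem uMap_apply (γ : σ → ℕ) (v : Vm p m) : uMap p m γ v = hasse K (qExp p m γ) • uι p m v := rfl

theorem uMap_zero (v : Vm p m) : uMap p m 0 v = uι p m v := by
  have : qExp p m 0 = 0 := by ext i; simp [qExp]
  rw [uMap_apply, this, hasse_zero, one_smul]

/-- The element `x_i^(p^k_i)` of the central subalgebra. -/
def yZ (i : σ) : Zm p m := ⟨X i ^ p ^ kExp p m i, Algebra.subset_adjoin (Set.mem_range_self i)⟩

/-- The lowering operator `∂^[γ p^k] ⊗ v ↦ ∂^[(γ - e_i) p^k] ⊗ v`. -/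
def uLow (i : σ) : Um p m →ₗ[K] Um p m :=
  (uT p m (yZ p m i)).restrictScalars K -
    Algebra.lsmul K K (Um p m) (mulOp K (X i ^ p ^ kExp p m i))

theorem uLow_apply (i : σ) (u : Um p m) :
    uLow p m i u = uT p m (yZ p m i) u - mulOp K (X i ^ p ^ kExp p m i) • u := rfl

/-- The endomorphism inserts x_i^{p^{k_i}} to the right of the divided power and left multiplication
to its left, so the difference is the commutator of `hasse_mul_X_pow`. -/
theorem uLow_uMap [DecidableEq σ] (i : σ) (γ : σ → ℕ) (v : Vm p m) :
    uLow p m i (uMap p m γ v) = if 1 ≤ γ i then uMap p m (γ - Pi.single i 1) v else 0 := by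
  have hp : 0 < p ^ kExp p m i := pow_pos (Fact.out : p.Prime).pos _
  rw [uLow_apply, uMap_apply, map_smul, uT_uι]
  change hasse K (qExp p m γ) • mulOp K (X i ^ p ^ kExp p m i) • uι p m v - _ = _
  rw [← mul_smul, ← mul_smul, hasse_mul_X_pow, add_smul, add_sub_cancel_left]
  have h1 : p ^ kExp p m i ≤ qExp p m γ i ↔ 1 ≤ γ i := by
    change _ ≤ γ i * _ ↔ _
    rw [le_mul_iff_one_le_left hp]
  simp only [h1]
  split_ifs with h
  · have : qExp p m γ - Finsupp.single i (p ^ kExp p m i) = qExp p m (γ - Pi.single i 1) := by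
      ext j
      rw [Finsupp.tsub_apply]
      change γ j * _ - _ = (γ j - (Pi.single i 1 : σ → ℕ) j) * _
      by_cases hj : i = j
      · subst hj
        rw [Finsupp.single_eq_same, Pi.single_eq_same, Nat.sub_mul, one_mul]
      · rw [Finsupp.single_apply, if_neg hj, Pi.single_eq_of_ne (Ne.symm hj), tsub_zero, tsub_zero]
    rw [this]
    rfl
  · rw [zero_smul]

/-- L composes δ_i lowering operators in each direction i. The last clause, that L vanishes on
vectors killed by all lowering operators, is what isolates V(m) inside U(m) later. -/
theorem exists_lowering (δ : σ → ℕ) : ∃ L : Um p m →ₗ[K] Um p m,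
    (∀ γ v, ¬ δ ≤ γ → L (uMap p m γ v) = 0) ∧ (∀ v, L (uMap p m δ v) = uι p m v) ∧
      (δ ≠ 0 → ∀ u, (∀ i, uLow p m i u = 0) → L u = 0) := by
  classical
  suffices h : ∀ (n : ℕ) (δ : σ → ℕ), ∑ i, δ i = n → ∃ L : Um p m →ₗ[K] Um p m,
      (∀ γ v, ¬ δ ≤ γ → L (uMap p m γ v) = 0) ∧ (∀ v, L (uMap p m δ v) = uι p m v) ∧
      (δ ≠ 0 → ∀ u, (∀ i, uLow p m i u = 0) → L u = 0) from h _ δ rfl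
  intro n
  induction n with
  | zero =>
    intro δ hδ
    have h0 : δ = 0 := funext fun i => (Finset.sum_eq_zero_iff.1 hδ) i (Finset.mem_univ i)
    subst h0
    exact ⟨LinearMap.id, fun γ v h => absurd (fun _ => Nat.zero_le _) h, fun v => uMap_zero p m v,
      fun h => absurd rfl h⟩
  | succ n ih =>
    intro δ hδ
    obtain ⟨i, -, hi⟩ : ∃ i ∈ Finset.univ, δ i ≠ 0 := by
      by_contra! h
      rw [Finset.sum_eq_zero h] at hδ
      omega
    have e : δ - Pi.single i 1 + Pi.single i 1 = δ := by
      ext j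
      by_cases hj : j = i
      · subst hj; simp; omega
      · simp [Pi.single_eq_of_ne hj]
    obtain ⟨L, h1, h2, -⟩ := ih (δ - Pi.single i 1) (by
      have := congrArg (fun f : σ → ℕ => ∑ j, f j) e
      simp only [Pi.add_apply, Finset.sum_add_distrib] at this
      rw [Finset.sum_pi_single'] at this
      simp only [Finset.mem_univ, if_true] at this
      omega)
    -- The lowering in direction i is applied first, so L vanishes on anything it kills.
    refine ⟨L ∘ₗ uLow p m i, fun γ v h => ?_, fun v => ?_, fun _ u hu => ?_⟩
    · rw [LinearMap.comp_apply, uLow_uMap]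
      split_ifs with hγ
      · refine h1 _ _ fun hle => h ?_
        intro j
        have h3 := hle j
        have h4 := congrFun e j
        simp only [Pi.sub_apply, Pi.add_apply] at h3 h4
        by_cases hj : j = i
        · subst hj
          simp only [Pi.single_eq_same] at h3 h4
          change δ j ≤ γ j
          omega
        · simp only [Pi.single_eq_of_ne hj] at h3 h4; omega
      · exact map_zero L
    · rw [LinearMap.comp_apply, uLow_uMap, if_pos (by omega), h2]
    · rw [LinearMap.comp_apply, hu i, map_zero]

theorem lsum_uMap_injective : Function.Injective (Finsupp.lsum K (uMap p m)) := by
  choose L h1 h2 _ using exists_lowering p m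
  refine lsum_injective_of_triangular _ L (fun γ => ∑ i, γ i) ?_ ?_
  · intro δ γ v hne h
    refine h1 _ _ _ fun hle => hne ?_
    have h3 := (Finset.sum_eq_sum_iff_of_le fun i _ => hle i).1
      (le_antisymm (Finset.sum_le_sum fun i _ => hle i) h)
    exact funext fun i => h3 i (Finset.mem_univ i)
  · intro δ v h
    rw [h2] at h
    exact (injective_iff_map_eq_zero _).1 (uι_injective p m) v h

/-- Divide each β_i by p^{k_i}: the divisible part labels a summand, and the remainder is in A(m)
and is absorbed by V(m). -/
theorem exists_uMap_eq_hasse (β : σ →₀ ℕ) (v : Vm p m) : ∃ γ v', ∑ j, γ j * p ^ kExp p m j ≤ β.degree ∧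
    hasse K β • uι p m v = uMap p m γ v' := by
  have hp : ∀ i, 0 < p ^ kExp p m i := fun i => pow_pos (Fact.out : p.Prime).pos _
  let γ : σ → ℕ := fun i => β i / p ^ kExp p m i
  let b : σ →₀ ℕ := Finsupp.equivFunOnFinite.symm fun i => β i % p ^ kExp p m i
  have hb : ∀ i, b i < p ^ kExp p m i := fun i => Nat.mod_lt _ (hp i)
  have e : qExp p m γ + b = β := by
    ext i
    exact Nat.div_add_mod' _ _
  refine ⟨γ, amHasse p m b • v, ?_, ?_⟩
  · rw [Finsupp.degree_eq_sum]
    exact Finset.sum_le_sum fun i _ => Nat.div_mul_le_self _ _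
  · rw [uMap_apply, amHasse_uι hb, ← mul_smul,
      hasse_mul_hasse_of_dvd p (k := kExp p m) (fun i => Dvd.intro_left _ rfl) hb, e]

/-- The subspace of `U(m)` spanned by the summands of weight at most `i`. -/
def uFil (i : ℕ) : Submodule K (Um p m) :=
  ⨆ (γ : σ → ℕ) (_ : ∑ j, γ j * p ^ kExp p m j ≤ i), LinearMap.range (uMap p m γ)

variable {p m} in
theorem uMap_mem_uFil {γ : σ → ℕ} {i : ℕ} (h : ∑ j, γ j * p ^ kExp p m j ≤ i) (v : Vm p m) :
    uMap p m γ v ∈ uFil p m i :=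
  Submodule.mem_iSup_of_mem γ (Submodule.mem_iSup_of_mem h ⟨v, rfl⟩)

theorem hasse_smul_uι_mem_uFil (β : σ →₀ ℕ) (v : Vm p m) {i : ℕ} (h : β.degree ≤ i) :
    hasse K β • uι p m v ∈ uFil p m i := by
  obtain ⟨γ, v', h1, h2⟩ := exists_uMap_eq_hasse p m β v
  rw [h2]
  exact uMap_mem_uFil (h1.trans h) v'

theorem X_smul_mem_uFil (j : σ) {i : ℕ} {u : Um p m} (hu : u ∈ uFil p m i) :
    mulOp K (X j) • u ∈ uFil p m i := by
  have : uFil p m i ≤ (uFil p m i).comap (Algebra.lsmul K K (Um p m) (mulOp K (X j))) := by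
    refine iSup_le fun γ => iSup_le fun hγ => ?_
    rintro _ ⟨v, rfl⟩
    change mulOp K (X j) • uMap p m γ v ∈ uFil p m i
    -- The case k = 0, that is [∂^[β], x_j] = ∂^[β - e_j] or 0: passing x_j to V(m) costs only a
    -- term of smaller degree.
    have h1 := hasse_mul_X_pow (K := K) p 0 j (qExp p m γ)
    simp only [pow_zero, pow_one] at h1
    rw [uMap_apply, ← mul_smul, eq_sub_iff_add_eq.2 h1.symm, sub_smul, mul_smul, ← amMul_uι]
    refine sub_mem (uMap_mem_uFil hγ _) ?_
    split_ifs
    · refine hasse_smul_uι_mem_uFil p m _ _ (le_trans ?_ hγ)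
      refine (Finsupp.degree_mono tsub_le_self).trans (le_of_eq ?_)
      rw [Finsupp.degree_eq_sum]
      rfl
    · rw [zero_smul]; exact zero_mem _
  exact this hu

theorem mulOp_smul_mem_uFil (f : MvPolynomial σ K) {i : ℕ} {u : Um p m} (hu : u ∈ uFil p m i) :
    mulOp K f • u ∈ uFil p m i := by
  induction f using MvPolynomial.induction_on generalizing u with
  | C a =>
    have : mulOp K (C a) = algebraMap K (DP K σ) a := (mulOp K).commutes a
    rw [this, algebraMap_smul]
    exact Submodule.smul_mem _ _ hu
  | add f g hf hg => rw [map_add, add_smul]; exact add_mem (hf hu) (hg hu)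
  | mul_X f j hf => rw [map_mul, mul_smul]; exact hf (X_smul_mem_uFil p m j hu)

/-- Multiplication by polynomials does not raise the weight on U(m), so the filtration sees only the
divided powers, reduced by division with remainder. -/
theorem mulSpace_canonFil_range_uι (i : ℕ) :
    mulSpace (canonFil K (σ := σ) i) (LinearMap.range (uι p m)) = uFil p m i := by
  refine le_antisymm ?_ ?_
  · refine Submodule.span_le.2 ?_
    rintro _ ⟨a, ha, _, ⟨v, rfl⟩, rfl⟩
    rw [SetLike.mem_coe]
    induction ha using Submodule.span_induction with
    | zero => rw [zero_smul]; exact zero_mem _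
    | add x y _ _ hx hy => rw [add_smul]; exact add_mem hx hy
    | smul c x _ hx => rw [smul_assoc]; exact Submodule.smul_mem _ _ hx
    | mem x hx =>
      obtain ⟨α, β, h, rfl⟩ := hx
      rw [mul_smul]
      exact mulOp_smul_mem_uFil p m _ (hasse_smul_uι_mem_uFil p m β v (by omega))
  · refine iSup_le fun γ => iSup_le fun hγ => ?_
    rintro _ ⟨v, rfl⟩
    refine Submodule.subset_span ⟨hasse K (qExp p m γ), hasse_mem_canonFil _ ?_, uι p m v,
      ⟨v, rfl⟩, rfl⟩
    rw [Finsupp.degree_eq_sum]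
    exact hγ

theorem exists_mem_uFil (u : Um p m) : ∃ i, u ∈ uFil p m i := by
  have hmono : Monotone (uFil p m) := fun i j hij =>
    iSup_le fun γ => iSup_le fun hγ => le_iSup_of_le γ (le_iSup_of_le (hγ.trans hij) le_rfl)
  induction u using Induced.induction with
  | hadd x y hx hy =>
    obtain ⟨i, hx⟩ := hx
    obtain ⟨j, hy⟩ := hy
    exact ⟨max i j, add_mem (hmono (le_max_left i j) hx) (hmono (le_max_right i j) hy)⟩
  | h d v =>
    obtain ⟨i, hi⟩ := isFinFiltration_canonFil.exhaustive d
    refine ⟨i, ?_⟩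
    rw [← mulSpace_canonFil_range_uι]
    exact Submodule.subset_span ⟨d, hi, uι p m v, ⟨v, rfl⟩, rfl⟩

theorem lsum_uMap_surjective : Function.Surjective (Finsupp.lsum K (uMap p m)) := by
  intro u
  obtain ⟨i, hi⟩ := exists_mem_uFil p m u
  have : uFil p m i ≤ LinearMap.range (Finsupp.lsum K (uMap p m)) := by
    refine iSup_le fun γ => iSup_le fun _ => ?_
    rintro _ ⟨v, rfl⟩
    exact ⟨Finsupp.single γ v, by rw [Finsupp.lsum_single]⟩
  exact this hi

theorem lsum_uMap_bijective : Function.Bijective (Finsupp.lsum K (uMap p m)) :=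
  ⟨lsum_uMap_injective p m, lsum_uMap_surjective p m⟩

/-- On d ⊗ v the two actions of z differ by the commutator of d with z, which vanishes once z lies
in K[x_i^{p^N}] with N large. -/
theorem exists_uT_eq (u : Um p m) : ∃ N₀, ∀ N ≥ N₀, ∀ z : Zm p m,
    (z : MvPolynomial σ K) ∈ frobSub K p (fun _ : σ => N) →
      uT p m z u = mulOp K (z : MvPolynomial σ K) • u := by
  induction u using Induced.induction with
  | hadd x y hx hy =>
    obtain ⟨N₁, h1⟩ := hx
    obtain ⟨N₂, h2⟩ := hy
    exact ⟨max N₁ N₂, fun N hN z hz => by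
      rw [map_add, smul_add, h1 N (by omega) z hz, h2 N (by omega) z hz]⟩
  | h d v =>
    obtain ⟨N₀, h⟩ := exists_commute_frobSub p d
    refine ⟨N₀, fun N hN z hz => ?_⟩
    rw [map_smul]
    refine (congrArg (d • ·) (uT_uι p m z v)).trans ?_
    rw [← mul_smul, ← mul_smul, (h N hN z hz).eq]

variable {p m} in
/-- The elements of `U(m)` annihilated by the central ideal are in `V(m)`. -/
theorem exists_uι_eq {u : Um p m} (hu : ∀ z ∈ Zm p m, z ∈ m.asIdeal → mulOp K z • u = 0) :
    ∃ v, u = uι p m v := by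
  classical
  -- For y = x_i^{p^{k_i}} choose a polynomial w in y^{p^N} with y ≡ w modulo m. As endomorphisms y
  -- and w agree; on u, the endomorphism w is left multiplication for N large; and left
  -- multiplication by y - w ∈ Z ∩ m kills u. So the two actions of y on u agree.
  have hlow : ∀ i, uLow p m i u = 0 := by
    intro i
    obtain ⟨N, hN⟩ := exists_uT_eq p m u
    obtain ⟨h, hh⟩ := exists_aeval_pow_sub_mem p m (yZ p m i).2 N
    let w : Zm p m := Polynomial.aeval (yZ p m i ^ p ^ N) h
    have hw : (w : MvPolynomial σ K) =
        Polynomial.aeval ((yZ p m i : MvPolynomial σ K) ^ p ^ N) h :=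
      (Polynomial.aeval_algHom_apply (Zm p m).val (yZ p m i ^ p ^ N) h).symm
    rw [← hw] at hh
    have h1 : (w : MvPolynomial σ K) ∈ frobSub K p (fun _ : σ => N) := by
      rw [hw]
      have h2 : (yZ p m i : MvPolynomial σ K) ^ p ^ N ∈ frobSub K p (fun _ : σ => N) :=
        pow_mem_frobSub p (fun _ => le_rfl) _
      exact (Polynomial.aeval_algHom_apply (frobSub K p (fun _ : σ => N)).val ⟨_, h2⟩ h) ▸
        Subtype.prop _
    have h2 : uT p m (yZ p m i - w) = 0 := (uT_eq_zero_iff p m _).2 hh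
    have h3 : uT p m (yZ p m i) = uT p m w := sub_eq_zero.1 ((map_sub (uTHom p m) _ _).symm.trans h2)
    have h4 := hu _ (sub_mem (yZ p m i).2 w.2) hh
    rw [map_sub, sub_smul] at h4
    rw [uLow_apply, h3, hN N le_rfl w h1, ← neg_sub, neg_eq_zero]
    exact h4
  obtain ⟨f, rfl⟩ := lsum_uMap_surjective p m u
  choose L h1 h2 h3 using exists_lowering p m
  -- A component of maximal weight with γ ≠ 0 would be extracted by its lowering operator, which is
  -- zero on u.
  have hf : ∀ γ ∈ f.support, γ = 0 := by
    by_contra! hne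
    obtain ⟨γ₁, hγ₁, hne⟩ := hne
    obtain ⟨γ, hγ, hmax⟩ := Finset.exists_max_image f.support (fun γ => ∑ i, γ i) ⟨γ₁, hγ₁⟩
    have h0 : γ ≠ 0 := by
      rintro rfl
      have := hmax γ₁ hγ₁
      simp only [Pi.zero_apply, Finset.sum_const_zero, nonpos_iff_eq_zero,
        Finset.sum_eq_zero_iff] at this
      exact hne (funext fun i => this i (Finset.mem_univ i))
    have h4 := h3 γ h0 _ hlow
    rw [Finsupp.lsum_apply, Finsupp.sum, map_sum, Finset.sum_eq_single γ] at h4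
    · rw [h2] at h4
      exact Finsupp.mem_support_iff.1 hγ ((injective_iff_map_eq_zero _).1 (uι_injective p m) _ h4)
    · intro δ hδ hδγ
      refine h1 _ _ _ fun hle => hδγ ?_
      have h5 := (Finset.sum_eq_sum_iff_of_le fun i _ => hle i).1
        (le_antisymm (Finset.sum_le_sum fun i _ => hle i) (hmax δ hδ))
      exact funext fun i => (h5 i (Finset.mem_univ i)).symm
    · exact fun hh => absurd hγ hh
  refine ⟨f 0, ?_⟩
  rw [Finsupp.lsum_apply, Finsupp.sum, Finset.sum_eq_single 0]
  · exact uMap_zero p m _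
  · exact fun γ hγ h => absurd (hf γ hγ) h
  · intro h
    rw [Finsupp.notMem_support_iff.1 h, map_zero]

/-- On d ⊗ v, a high p-power of an element of m commutes with d and lies in Z ∩ m, which kills V(m).
-/
theorem exists_frob_smul_eq_zero (u : Um p m) :
    ∃ N, ∀ f ∈ m.asIdeal, mulOp K (f ^ p ^ N) • u = 0 := by
  suffices h : ∃ N₀, ∀ N ≥ N₀, ∀ f ∈ m.asIdeal, mulOp K (f ^ p ^ N) • u = 0 from
    ⟨h.choose, h.choose_spec _ le_rfl⟩
  induction u using Induced.induction with
  | hadd x y hx hy =>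
    obtain ⟨N₁, h1⟩ := hx
    obtain ⟨N₂, h2⟩ := hy
    exact ⟨max N₁ N₂, fun N hN f hf => by
      rw [smul_add, h1 N (by omega) f hf, h2 N (by omega) f hf, add_zero]⟩
  | h d v =>
    obtain ⟨N₀, h⟩ := exists_commute_frobSub p d
    refine ⟨max N₀ (Finset.univ.sup (kExp p m)), fun N hN f hf => ?_⟩
    have h1 := h N (by omega) (f ^ p ^ N) (pow_mem_frobSub p (fun _ => le_rfl) f)
    have h2 : f ^ p ^ N ∈ Zm p m := pow_mem_frobSub p (fun i =>
      (Finset.le_sup (Finset.mem_univ i)).trans ((le_max_right _ _).trans hN)) f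
    have h3 : mulOp K (f ^ p ^ N) • uι p m v = 0 := by
      rw [← amMul_uι, centralSet_smul p m (mem_centralSet_amMul h2
        (Ideal.pow_mem_of_mem _ hf _ (pow_pos (Fact.out : p.Prime).pos N))), map_zero]
    rw [← mul_smul, ← h1.eq, mul_smul]
    exact (congrArg (d • ·) h3).trans (smul_zero d)

variable {p m} in
/-- Every nonzero element of `U(m)` has a nonzero multiple annihilated by `m`. -/
theorem exists_mulOp_smul_ne_zero {u : Um p m} (hu : u ≠ 0) :
    ∃ f : MvPolynomial σ K, mulOp K f • u ≠ 0 ∧ ∀ g ∈ m.asIdeal, mulOp K g • mulOp K f • u = 0 := by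
  -- The annihilator of u in P_s: proper as u ≠ 0, and its radical contains m, so
  -- `exists_pow_le_of_le_radical` applies.
  let J : Ideal (MvPolynomial σ K) :=
    { carrier := {f | mulOp K f • u = 0}
      add_mem' := fun {a b} ha hb => by
        change mulOp K (a + b) • u = 0
        rw [map_add, add_smul, ha, hb, add_zero]
      zero_mem' := by
        change mulOp K 0 • u = 0
        rw [map_zero, zero_smul]
      smul_mem' := fun c a ha => by
        change mulOp K (c * a) • u = 0
        rw [map_mul, mul_smul, ha, smul_zero] }
  obtain ⟨N, hN⟩ := exists_frob_smul_eq_zero p m u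
  obtain ⟨f, hf, hfg⟩ := exists_pow_le_of_le_radical m (J := J) (by
    rw [Ne, Ideal.eq_top_iff_one]
    intro h
    change mulOp K 1 • u = 0 at h
    rw [map_one, one_smul] at h
    exact hu h) (fun f hf => ⟨p ^ N, hN f hf⟩)
  refine ⟨f, hf, fun g hg => ?_⟩
  rw [← mul_smul, ← map_mul, mul_comm]
  exact hfg g hg

variable {p m} in
-- Multiplying by a polynomial makes u killed by m, hence by Z ∩ m, while nonzero. A divided power
-- keeps both properties, up to Z ∩ m, so the result is in V(m), where simplicity finishes.
theorem exists_smul_eq_uι_vOne {u : Um p m} (hu : u ≠ 0) :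
    ∃ d : DP K σ, d • u = uι p m (vOne p m) := by
  obtain ⟨f, h1, h2⟩ := exists_mulOp_smul_ne_zero hu
  obtain ⟨β, e1, e2, -⟩ := exists_hasse_annihilated p m h1 fun z _ hzm => h2 z hzm
  obtain ⟨v, hv⟩ := exists_uι_eq e2
  have hv0 : v ≠ 0 := by
    rintro rfl
    rw [hv, map_zero] at e1
    exact e1 rfl
  obtain ⟨a, ha⟩ := exists_smul_eq_vOne hv0
  refine ⟨a * hasse K β * mulOp K f, ?_⟩
  rw [mul_smul, mul_smul, hv, ← ha]
  exact (Induced.ι_smul a v).symm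

/-- The image of the generator satisfies the same relations as the generator: annihilation by Z ∩ m
puts it in V(m), annihilation by the ∂^[β] of the box puts it in the line of Z. This determines the
endomorphism. -/
theorem uTHom_surjective : Function.Surjective (uTHom p m) := by
  intro g
  have h1 : ∀ z ∈ Zm p m, z ∈ m.asIdeal → mulOp K z • g (uι p m (vOne p m)) = 0 := by
    intro z hz hzm
    rw [← map_smul]
    have h0 : mulOp K z • uι p m (vOne p m) = 0 := by
      rw [← amMul_uι, centralSet_smul p m (mem_centralSet_amMul hz hzm), map_zero]
    exact (congrArg g h0).trans (map_zero g)
  obtain ⟨v, hv⟩ := exists_uι_eq h1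
  obtain ⟨z, hz, hvz⟩ := exists_vMap_eq (v := v) (fun β hβ hβ' => by
    apply uι_injective p m
    rw [amHasse_uι hβ', ← hv, map_zero, ← map_smul]
    have h0 : hasse K β • uι p m (vOne p m) = 0 := by
      rw [← amHasse_uι hβ', amHasse_smul_vOne hβ, map_zero]
    exact (congrArg g h0).trans (map_zero g))
  refine ⟨⟨z, hz⟩, Um_hom_ext ?_⟩
  change uT p m ⟨z, hz⟩ _ = _
  rw [uT_uι_vOne, hv, hvz]

/-- `End U(m) = (P_s / m)^sep`. -/
def endUmEquiv : Module.End (DP K σ) (Um p m) ≃ₐ[K] ResSep m :=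
  (Ideal.quotientKerAlgEquivOfSurjective (uTHom_surjective p m)).symm.trans
    ((Ideal.quotientEquivAlgOfEq K (by
      ext z
      rw [RingHom.mem_ker, RingHom.mem_ker]
      exact (uT_eq_zero_iff p m z).trans (zSep_eq_zero_iff p m).symm)).trans
    (Ideal.quotientKerAlgEquivOfSurjective (zSep_surjective p m)))

end Umod
end
end TinyDMod

namespace TinyDMod
noncomputable section

/-! ### Outer tensor products -/

section OuterModule

set_option linter.unusedSectionVars false

open MvPolynomial

variable {K : Type u} [Field K] {n : ℕ} {ε : Fin n → ℤˣ}
variable {Φ : DP K (NegIdx ε) ⊗[K] DP K (PosIdx ε) ≃ₐ[K] DP K (Fin n)}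
variable {M N : Type u} [AddCommGroup M] [Module K M] [Module (DP K (NegIdx ε)) M]
  [IsScalarTower K (DP K (NegIdx ε)) M] [AddCommGroup N] [Module K N] [Module (DP K (PosIdx ε)) N]
  [IsScalarTower K (DP K (PosIdx ε)) N]

theorem Outer.smul_tmul (a : DP K (NegIdx ε)) (b : DP K (PosIdx ε)) (x : M) (y : N) :
    Φ (a ⊗ₜ b) • Outer.tmul Φ x y = Outer.tmul Φ (a • x) (b • y) := by
  rw [Outer.smul_def, outerAct]
  simp only [AlgHom.comp_apply]
  have : (Φ.symm : DP K (Fin n) →ₐ[K] DP K (NegIdx ε) ⊗[K] DP K (PosIdx ε)) (Φ (a ⊗ₜ b)) =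
      a ⊗ₜ b := Φ.symm_apply_apply _
  rw [this, Algebra.TensorProduct.map_tmul]
  rfl

theorem Outer.zero_tmul (y : N) : Outer.tmul Φ (0 : M) y = 0 :=
  TensorProduct.zero_tmul M y

theorem Outer.smul_tmul_left (c : K) (x : M) (y : N) :
    Outer.tmul Φ (c • x) y = c • Outer.tmul Φ x y :=
  (TensorProduct.smul_tmul' c x y).symm

theorem Outer.induction {Q : Outer Φ M N → Prop} (hadd : ∀ x y, Q x → Q y → Q (x + y))
    (h : ∀ (x : M) (y : N), Q (Outer.tmul Φ x y)) (x : Outer Φ M N) : Q x := by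
  induction x using TensorProduct.induction_on with
  | zero =>
    have := h 0 0
    rw [map_zero] at this
    exact this
  | add x y hx hy => exact hadd x y hx hy
  | tmul x y => exact h x y

/-- A `K`-linear map from an outer tensor product that is compatible with the actions on pure
tensors is linear over the differential operators. -/
def Outer.lift {L : Type*} [AddCommGroup L] [Module K L] [Module (DP K (Fin n)) L]
    [IsScalarTower K (DP K (Fin n)) L] (F : Outer Φ M N →ₗ[K] L)
    (h : ∀ (a : DP K (NegIdx ε)) (b : DP K (PosIdx ε)) x y,
      F (Outer.tmul Φ (a • x) (b • y)) = Φ (a ⊗ₜ b) • F (Outer.tmul Φ x y)) :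
    Outer Φ M N →ₗ[DP K (Fin n)] L where
  toFun := F
  map_add' := map_add F
  map_smul' := fun d x => by
    obtain ⟨z, rfl⟩ := Φ.surjective d
    rw [RingHom.id_apply]
    induction x using Outer.induction with
    | hadd x y hx hy => rw [smul_add, map_add, hx, hy, map_add, smul_add]
    | h x y =>
      induction z using TensorProduct.induction_on with
      | zero => rw [map_zero, zero_smul, zero_smul, map_zero]
      | add z w hz hw => rw [map_add, add_smul, map_add, hz, hw, add_smul]
      | tmul a b => rw [Outer.smul_tmul, h]

theorem Outer.lift_apply {L : Type*} [AddCommGroup L] [Module K L] [Module (DP K (Fin n)) L]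
    [IsScalarTower K (DP K (Fin n)) L] (F : Outer Φ M N →ₗ[K] L)
    (h : ∀ (a : DP K (NegIdx ε)) (b : DP K (PosIdx ε)) x y,
      F (Outer.tmul Φ (a • x) (b • y)) = Φ (a ⊗ₜ b) • F (Outer.tmul Φ x y)) (x : Outer Φ M N) :
    Outer.lift F h x = F x := rfl

end OuterModule

/-! ### Modules P_t ⊗ N and their endomorphisms -/

section PolyOuter

set_option linter.unusedSectionVars false

open MvPolynomial

variable {K : Type u} [Field K] {n : ℕ} {ε : Fin n → ℤˣ}
variable (Φ : DP K (NegIdx ε) ⊗[K] DP K (PosIdx ε) ≃ₐ[K] DP K (Fin n))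
variable (N : Type u) [AddCommGroup N] [Module K N] [Module (DP K (PosIdx ε)) N]
  [IsScalarTower K (DP K (PosIdx ε)) N]

/-- The tensor product `P_t ⊗ N`. -/
abbrev PolyOuter : Type u := Outer Φ (MvPolynomial (NegIdx ε) K) N

/-- The coefficients of the elements of `P_t ⊗ N`. -/
def outerEquiv : ((NegIdx ε →₀ ℕ) →₀ N) ≃ₗ[K] PolyOuter Φ N :=
  (TensorProduct.equivFinsuppOfBasisLeft (N := N) (basisMonomials (NegIdx ε) K)).symm

theorem outerEquiv_apply (f : (NegIdx ε →₀ ℕ) →₀ N) :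
    outerEquiv Φ N f = f.sum fun α y => Outer.tmul Φ (monomial α 1) y := by
  refine (TensorProduct.equivFinsuppOfBasisLeft_symm_apply _ f).trans ?_
  simp only [coe_basisMonomials]
  rfl

theorem outerEquiv_single (α : NegIdx ε →₀ ℕ) (y : N) :
    outerEquiv Φ N (Finsupp.single α y) = Outer.tmul Φ (monomial α 1) y := by
  rw [outerEquiv_apply]
  exact Finsupp.sum_single_index (h := fun α y => Outer.tmul Φ (monomial α 1) y) (map_zero _)

theorem Outer.tmul_one_injective : Function.Injective (Outer.tmul Φ (1 : MvPolynomial (NegIdx ε) K) (N := N)) := by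
  intro y y' h
  have h1 : ∀ y : N, Outer.tmul Φ (1 : MvPolynomial (NegIdx ε) K) y =
      outerEquiv Φ N (Finsupp.single 0 y) := fun y => (outerEquiv_single Φ N 0 y).symm
  rw [h1, h1] at h
  exact Finsupp.single_injective 0 ((outerEquiv Φ N).injective h)

variable {N}

/-- Every nonzero element of `P_t ⊗ N` is mapped to some `1 ⊗ y ≠ 0` by some `∂^[β]`. -/
theorem exists_hasse_smul_eq {x : PolyOuter Φ N} (hx : x ≠ 0) :
    ∃ (β : NegIdx ε →₀ ℕ) (y : N), y ≠ 0 ∧ Φ (hasse K β ⊗ₜ 1) • x = Outer.tmul Φ 1 y ∧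
      (β = 0 → x = Outer.tmul Φ 1 y) := by
  classical
  obtain ⟨f, rfl⟩ := (outerEquiv Φ N).surjective x
  have hf : f ≠ 0 := fun h => hx (by rw [h, map_zero])
  obtain ⟨β, hβ, hmax⟩ := Finset.exists_max_image f.support (fun α => α.degree)
    (Finsupp.support_nonempty_iff.2 hf)
  have h1 : Φ (hasse K β ⊗ₜ 1) • outerEquiv Φ N f = Outer.tmul Φ 1 (f β) := by
    rw [outerEquiv_apply, Finsupp.sum, Finset.smul_sum, Finset.sum_eq_single β]
    · rw [Outer.smul_tmul, hasse_smul, hasseEnd_monomial_of_degree_le le_rfl, if_pos rfl, one_smul]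
    · intro α hα hne
      rw [Outer.smul_tmul, hasse_smul, hasseEnd_monomial_of_degree_le (hmax α hα), if_neg hne]
      exact TensorProduct.zero_tmul _ _
    · exact fun hh => absurd hβ hh
  refine ⟨β, f β, Finsupp.mem_support_iff.1 hβ, h1, fun h0 => ?_⟩
  rw [← h1, h0, hasse_zero, ← Algebra.TensorProduct.one_def, map_one, one_smul]

theorem exists_eq_tmul_one {x : PolyOuter Φ N}
    (hx : ∀ β : NegIdx ε →₀ ℕ, β ≠ 0 → Φ (hasse K β ⊗ₜ 1) • x = 0) :
    ∃ y, x = Outer.tmul Φ 1 y := by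
  by_cases h : x = 0
  · exact ⟨0, by rw [h, map_zero]⟩
  obtain ⟨β, y, hy, h1, h2⟩ := exists_hasse_smul_eq Φ h
  refine ⟨y, h2 ?_⟩
  by_contra h0
  rw [hx β h0] at h1
  exact hy (Outer.tmul_one_injective Φ N (by rw [← h1, map_zero]))

theorem hasse_smul_one {σ : Type} [Fintype σ] {β : σ →₀ ℕ} (hβ : β ≠ 0) :
    hasse K β • (1 : MvPolynomial σ K) = 0 := by
  rw [hasse_smul]
  have := hasseEnd_monomial (K := K) β 0 1
  rw [multiChoose_eq_zero (by simpa using hβ), zero_smul] at this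
  exact this

theorem hasse_smul_tmul_one {β : NegIdx ε →₀ ℕ} (hβ : β ≠ 0) (y : N) :
    Φ (hasse K β ⊗ₜ 1) • Outer.tmul Φ (1 : MvPolynomial (NegIdx ε) K) y = 0 := by
  rw [Outer.smul_tmul, hasse_smul_one hβ]
  exact TensorProduct.zero_tmul _ _

/-- The endomorphism `1 ⊗ g` of `P_t ⊗ N`. -/
def lTensorEnd (g : Module.End (DP K (PosIdx ε)) N) :
    Module.End (DP K (Fin n)) (PolyOuter Φ N) :=
  Outer.lift (Φ := Φ) (M := MvPolynomial (NegIdx ε) K) (N := N) (L := PolyOuter Φ N)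
    (LinearMap.lTensor (MvPolynomial (NegIdx ε) K) (g.restrictScalars K)) fun a b x y => by
      change Outer.tmul Φ (a • x) (g (b • y)) = Φ (a ⊗ₜ b) • Outer.tmul Φ x (g y)
      rw [Outer.smul_tmul, map_smul]

theorem lTensorEnd_tmul (g : Module.End (DP K (PosIdx ε)) N) (x : MvPolynomial (NegIdx ε) K)
    (y : N) : lTensorEnd Φ g (Outer.tmul Φ x y) = Outer.tmul Φ x (g y) := rfl

variable {Φ} in
theorem PolyOuter.end_ext {h h' : Module.End (DP K (Fin n)) (PolyOuter Φ N)}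
    (H : ∀ x y, h (Outer.tmul Φ x y) = h' (Outer.tmul Φ x y)) : h = h' := by
  ext x
  induction x using Outer.induction with
  | hadd x y hx hy => rw [map_add, hx, hy, map_add]
  | h x y => exact H x y

/-- The map `g ↦ 1 ⊗ g`. -/
def outerEndLin : Module.End (DP K (PosIdx ε)) N →ₗ[K]
    Module.End (DP K (Fin n)) (PolyOuter Φ N) where
  toFun := lTensorEnd Φ
  map_add' := fun g g' => PolyOuter.end_ext fun x y => by
    rw [LinearMap.add_apply, lTensorEnd_tmul, lTensorEnd_tmul, lTensorEnd_tmul,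
      LinearMap.add_apply, map_add]
  map_smul' := fun c g => PolyOuter.end_ext fun x y => by
    rw [RingHom.id_apply, LinearMap.smul_apply, lTensorEnd_tmul, lTensorEnd_tmul,
      LinearMap.smul_apply, map_smul]

/-- The homomorphism `g ↦ 1 ⊗ g`. -/
def outerEnd : Module.End (DP K (PosIdx ε)) N →ₐ[K] Module.End (DP K (Fin n)) (PolyOuter Φ N) :=
  AlgHom.ofLinearMap (outerEndLin Φ)
    (PolyOuter.end_ext fun x y => lTensorEnd_tmul Φ 1 x y)
    (fun g g' => PolyOuter.end_ext fun x y => lTensorEnd_tmul Φ (g * g') x y)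

theorem outerEnd_tmul (g : Module.End (DP K (PosIdx ε)) N) (x : MvPolynomial (NegIdx ε) K) (y : N) :
    outerEnd Φ g (Outer.tmul Φ x y) = Outer.tmul Φ x (g y) := rfl

theorem mulOp_smul_tmul_one (f : MvPolynomial (NegIdx ε) K) (y : N) :
    Φ (mulOp K f ⊗ₜ 1) • Outer.tmul Φ (1 : MvPolynomial (NegIdx ε) K) y = Outer.tmul Φ f y := by
  rw [Outer.smul_tmul, mulOp_smul, mul_one, one_smul]

/-- The vectors killed by all ∂^[β] ⊗ 1, β ≠ 0, form 1 ⊗ N, so an endomorphism preserves 1 ⊗ N and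
induces g there; it equals 1 ⊗ g because multiplication operators generate P_t ⊗ N from 1 ⊗ N. -/
theorem outerEnd_bijective : Function.Bijective (outerEnd Φ (N := N)) := by
  constructor
  · rw [injective_iff_map_eq_zero]
    intro g hg
    ext y
    refine Outer.tmul_one_injective Φ N ?_
    rw [← outerEnd_tmul, hg]
    exact (map_zero _).symm
  · intro h
    have h1 : ∀ y : N, ∃ y', h (Outer.tmul Φ 1 y) = Outer.tmul Φ 1 y' := fun y =>
      exists_eq_tmul_one Φ fun β hβ => by
        rw [← map_smul, hasse_smul_tmul_one Φ hβ, map_zero]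
    choose g hg using h1
    have hinj := Outer.tmul_one_injective Φ N
    refine ⟨{ toFun := g
              map_add' := fun x y => hinj (by rw [← hg, map_add, map_add, map_add, hg, hg])
              map_smul' := fun b y => hinj (by
                have e : ∀ y : N, Outer.tmul Φ (1 : MvPolynomial (NegIdx ε) K) (b • y) =
                    Φ (1 ⊗ₜ b) • Outer.tmul Φ (1 : MvPolynomial (NegIdx ε) K) y := fun y => by
                  rw [Outer.smul_tmul, one_smul]
                rw [← hg, e, map_smul, hg, RingHom.id_apply, e]) }, ?_⟩
    ext x
    induction x using Outer.induction with
    | hadd x y hx hy => rw [map_add, hx, hy, map_add]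
    | h x y =>
      rw [outerEnd_tmul, ← mulOp_smul_tmul_one, ← mulOp_smul_tmul_one Φ x y, map_smul, hg]
      rfl

variable (K) in
-- If β is an exponent of maximal degree in f, then ∂^[β] f is the nonzero coefficient at β, so β =
-- 0.
theorem exists_hasse_smul_poly {σ : Type} [Fintype σ] {f : MvPolynomial σ K}
    (hf : ∀ β : σ →₀ ℕ, β ≠ 0 → hasse K β • f = 0) : ∃ c, f = C c := by
  classical
  by_cases h0 : f = 0
  · exact ⟨0, by rw [h0, map_zero]⟩
  obtain ⟨β, hβ, hmax⟩ := Finset.exists_max_image f.support (fun α => α.degree)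
    (support_nonempty.2 h0)
  have h1 : hasse K β • f = C (coeff β f) := by
    conv_lhs => rw [f.as_sum, Finset.smul_sum]
    have e : ∀ α c, (monomial α c : MvPolynomial σ K) = c • monomial α 1 := fun α c => by
      rw [smul_monomial, smul_eq_mul, mul_one]
    rw [Finset.sum_eq_single β]
    · rw [e, smul_comm, hasse_smul, hasseEnd_monomial_of_degree_le le_rfl, if_pos rfl,
        smul_eq_C_mul, mul_one]
    · intro α hα hne
      rw [e, smul_comm, hasse_smul, hasseEnd_monomial_of_degree_le (hmax α hα), if_neg hne,
        smul_zero]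
    · exact fun hh => absurd hβ hh
  by_cases hβ0 : β = 0
  · exact ⟨coeff β f, by rw [← h1, hβ0, hasse_zero, one_smul]⟩
  · rw [hf β hβ0] at h1
    exact absurd (C_eq_zero.1 h1.symm) (Finsupp.mem_support_iff.1 hβ)

variable (K) in
/-- `End P_t = K`. -/
def endPolyEquiv (σ : Type) [Fintype σ] :
    K ≃ₐ[K] Module.End (DP K σ) (MvPolynomial σ K) :=
  AlgEquiv.ofBijective (Algebra.ofId K _) (by
    refine ⟨(algebraMap K _).injective, fun f => ?_⟩
    obtain ⟨c, hc⟩ := exists_hasse_smul_poly K (f := f 1) fun β hβ => by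
      rw [← map_smul, hasse_smul_one hβ, map_zero]
    refine ⟨c, ?_⟩
    ext1 g
    change c • g = f g
    have h1 : ∀ g : MvPolynomial σ K, g = mulOp K g • 1 := fun g => by rw [mulOp_smul, mul_one]
    rw [h1 g, map_smul, hc, ← smul_comm, smul_eq_C_mul, mul_one])

/-- `End (P_t ⊗ N) = End P_t ⊗ End N`. -/
def outerEndEquiv : Module.End (DP K (NegIdx ε)) (MvPolynomial (NegIdx ε) K) ⊗[K]
    Module.End (DP K (PosIdx ε)) N ≃ₐ[K] Module.End (DP K (Fin n)) (PolyOuter Φ N) :=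
  ((Algebra.TensorProduct.congr (endPolyEquiv K (NegIdx ε)).symm AlgEquiv.refl).trans
    (Algebra.TensorProduct.lid K _)).trans (AlgEquiv.ofBijective _ (outerEnd_bijective Φ))

theorem outerEndEquiv_tmul (f : Module.End (DP K (NegIdx ε)) (MvPolynomial (NegIdx ε) K))
    (g : Module.End (DP K (PosIdx ε)) N) (x : MvPolynomial (NegIdx ε) K) (y : N) :
    outerEndEquiv Φ (f ⊗ₜ[K] g) (Outer.tmul Φ x y) = Outer.tmul Φ (f x) (g y) := by
  obtain ⟨c, rfl⟩ := (endPolyEquiv K (NegIdx ε)).surjective f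
  have h1 : outerEndEquiv Φ (endPolyEquiv K (NegIdx ε) c ⊗ₜ[K] g) = outerEnd Φ (c • g) := by
    simp [outerEndEquiv]
  rw [h1, outerEnd_tmul]
  change Outer.tmul Φ x (c • g y) = Outer.tmul Φ (c • x) (g y)
  rw [map_smul, Outer.smul_tmul_left]

end PolyOuter
end
end TinyDMod

namespace TinyDMod
noncomputable section

/-! ### The module 𝒰(m): simplicity, filtration, failure of finite presentation -/

section UcalStructure

set_option linter.unusedSectionVars false

open MvPolynomial

variable {K : Type u} [Field K] {n : ℕ} {ε : Fin n → ℤˣ} {p : ℕ} [Fact p.Prime] [CharP K p]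
variable {m : MaximalSpectrum (MvPolynomial (PosIdx ε) K)}

variable (p m) in
/-- The generator `1 ⊗ 1 ⊗ 1` of `𝒰(m)`. -/
def ucalOne : Ucal (tensorIso ε K) p m := Outer.tmul (tensorIso ε K) 1 (uι p m (vOne p m))

theorem exists_smul_ucalOne (x : Ucal (tensorIso ε K) p m) :
    ∃ d : DP K (Fin n), d • ucalOne p m = x := by
  induction x using Outer.induction with
  | hadd x y hx hy =>
    obtain ⟨a, rfl⟩ := hx
    obtain ⟨b, rfl⟩ := hy
    exact ⟨a + b, add_smul _ _ _⟩
  | h f u =>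
    obtain ⟨d, rfl⟩ := exists_smul_uι_vOne p m u
    refine ⟨tensorIso ε K (mulOp K f ⊗ₜ d), ?_⟩
    rw [ucalOne, Outer.smul_tmul, mulOp_smul, mul_one]

theorem ucalOne_ne_zero : ucalOne p m ≠ 0 := by
  intro h
  have h1 : Outer.tmul (tensorIso ε K) (1 : MvPolynomial (NegIdx ε) K) (uι p m (vOne p m)) =
      Outer.tmul (tensorIso ε K) 1 0 := by rw [map_zero]; exact h
  have h2 := Outer.tmul_one_injective _ _ h1
  rw [← map_zero (uι p m)] at h2
  have h3 := uι_injective p m h2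
  have : Nontrivial (Vm p m) := IsSimpleModule.nontrivial (Am p m) _
  obtain ⟨v, hv⟩ := exists_ne (0 : Vm p m)
  obtain ⟨a, rfl⟩ := exists_smul_vOne p m v
  exact hv (by rw [h3, smul_zero])

/-- First ∂^[β] ⊗ 1 reduces the vector to some 1 ⊗ u with u ≠ 0, then the corresponding property of
U(m) applies to u. -/
theorem exists_smul_eq_ucalOne {x : Ucal (tensorIso ε K) p m} (hx : x ≠ 0) :
    ∃ d : DP K (Fin n), d • x = ucalOne p m := by
  obtain ⟨β, u, hu, h1, -⟩ := exists_hasse_smul_eq (tensorIso ε K) hx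
  obtain ⟨d, hd⟩ := exists_smul_eq_uι_vOne hu
  refine ⟨tensorIso ε K (1 ⊗ₜ d) * tensorIso ε K (hasse K β ⊗ₜ 1), ?_⟩
  rw [mul_smul, h1, Outer.smul_tmul, hd, one_smul]
  rfl

instance isSimpleModule_Ucal : IsSimpleModule (DP K (Fin n)) (Ucal (tensorIso ε K) p m) := by
  rw [isSimpleModule_iff_toSpanSingleton_surjective]
  refine ⟨⟨_, _, ucalOne_ne_zero (p := p) (m := m)⟩, fun x hx y => ?_⟩
  obtain ⟨a, ha⟩ := exists_smul_eq_ucalOne hx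
  obtain ⟨b, hb⟩ := exists_smul_ucalOne y
  exact ⟨b * a, by rw [LinearMap.toSpanSingleton_apply, mul_smul, ha, hb]⟩

theorem psIncl_smul_tmul (g : MvPolynomial (PosIdx ε) K) (f : MvPolynomial (NegIdx ε) K)
    (u : Um p m) : psIncl K ε g • Outer.tmul (tensorIso ε K) f u =
      Outer.tmul (tensorIso ε K) f (mulOp K g • u) := by
  rw [← tensorIso_mulOp_right, Outer.smul_tmul, one_smul]

theorem exists_psIncl_pow_smul_eq_zero (x : Ucal (tensorIso ε K) p m) :
    ∃ N, ∀ f ∈ m.asIdeal, psIncl K ε (f ^ p ^ N) • x = 0 := by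
  induction x using Outer.induction with
  | hadd x y hx hy =>
    obtain ⟨a, ha⟩ := hx
    obtain ⟨b, hb⟩ := hy
    -- The exponent p^{a+b} serves both summands: it is the p^b-th power of f^{p^a}, again an
    -- element of m, and also a multiple of f^{p^a}.
    refine ⟨a + b, fun f hf => ?_⟩
    have hp : ∀ N, 0 < p ^ N := fun N => pow_pos (Fact.out : p.Prime).pos N
    rw [smul_add, pow_add, pow_mul, hb _ (Ideal.pow_mem_of_mem _ hf _ (hp a)), add_zero,
      ← Nat.sub_add_cancel (hp b), pow_succ, map_mul, mul_smul, ha f hf, smul_zero]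
  | h f u =>
    obtain ⟨N, hN⟩ := exists_frob_smul_eq_zero p m u
    exact ⟨N, fun g hg => by rw [psIncl_smul_tmul, hN g hg, map_zero]⟩

theorem summandMap_apply (α : NegIdx ε →₀ ℕ) (γ : PosIdx ε → ℕ) (v : Vm p m) :
    summandMap (tensorIso ε K) p m α γ v =
      Outer.tmul (tensorIso ε K) (monomial α 1) (uMap p m γ v) := rfl

variable (p m) in
theorem lsum_summandMap_bijective : Function.Bijective (Finsupp.lsum K
    fun x : (NegIdx ε →₀ ℕ) × (PosIdx ε → ℕ) => summandMap (tensorIso ε K) p m x.1 x.2) := by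
  classical
  let e := LinearEquiv.ofBijective _ (lsum_uMap_bijective p m)
  have : (Finsupp.lsum K
      fun x : (NegIdx ε →₀ ℕ) × (PosIdx ε → ℕ) => summandMap (tensorIso ε K) p m x.1 x.2) =
      ((Finsupp.curryLinearEquiv K).trans ((Finsupp.mapRange.linearEquiv e).trans
        (outerEquiv (tensorIso ε K) (Um p m)))).toLinearMap := by
    refine Finsupp.lhom_ext fun x v => ?_
    rw [Finsupp.lsum_single, summandMap_apply]
    change _ = outerEquiv (tensorIso ε K) (Um p m)
      (Finsupp.mapRange e (map_zero e) (Finsupp.curry (Finsupp.single x v)))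
    rw [Finsupp.curry_single, Finsupp.mapRange_single, outerEquiv_single]
    congr 1
    exact (Finsupp.lsum_single K _ _ _).symm
  rw [this]
  exact LinearEquiv.bijective _

variable (p m) in
/-- The step `𝒰(m)_i` as a sum of copies of `V(m)`. -/
def ucalFil (i : ℕ) : Submodule K (Ucal (tensorIso ε K) p m) :=
  ⨆ (α : NegIdx ε →₀ ℕ) (γ : PosIdx ε → ℕ) (_ : α.degree + ∑ j, γ j * p ^ kExp p m j ≤ i),
    LinearMap.range (summandMap (tensorIso ε K) p m α γ)

theorem tmul_mem_ucalFil {α : NegIdx ε →₀ ℕ} {u : Um p m} {i j : ℕ} (hu : u ∈ uFil p m j)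
    (h : α.degree + j ≤ i) :
    Outer.tmul (tensorIso ε K) (monomial α (1 : K)) u ∈ ucalFil p m i := by
  have : uFil p m j ≤ (ucalFil p m i).comap (Outer.tmul (tensorIso ε K) (monomial α (1 : K))) := by
    refine iSup_le fun γ => iSup_le fun hγ => ?_
    rintro _ ⟨v, rfl⟩
    exact Submodule.mem_iSup_of_mem α (Submodule.mem_iSup_of_mem γ
      (Submodule.mem_iSup_of_mem (by omega) ⟨v, rfl⟩))
  exact this hu

variable (p m) in
theorem ucalFil_mono : Monotone (ucalFil p m) := fun _ _ hij =>
  iSup_mono fun _ => iSup_mono fun _ => iSup_mono' fun h => ⟨h.trans hij, le_rfl⟩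

variable (p m) in
-- Divided powers in the variables of P_t kill 1, and polynomials in those of P_s do not raise the
-- weight; what remains are monomials x^α and the filtration of U(m).
theorem mulSpace_canonFil_baseUcal (i : ℕ) :
    mulSpace (canonFil K (σ := Fin n) i) (baseUcal (tensorIso ε K) p m) = ucalFil p m i := by
  refine le_antisymm ?_ ?_
  · refine Submodule.span_le.2 ?_
    rintro _ ⟨a, ha, _, ⟨_, ⟨v, rfl⟩, rfl⟩, rfl⟩
    rw [SetLike.mem_coe]
    induction ha using Submodule.span_induction with
    | zero => rw [zero_smul]; exact zero_mem _
    | add x y _ _ hx hy => rw [add_smul]; exact add_mem hx hy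
    | smul c x _ hx => rw [smul_assoc]; exact Submodule.smul_mem _ _ hx
    | mem x hx =>
      obtain ⟨α, β, h, rfl⟩ := hx
      obtain ⟨⟨α₁, α₂⟩, rfl⟩ := (joinEquiv ε).surjective α
      obtain ⟨⟨β₁, β₂⟩, rfl⟩ := (joinEquiv ε).surjective β
      change (joinIdx α₁ α₂).degree + (joinIdx β₁ β₂).degree ≤ i at h
      change (mulOp K (monomial (joinIdx α₁ α₂) 1) * hasse K (joinIdx β₁ β₂)) • _ ∈ _
      rw [degree_joinIdx, degree_joinIdx] at h
      have h1 := rename_mul_rename (ε := ε) K α₁ α₂ 1 1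
      rw [mul_one] at h1
      rw [← h1, ← tensorIso_mulOp_hasse, Outer.smul_tmul, mul_smul, mul_smul, mulOp_smul]
      by_cases hβ : β₁ = 0
      · rw [hβ, hasse_zero, one_smul, mul_one]
        exact tmul_mem_ucalFil (mulOp_smul_mem_uFil p m _
          (hasse_smul_uι_mem_uFil p m β₂ v le_rfl)) (by omega)
      · rw [hasse_smul_one hβ, mul_zero, Outer.zero_tmul]
        exact zero_mem _
  · refine iSup_le fun α => iSup_le fun γ => iSup_le fun h => ?_
    rintro _ ⟨v, rfl⟩
    refine Submodule.subset_span ⟨tensorIso ε K ((mulOp K (monomial α 1) * hasse K 0) ⊗ₜ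
      (mulOp K (monomial 0 1) * hasse K (qExp p m γ))), ?_, Outer.tmul (tensorIso ε K) 1 (uι p m v),
      ⟨_, ⟨v, rfl⟩, rfl⟩, ?_⟩
    · rw [tensorIso_mulOp_hasse, rename_mul_rename, mul_one]
      refine monomial_hasse_mem_canonFil _ _ ?_
      simp only [degree_joinIdx, map_zero, add_zero, zero_add]
      refine le_trans (le_of_eq ?_) h
      rw [Finsupp.degree_eq_sum (qExp p m γ)]
      rfl
    · rw [Outer.smul_tmul, hasse_zero, mul_one, mulOp_smul, mul_one]
      have h0 : mulOp K (monomial 0 1 : MvPolynomial (PosIdx ε) K) = 1 := map_one _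
      rw [h0, one_mul, summandMap_apply, uMap_apply]

theorem exists_mem_ucalFil (x : Ucal (tensorIso ε K) p m) : ∃ i, x ∈ ucalFil p m i := by
  obtain ⟨f, rfl⟩ := (lsum_summandMap_bijective p m).2 x
  induction f using Finsupp.induction_linear with
  | zero => exact ⟨0, by rw [map_zero]; exact zero_mem _⟩
  | add f g hf hg =>
    obtain ⟨i, hf⟩ := hf
    obtain ⟨j, hg⟩ := hg
    refine ⟨max i j, ?_⟩
    rw [map_add]
    exact add_mem (ucalFil_mono p m (le_max_left i j) hf) (ucalFil_mono p m (le_max_right i j) hg)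
  | single x v =>
    refine ⟨x.1.degree + ∑ j, x.2 j * p ^ kExp p m j, ?_⟩
    rw [Finsupp.lsum_single]
    exact Submodule.mem_iSup_of_mem x.1 (Submodule.mem_iSup_of_mem x.2
      (Submodule.mem_iSup_of_mem le_rfl ⟨v, rfl⟩))

/-- Each generator of Λ_ε respects the weights: an x_i with ε_i = 1 does not raise them on U(m), and
a ∂_i^[j] with ε_i = -1 lowers degrees on P_t. Local finiteness follows, as these spaces have finite
dimension. -/
theorem Lam_smul_mem_ucalFil {a : DP K (Fin n)} (ha : a ∈ Lam K ε) {i : ℕ}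
    {x : Ucal (tensorIso ε K) p m} (hx : x ∈ ucalFil p m i) : a • x ∈ ucalFil p m i := by
  have key : ∀ a : DP K (Fin n), (∀ (α : NegIdx ε →₀ ℕ) (γ : PosIdx ε → ℕ) (v : Vm p m),
      α.degree + ∑ j, γ j * p ^ kExp p m j ≤ i →
      a • Outer.tmul (tensorIso ε K) (monomial α (1 : K)) (uMap p m γ v) ∈ ucalFil p m i) →
      ∀ {x : Ucal (tensorIso ε K) p m}, x ∈ ucalFil p m i → a • x ∈ ucalFil p m i := by
    intro a h x hx
    have : ucalFil p m i ≤
        (ucalFil p m i).comap (Algebra.lsmul K K (Ucal (tensorIso ε K) p m) a) := by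
      refine iSup_le fun α => iSup_le fun γ => iSup_le fun h' => ?_
      rintro _ ⟨v, rfl⟩
      exact h α γ v h'
    exact this hx
  induction ha using Algebra.adjoin_induction generalizing x with
  | mem a ha =>
    refine key a ?_ hx
    intro α γ v h
    rcases ha with ⟨k, hk, rfl⟩ | ⟨k, j, hk, rfl⟩
    · have h1 : mulOp K (X k) = psIncl K ε (X ⟨k, hk⟩) := by
        rw [psIncl, AlgHom.comp_apply, rename_X]
      rw [h1, psIncl_smul_tmul]
      exact tmul_mem_ucalFil (X_smul_mem_uFil p m _ (uMap_mem_uFil le_rfl v)) h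
    · have h1 := tensorIso_partialPow K (⟨k, hk⟩ : NegIdx ε) j
      rw [← h1, Outer.smul_tmul, one_smul, partialPow, hasse_smul, hasseEnd_monomial]
      have h2 : ∀ (c : ℕ) (f : MvPolynomial (NegIdx ε) K) (u : Um p m),
          Outer.tmul (tensorIso ε K) (c • f) u = c • Outer.tmul (tensorIso ε K) f u :=
        fun c f u => (TensorProduct.smul_tmul' c f u).symm
      rw [h2]
      refine nsmul_mem (tmul_mem_ucalFil (uMap_mem_uFil le_rfl v) ?_) _
      exact (add_le_add (Finsupp.degree_mono tsub_le_self) le_rfl).trans h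
  | algebraMap c =>
    rw [algebraMap_smul]
    exact Submodule.smul_mem _ _ hx
  | add a b _ _ ha hb => rw [add_smul]; exact add_mem (ha hx) (hb hx)
  | mul a b _ _ ha hb => rw [mul_smul]; exact ha (hb hx)

/-- If the annihilator of the generator were finitely generated, its generators would commute with
x_i^{p^N} for N large, so the whole annihilator would kill x_i^{p^N}·1. But ∂_i^[p^N] annihilates
the generator and sends x_i^{p^N}·1 to it. -/
theorem not_finitePresentation_Ucal {i : Fin n} (hi : ε i = -1) :
    ¬ Module.FinitePresentation (DP K (Fin n)) (Ucal (tensorIso ε K) p m) := by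
  classical
  intro hfp
  have hl : Function.Surjective (LinearMap.toSpanSingleton (DP K (Fin n))
      (Ucal (tensorIso ε K) p m) (ucalOne p m)) := fun x => exists_smul_ucalOne x
  obtain ⟨s, hs⟩ := Module.FinitePresentation.fg_ker _ hl
  obtain ⟨N, hN⟩ := exists_commute_frobSub_finset p s
  have h1 : ∀ a ∈ LinearMap.ker (LinearMap.toSpanSingleton (DP K (Fin n))
      (Ucal (tensorIso ε K) p m) (ucalOne p m)),
      a • mulOp K (X i ^ p ^ N) • ucalOne p m = 0 := by
    intro a ha
    rw [← hs] at ha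
    induction ha using Submodule.span_induction with
    | zero => rw [zero_smul]
    | add x y _ _ hx hy => rw [add_smul, hx, hy, add_zero]
    | smul c x _ hx => rw [smul_assoc, hx, smul_zero]
    | mem x hx =>
      have hk : x • ucalOne p m = 0 := by
        have : x ∈ LinearMap.ker _ := hs ▸ Submodule.subset_span hx
        exact this
      have hX : (X i ^ p ^ N : MvPolynomial (Fin n) K) ∈ frobSub K p fun _ => N :=
        Algebra.subset_adjoin ⟨i, rfl⟩
      rw [← mul_smul, (hN N le_rfl x hx _ hX).eq, mul_smul, hk, smul_zero]
  have h2 : hasse K (Finsupp.single i (p ^ N)) • ucalOne p m = 0 := by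
    change partialPow K ((⟨i, hi⟩ : NegIdx ε) : Fin n) (p ^ N) • ucalOne p m = 0
    rw [← tensorIso_partialPow]
    refine hasse_smul_tmul_one (tensorIso ε K) ?_ _
    rw [Ne, Finsupp.single_eq_zero]
    exact pow_ne_zero _ (Fact.out : p.Prime).ne_zero
  have h3 : hasse K (Finsupp.single i (p ^ N)) • mulOp K (X i ^ p ^ N) • ucalOne p m = 0 :=
    h1 _ h2
  rw [← mul_smul, hasse_mul_X_pow, Finsupp.single_eq_same, if_pos le_rfl, tsub_self, hasse_zero,
    add_smul, mul_smul, h2, smul_zero, zero_add, one_smul] at h3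
  exact ucalOne_ne_zero h3

end UcalStructure
end
end TinyDMod

namespace TinyDMod
noncomputable section

/-! ### Growth is independent of the generating subspace -/

section Growth

set_option linter.unusedSectionVars false

open Filter Topology

theorem tendsto_shift_div_pow {h : ℕ → ℕ} {d : ℕ} {L : ℝ}
    (H : Tendsto (fun i : ℕ => (h i : ℝ) / (i : ℝ) ^ d) atTop (𝓝 L)) (a b : ℕ) :
    Tendsto (fun i : ℕ => (h (i + a) : ℝ) / ((i + b : ℕ) : ℝ) ^ d) atTop (𝓝 L) := by
  have h1 : Tendsto (fun i : ℕ => ((i + a : ℕ) : ℝ) / ((i + b : ℕ) : ℝ)) atTop (𝓝 1) := by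
    have h2 : Tendsto (fun i : ℕ => 1 + ((a : ℝ) - b) / ((i + b : ℕ) : ℝ)) atTop (𝓝 (1 + 0)) :=
      tendsto_const_nhds.add (tendsto_const_nhds.div_atTop
        (tendsto_natCast_atTop_atTop.comp (tendsto_add_atTop_nat b)))
    rw [add_zero] at h2
    refine h2.congr' ?_
    filter_upwards [eventually_gt_atTop 0] with i hi
    have : ((i + b : ℕ) : ℝ) ≠ 0 := by positivity
    field_simp
    push_cast
    ring
  have h3 := (H.comp (tendsto_add_atTop_nat a)).mul (h1.pow d)
  rw [one_pow, mul_one] at h3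
  refine h3.congr' ?_
  filter_upwards [eventually_gt_atTop 0] with i hi
  have h4 : ((i + b : ℕ) : ℝ) ≠ 0 := by positivity
  have h5 : ((i + a : ℕ) : ℝ) ≠ 0 := by positivity
  simp only [Function.comp_apply, div_pow]
  field_simp

variable {K : Type u} [Field K] {σ : Type} [Fintype σ]
variable {M : Type u} [AddCommGroup M] [Module K M] [Module (DP K σ) M] [IsScalarTower K (DP K σ) M]

theorem mulSpace_le {F : Submodule K (DP K σ)} {W V : Submodule K M} :
    mulSpace F W ≤ V ↔ ∀ a ∈ F, ∀ w ∈ W, a • w ∈ V := by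
  rw [mulSpace, Submodule.span_le]
  constructor
  · exact fun h a ha w hw => h ⟨a, ha, w, hw, rfl⟩
  · rintro h _ ⟨a, ha, w, hw, rfl⟩
    exact h a ha w hw

theorem smul_mem_mulSpace {F : Submodule K (DP K σ)} {W : Submodule K M} {a : DP K σ} (ha : a ∈ F)
    {w : M} (hw : w ∈ W) : a • w ∈ mulSpace F W :=
  Submodule.subset_span ⟨a, ha, w, hw, rfl⟩

theorem finiteDimensional_mulSpace (F : Submodule K (DP K σ)) [FiniteDimensional K F]
    (W : Submodule K M) [FiniteDimensional K W] : FiniteDimensional K (mulSpace F W) := by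
  have h1 := Submodule.FG.map₂ (Algebra.lsmul K K M).toLinearMap
    (Module.Finite.iff_fg.1 (inferInstance : Module.Finite K F))
    (Module.Finite.iff_fg.1 (inferInstance : Module.Finite K W))
  have h2 : mulSpace F W = Submodule.map₂ (Algebra.lsmul K K M).toLinearMap F W :=
    le_antisymm (mulSpace_le.2 fun a ha w hw => Submodule.apply_mem_map₂ _ ha hw)
      (Submodule.map₂_le.2 fun a ha w hw => smul_mem_mulSpace ha hw)
  exact Module.Finite.iff_fg.2 (h2 ▸ h1)

instance finiteDimensional_canonFil (i : ℕ) : FiniteDimensional K (canonFil K (σ := σ) i) :=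
  isFinFiltration_canonFil.finite i

theorem mulSpace_canonFil_mono (W : Submodule K M) :
    Monotone fun i => mulSpace (canonFil K (σ := σ) i) W := fun _ _ hij =>
  mulSpace_le.2 fun _ ha _ hw => smul_mem_mulSpace (isFinFiltration_canonFil.mono hij ha) hw

theorem exists_mem_mulSpace {W : Submodule K M}
    (hW : Submodule.span (DP K σ) (W : Set M) = ⊤) (x : M) :
    ∃ i, x ∈ mulSpace (canonFil K (σ := σ) i) W := by
  have hx : x ∈ Submodule.span (DP K σ) (W : Set M) := hW ▸ Submodule.mem_top
  induction hx using Submodule.span_induction with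
  | zero => exact ⟨0, zero_mem _⟩
  | mem x hx =>
    exact ⟨0, by simpa using smul_mem_mulSpace (isFinFiltration_canonFil (K := K)).one_mem hx⟩
  | add x y _ _ hx hy =>
    obtain ⟨i, hi⟩ := hx
    obtain ⟨j, hj⟩ := hy
    exact ⟨max i j, add_mem (mulSpace_canonFil_mono W (le_max_left i j) hi)
      (mulSpace_canonFil_mono W (le_max_right i j) hj)⟩
  | smul d x _ hx =>
    obtain ⟨i, hi⟩ := hx
    obtain ⟨j, hj⟩ := isFinFiltration_canonFil.exhaustive d
    refine ⟨j + i, ?_⟩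
    have : mulSpace (canonFil K (σ := σ) i) W ≤
        (mulSpace (canonFil K (σ := σ) (j + i)) W).comap (Algebra.lsmul K K M d) := by
      refine mulSpace_le.2 fun a ha w hw => ?_
      change d • a • w ∈ mulSpace (canonFil K (σ := σ) (j + i)) W
      rw [← mul_smul]
      exact smul_mem_mulSpace (canonFil_mul_mem _ _ _ _ hj ha) hw
    exact this hi

theorem exists_le_mulSpace {W W' : Submodule K M} [FiniteDimensional K W']
    (hW : Submodule.span (DP K σ) (W : Set M) = ⊤) :
    ∃ i, W' ≤ mulSpace (canonFil K (σ := σ) i) W := by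
  obtain ⟨s, hs⟩ := Module.Finite.iff_fg.1 (inferInstance : Module.Finite K W')
  choose f hf using exists_mem_mulSpace hW
  refine ⟨s.sup f, ?_⟩
  rw [← hs, Submodule.span_le]
  exact fun x hx => mulSpace_canonFil_mono W (Finset.le_sup hx) (hf x)

/-- W' is contained in some F_a W, and then F_i W' ⊆ F_{i+a} W. -/
theorem exists_hilb_le {W W' : Submodule K M} [FiniteDimensional K W] [FiniteDimensional K W']
    (hW : Submodule.span (DP K σ) (W : Set M) = ⊤) :
    ∃ a, ∀ i, hilb σ W' i ≤ hilb σ W (i + a) := by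
  obtain ⟨a, ha⟩ := exists_le_mulSpace (W' := W') hW
  refine ⟨a, fun i => ?_⟩
  have := finiteDimensional_mulSpace (canonFil K (σ := σ) (i + a)) W
  refine Submodule.finrank_mono (mulSpace_le.2 fun d hd w hw => ?_)
  have : mulSpace (canonFil K (σ := σ) a) W ≤
      (mulSpace (canonFil K (σ := σ) (i + a)) W).comap (Algebra.lsmul K K M d) := by
    refine mulSpace_le.2 fun b hb w hw => ?_
    change d • b • w ∈ mulSpace (canonFil K (σ := σ) (i + a)) W
    rw [← mul_smul]
    exact smul_mem_mulSpace (canonFil_mul_mem _ _ _ _ hd hb) hw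
  exact this (ha hw)

/-- Two generating subspaces bound each other's Hilbert functions up to a shift, and shifts do not
change the limit after division by i^d. -/
theorem hasMultiplicity_of_tendsto (W : Submodule K M) [FiniteDimensional K W]
    (hW : Submodule.span (DP K σ) (W : Set M) = ⊤) {d : ℕ} {e : ℝ} (he : 0 < e)
    (H : Tendsto (fun i : ℕ => (hilb σ W i : ℝ) / (i : ℝ) ^ d) atTop
      (𝓝 (e / (d.factorial : ℝ)))) : HasMultiplicity K σ M d e := by
  refine ⟨he, ?_, fun W' _ hW' => ?_⟩
  · obtain ⟨s, hs⟩ := Module.Finite.iff_fg.1 (inferInstance : Module.Finite K W)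
    refine ⟨⟨s, ?_⟩⟩
    rw [← top_le_iff, ← hW, Submodule.span_le]
    intro x hx
    have h1 : (Submodule.span K (s : Set M)) ≤
        (Submodule.span (DP K σ) (s : Set M)).restrictScalars K :=
      Submodule.span_le.2 Submodule.subset_span
    exact h1 (hs ▸ hx)
  · obtain ⟨a, ha⟩ := exists_hilb_le (W' := W') hW
    obtain ⟨b, hb⟩ := exists_hilb_le (W' := W) hW'
    rw [← tendsto_add_atTop_iff_nat b]
    refine tendsto_of_tendsto_of_tendsto_of_le_of_le (tendsto_shift_div_pow H 0 b)
      (tendsto_shift_div_pow H (b + a) b) (fun i => ?_) fun i => ?_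
    · exact div_le_div_of_nonneg_right (Nat.cast_le.2 (hb i)) (by positivity)
    · refine div_le_div_of_nonneg_right ?_ (by positivity)
      rw [← add_assoc]
      exact Nat.cast_le.2 (ha (i + b))

theorem isHolonomic_of_hilb_le [Nontrivial M] (W : Submodule K M) [FiniteDimensional K W]
    (hW : Submodule.span (DP K σ) (W : Set M) = ⊤) {c : ℕ}
    (hc : ∀ i, hilb σ W i ≤ c * (i + 1) ^ Fintype.card σ) : IsHolonomic K σ M := by
  -- The factor c + 1 in place of c keeps the bounding polynomial of exact degree even if c = 0.
  refine ⟨inferInstance, canonFil K, W, isFinFiltration_canonFil, filEquiv_refl _, inferInstance,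
    hW, Polynomial.C ((c + 1 : ℕ) : ℚ) * (Polynomial.X + Polynomial.C 1) ^ Fintype.card σ, ?_,
    Eventually.of_forall fun i => ?_⟩
  · rw [Polynomial.natDegree_C_mul (by positivity), Polynomial.natDegree_pow,
      Polynomial.natDegree_X_add_C, mul_one]
  · have h1 : (hilb σ W i : ℚ) ≤ c * ((i : ℚ) + 1) ^ Fintype.card σ := by exact_mod_cast hc i
    refine h1.trans ?_
    simp only [Polynomial.eval_mul, Polynomial.eval_C, Polynomial.eval_pow, Polynomial.eval_add,
      Polynomial.eval_X]
    gcongr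
    simp

theorem IsHolonomic.of_equiv {M' : Type u} [AddCommGroup M'] [Module K M'] [Module (DP K σ) M']
    [IsScalarTower K (DP K σ) M'] (e : M ≃ₗ[DP K σ] M') (h : IsHolonomic K σ M) :
    IsHolonomic K σ M' := by
  obtain ⟨h0, F, W, hF, hFe, hWf, hW, q, hq, hb⟩ := h
  have h1 : ∀ G : Submodule K (DP K σ), mulSpace G (W.map (e.restrictScalars K).toLinearMap) =
      (mulSpace G W).map (e.restrictScalars K).toLinearMap := fun G => by
    refine le_antisymm (mulSpace_le.2 ?_) (Submodule.map_le_iff_le_comap.2 (mulSpace_le.2 ?_))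
    · rintro a ha _ ⟨w, hw, rfl⟩
      exact ⟨a • w, smul_mem_mulSpace ha hw, e.map_smul a w⟩
    · intro a ha w hw
      have : e (a • w) = a • e w := e.map_smul a w
      change e (a • w) ∈ mulSpace G (W.map (e.restrictScalars K).toLinearMap)
      rw [this]
      exact smul_mem_mulSpace ha ⟨w, hw, rfl⟩
  refine ⟨e.toEquiv.symm.nontrivial, F, W.map (e.restrictScalars K).toLinearMap, hF, hFe,
    inferInstance, ?_, q, hq, ?_⟩
  · have h2 : ((W.map (e.restrictScalars K).toLinearMap : Submodule K M') : Set M') =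
        e.toLinearMap '' (W : Set M) := rfl
    rw [h2, ← Submodule.map_span, hW, Submodule.map_top, LinearMap.range_eq_top]
    exact e.surjective
  · filter_upwards [hb] with i hi
    rw [h1]
    refine le_of_eq_of_le ?_ hi
    rw [LinearEquiv.finrank_map_eq]

end Growth

end
end TinyDMod

namespace TinyDMod
noncomputable section

/-! ### Hilbert functions, multiplicities and Poincaré series -/

section Hilbert

set_option linter.unusedSectionVars false

open MvPolynomial

theorem span_range_ι {K : Type u} [Field K] {D : Type u} [Ring D] [Algebra K D]
    (A : Subalgebra K D) (V : Type u) [AddCommGroup V] [Module K V] [Module A V]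
    [IsScalarTower K A V] :
    Submodule.span D (LinearMap.range (Induced.ι A V) : Set (Induced A V)) = ⊤ := by
  rw [← top_le_iff]
  intro x _
  induction x using Induced.induction with
  | hadd x y hx hy => exact add_mem (hx trivial) (hy trivial)
  | h d v => exact Submodule.smul_mem _ _ (Submodule.subset_span ⟨v, rfl⟩)

variable {K : Type u} [Field K]

section Poly

variable (K) (σ : Type) [Fintype σ]

theorem span_one_eq_top : Submodule.span (DP K σ)
    (Submodule.span K {(1 : MvPolynomial σ K)} : Set (MvPolynomial σ K)) = ⊤ := by
  rw [← top_le_iff]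
  intro f _
  have : f = mulOp K f • 1 := by rw [mulOp_smul, mul_one]
  rw [this]
  exact Submodule.smul_mem _ _ (Submodule.subset_span (Submodule.mem_span_singleton_self 1))

theorem hilb_span_one (i : ℕ) : hilb σ (Submodule.span K {(1 : MvPolynomial σ K)}) i =
    wcount (fun _ : σ => 1) i := by
  have h1 : mulSpace (canonFil K (σ := σ) i) (Submodule.span K {(1 : MvPolynomial σ K)}) =
      ⨆ α ∈ {α : σ →₀ ℕ | α.degree ≤ i},
        LinearMap.range (MvPolynomial.monomial (R := K) α) := by
    refine le_antisymm (mulSpace_le.2 fun a ha w hw => ?_) (iSup₂_le fun α hα => ?_)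
    · obtain ⟨c, rfl⟩ := Submodule.mem_span_singleton.1 hw
      rw [smul_comm]
      refine Submodule.smul_mem _ _ ?_
      induction ha using Submodule.span_induction with
      | zero => rw [zero_smul]; exact zero_mem _
      | add x y _ _ hx hy => rw [add_smul]; exact add_mem hx hy
      | smul c x _ hx => rw [smul_assoc]; exact Submodule.smul_mem _ _ hx
      | mem x hx =>
        obtain ⟨α, β, h, rfl⟩ := hx
        rw [mul_smul]
        by_cases hβ : β = 0
        · rw [hβ, hasse_zero, one_smul, mulOp_smul, mul_one]
          exact Submodule.mem_iSup_of_mem α (Submodule.mem_iSup_of_mem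
            (show α.degree ≤ i by omega) ⟨1, rfl⟩)
        · rw [hasse_smul_one hβ, smul_zero]
          exact zero_mem _
    · rintro _ ⟨c, rfl⟩
      have : monomial α c = (c • mulOp K (monomial α 1)) • (1 : MvPolynomial σ K) := by
        rw [smul_assoc, mulOp_smul, mul_one, smul_monomial, smul_eq_mul, mul_one]
      rw [this]
      refine smul_mem_mulSpace (Submodule.smul_mem _ _ ?_) (Submodule.mem_span_singleton_self 1)
      have h2 := monomial_hasse_mem_canonFil (K := K) (i := i) α (0 : σ →₀ ℕ)
        (by simpa using hα)
      rwa [hasse_zero, mul_one] at h2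
  have h2 : Function.Injective (Finsupp.lsum K fun α : σ →₀ ℕ => monomial (R := K) α) := by
    have : (Finsupp.lsum K fun α : σ →₀ ℕ => monomial (R := K) α) =
        (basisMonomials σ K).repr.symm.toLinearMap := by
      refine Finsupp.lhom_ext fun α c => ?_
      rw [Finsupp.lsum_single]
      change _ = (basisMonomials σ K).repr.symm (Finsupp.single α c)
      rw [Module.Basis.repr_symm_single, coe_basisMonomials, smul_monomial, smul_eq_mul, mul_one]
    rw [this]
    exact (basisMonomials σ K).repr.symm.injective
  have h3 : ∀ α : σ →₀ ℕ, α.degree = ∑ j, α j * 1 := fun α => by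
    rw [Finsupp.degree_eq_sum]
    simp
  have h4 : Nat.card {α : σ →₀ ℕ | α.degree ≤ i} =
      Nat.card {δ : σ → ℕ | ∑ j, δ j * 1 ≤ i} :=
    Nat.card_congr (Finsupp.equivFunOnFinite.subtypeEquiv fun α => by
      rw [Set.mem_ofPred_eq, h3]
      rfl)
  have hfin : {α : σ →₀ ℕ | α.degree ≤ i}.Finite := by
    refine Set.Finite.of_finite_image (f := Finsupp.equivFunOnFinite)
      ((finite_weight_le (w := fun _ : σ => 1) (fun _ => one_pos) i).subset ?_)
      Finsupp.equivFunOnFinite.injective.injOn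
    rintro _ ⟨α, hα, rfl⟩
    rw [Set.mem_ofPred_eq, h3] at hα
    exact hα
  rw [hilb, h1, finrank_iSup_range_of_lsum h2 hfin, Module.finrank_self, mul_one, wcount,
    ← Nat.card_coe_set_eq, h4, Nat.card_coe_set_eq]

end Poly

variable {p : ℕ} [Fact p.Prime] [CharP K p]

theorem pow_kExp_pos {σ : Type} (m : MaximalSpectrum (MvPolynomial σ K)) (j : σ) :
    0 < p ^ kExp p m j := pow_pos (Fact.out : p.Prime).pos _

theorem hilb_range_uι {σ : Type} [Fintype σ] (m : MaximalSpectrum (MvPolynomial σ K)) (i : ℕ) :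
    hilb σ (LinearMap.range (uι p m)) i =
      Module.finrank K (Vm p m) * wcount (fun j => p ^ kExp p m j) i := by
  rw [hilb, mulSpace_canonFil_range_uι, mul_comm]
  exact finrank_iSup_range_of_lsum (lsum_uMap_bijective p m).1
    (finite_weight_le (fun j => pow_kExp_pos m j) i)

variable {n : ℕ} {ε : Fin n → ℤˣ} (m : MaximalSpectrum (MvPolynomial (PosIdx ε) K))

variable (p) in
/-- The weights of the variables of `𝒰(m)`. -/
def ucalWeight : NegIdx ε ⊕ PosIdx ε → ℕ := Sum.elim (fun _ => 1) fun j => p ^ kExp p m j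

theorem ucalWeight_pos (j : NegIdx ε ⊕ PosIdx ε) : 0 < ucalWeight p m j := by
  rcases j with j | j
  · exact one_pos
  · exact pow_kExp_pos m j

/-- Exponents of `𝒰(m)` as functions. -/
def expEquiv (ε : Fin n → ℤˣ) :
    (NegIdx ε →₀ ℕ) × (PosIdx ε → ℕ) ≃ (NegIdx ε ⊕ PosIdx ε → ℕ) :=
  (Finsupp.equivFunOnFinite.prodCongr (Equiv.refl _)).trans (Equiv.sumArrowEquivProdArrow _ _ _).symm

theorem sum_expEquiv (x : (NegIdx ε →₀ ℕ) × (PosIdx ε → ℕ)) :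
    ∑ j, expEquiv ε x j * ucalWeight p m j =
      x.1.degree + ∑ j, x.2 j * p ^ kExp p m j := by
  rw [Fintype.sum_sum_type, Finsupp.degree_eq_sum]
  congr 1
  refine Finset.sum_congr rfl fun j _ => ?_
  change x.1 j * 1 = _
  rw [mul_one]

theorem hilb_baseUcal (i : ℕ) : hilb (Fin n) (baseUcal (tensorIso ε K) p m) i =
    Module.finrank K (Vm p m) * wcount (ucalWeight p m) i := by
  let t : Set ((NegIdx ε →₀ ℕ) × (PosIdx ε → ℕ)) :=
    {x | x.1.degree + ∑ j, x.2 j * p ^ kExp p m j ≤ i}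
  have h1 : ucalFil p m i =
      ⨆ x ∈ t, LinearMap.range (summandMap (tensorIso ε K) p m x.1 x.2) := by
    rw [iSup_prod]
    rfl
  have h4 : Nat.card t =
      Nat.card {δ : NegIdx ε ⊕ PosIdx ε → ℕ | ∑ j, δ j * ucalWeight p m j ≤ i} :=
    Nat.card_congr ((expEquiv ε).subtypeEquiv fun x => by
      change _ ↔ ∑ j, expEquiv ε x j * ucalWeight p m j ≤ i
      rw [sum_expEquiv]
      rfl)
  have hfin : t.Finite := by
    refine Set.Finite.of_finite_image (f := expEquiv ε)
      ((finite_weight_le (ucalWeight_pos (p := p) m) i).subset ?_) (expEquiv ε).injective.injOn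
    rintro _ ⟨x, hx, rfl⟩
    rw [Set.mem_ofPred_eq, sum_expEquiv]
    exact hx
  rw [hilb, mulSpace_canonFil_baseUcal, h1,
    finrank_iSup_range_of_lsum (lsum_summandMap_bijective p m).1 hfin, wcount,
    ← Nat.card_coe_set_eq, h4, Nat.card_coe_set_eq, mul_comm]

theorem finrank_Vm_pos : 0 < Module.finrank K (Vm p m) := by
  have : Nontrivial (Vm p m) := IsSimpleModule.nontrivial (Am p m) _
  exact Module.finrank_pos

instance finiteDimensional_baseU {σ : Type} [Fintype σ] (m : MaximalSpectrum (MvPolynomial σ K)) :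
    FiniteDimensional K (LinearMap.range (uι p m)) := inferInstance

instance finiteDimensional_baseUcal :
    FiniteDimensional K (baseUcal (tensorIso ε K) p m) :=
  Module.Finite.map (LinearMap.range (uι p m)) (Outer.tmul (tensorIso ε K) 1)

variable (p) in
theorem span_baseUcal : Submodule.span (DP K (Fin n))
    (baseUcal (tensorIso ε K) p m : Set (Ucal (tensorIso ε K) p m)) = ⊤ := by
  rw [← top_le_iff]
  intro x _
  obtain ⟨d, rfl⟩ := exists_smul_ucalOne x
  exact Submodule.smul_mem _ _ (Submodule.subset_span ⟨_, ⟨_, rfl⟩, rfl⟩)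

theorem isLocFinite_Ucal : IsLocFinite (K := K) (Ucal (tensorIso ε K) p m) ε := by
  intro x
  obtain ⟨i, hi⟩ := exists_mem_ucalFil x
  have : FiniteDimensional K (ucalFil p m i) := by
    rw [← mulSpace_canonFil_baseUcal]
    exact finiteDimensional_mulSpace _ _
  refine Submodule.finiteDimensional_of_le (S₂ := ucalFil p m i) (Submodule.span_le.2 ?_)
  rintro _ ⟨a, ha, rfl⟩
  exact Lam_smul_mem_ucalFil ha hi

theorem isHolonomic_Ucal : IsHolonomic K (Fin n) (Ucal (tensorIso ε K) p m) := by
  have : Nontrivial (Ucal (tensorIso ε K) p m) := IsSimpleModule.nontrivial (DP K (Fin n)) _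
  refine isHolonomic_of_hilb_le _ (span_baseUcal p m) (c := Module.finrank K (Vm p m)) fun i => ?_
  rw [hilb_baseUcal]
  refine Nat.mul_le_mul_left _ ((wcount_le (ucalWeight_pos m) i).trans (le_of_eq ?_))
  rw [Fintype.card_sum, card_idx, Fintype.card_fin]

theorem card_sumIdx : Fintype.card (NegIdx ε ⊕ PosIdx ε) = n := by
  rw [Fintype.card_sum, card_idx]

theorem prod_ucalWeight : ∏ j, (ucalWeight p m j : ℚ) = (p : ℚ) ^ ∑ j, kExp p m j := by
  rw [Fintype.prod_sum_type]
  simp only [ucalWeight, Sum.elim_inl, Sum.elim_inr, Nat.cast_one, Finset.prod_const_one, one_mul,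
    Nat.cast_pow]
  exact Finset.prod_pow_eq_pow_sum _ _ _

variable (p) in
/-- The endomorphism algebra of `𝒰(m)`. -/
def endUcalEquiv : Module.End (DP K (Fin n)) (Ucal (tensorIso ε K) p m) ≃ₐ[K] ResSep m :=
  (AlgEquiv.ofBijective _ (outerEnd_bijective (tensorIso ε K))).symm.trans (endUmEquiv p m)

theorem p_ne_zero : (p : ℚ) ≠ 0 := Nat.cast_ne_zero.2 (Fact.out : p.Prime).ne_zero

/-- The period is a common multiple of the weights 1 and p^{k_j}. The factor p^{∑ k_j} in the
dimension of V(m) cancels the product of the weights, leaving the degree of the separable part. -/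
theorem isAlmostPolynomial_baseUcal :
    IsAlmostPolynomial (hilb (Fin n) (baseUcal (tensorIso ε K) p m))
      (p ^ Finset.univ.sup (kExp p m)) n
      ((Module.finrank K (ResSep m) : ℚ) / (n.factorial : ℚ)) := by
  have h1 := isAlmostPolynomial_wcount (w := ucalWeight p m)
    (q := p ^ Finset.univ.sup (kExp p m)) (pow_pos (Fact.out : p.Prime).pos _) (fun j => by
      rcases j with j | j
      · exact one_dvd _
      · exact pow_dvd_pow _ (Finset.le_sup (Finset.mem_univ j))) (finrank_Vm_pos (p := p) m)
  rw [prod_ucalWeight, card_sumIdx, finrank_Vm, Nat.cast_mul, Nat.cast_pow] at h1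
  have h2 : hilb (Fin n) (baseUcal (tensorIso ε K) p m) = fun i =>
      p ^ (∑ j, kExp p m j) * Module.finrank K (ResSep m) * wcount (ucalWeight p m) i := by
    funext i
    rw [hilb_baseUcal, finrank_Vm]
  rw [h2]
  convert h1 using 1
  have := p_ne_zero (p := p)
  field_simp

theorem finrank_ResSep_pos {σ : Type} [Fintype σ] (m : MaximalSpectrum (MvPolynomial σ K)) :
    0 < Module.finrank K (ResSep m) := by
  have : FiniteDimensional K (MvPolynomial σ K ⧸ m.asIdeal) := finiteDimensional_residue m
  exact Module.finrank_pos

theorem hasMultiplicity_poly (σ : Type) [Fintype σ] :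
    HasMultiplicity K σ (MvPolynomial σ K) (Fintype.card σ) 1 := by
  have h1 := (isAlmostPolynomial_wcount (w := fun _ : σ => 1) one_pos (fun _ => dvd_rfl)
    one_pos).tendsto
  refine hasMultiplicity_of_tendsto _ (span_one_eq_top K σ) one_pos ?_
  simp only [hilb_span_one]
  simpa using h1

theorem hasMultiplicity_Um {σ : Type} [Fintype σ] (m : MaximalSpectrum (MvPolynomial σ K)) :
    HasMultiplicity K σ (Um p m) (Fintype.card σ) (Module.finrank K (ResSep m)) := by
  have h0 : 0 < Module.finrank K (Vm p m) := by
    rw [finrank_Vm]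
    exact Nat.mul_pos (pow_pos (Fact.out : p.Prime).pos _) (finrank_ResSep_pos m)
  have h1 := (isAlmostPolynomial_wcount (w := fun j => p ^ kExp p m j)
    (q := p ^ Finset.univ.sup (kExp p m)) (pow_pos (Fact.out : p.Prime).pos _)
    (fun j => pow_dvd_pow _ (Finset.le_sup (Finset.mem_univ j))) h0).tendsto
  refine hasMultiplicity_of_tendsto _ (span_range_ι _ _)
    (Nat.cast_pos.2 (finrank_ResSep_pos m)) ?_
  simp only [hilb_range_uι]
  convert h1 using 2
  have hp : (p : ℝ) ≠ 0 := Nat.cast_ne_zero.2 (Fact.out : p.Prime).ne_zero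
  rw [finrank_Vm]
  push_cast
  rw [Finset.prod_pow_eq_pow_sum]
  field_simp

theorem hasMultiplicity_Ucal :
    HasMultiplicity K (Fin n) (Ucal (tensorIso ε K) p m) n (Module.finrank K (ResSep m)) := by
  refine hasMultiplicity_of_tendsto _ (span_baseUcal p m)
    (Nat.cast_pos.2 (finrank_ResSep_pos m)) ?_
  convert (isAlmostPolynomial_baseUcal (p := p) m).tendsto using 2
  push_cast
  rfl

open PowerSeries in
theorem poincare_baseUcal_mul : poincare (Fin n) (baseUcal (tensorIso ε K) p m) *
    ((1 - PowerSeries.X) ^ (Fintype.card (NegIdx ε) + 1) *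
      ∏ j, (1 - PowerSeries.X ^ p ^ kExp p m j)) =
    PowerSeries.C ((p : ℚ) ^ (∑ j, kExp p m j) * (Module.finrank K (ResSep m) : ℚ)) := by
  have h1 := mk_wcount_mul (ucalWeight p m) (ucalWeight_pos m)
  rw [Fintype.prod_sum_type] at h1
  simp only [ucalWeight, Sum.elim_inl, Sum.elim_inr, pow_one, Finset.prod_const,
    Finset.card_univ] at h1
  have h2 : poincare (Fin n) (baseUcal (tensorIso ε K) p m) =
      PowerSeries.C ((p : ℚ) ^ (∑ j, kExp p m j) * (Module.finrank K (ResSep m) : ℚ)) *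
        PowerSeries.mk fun i => (wcount (ucalWeight p m) i : ℚ) := by
    ext i
    rw [poincare, PowerSeries.coeff_mk, PowerSeries.coeff_C_mul, PowerSeries.coeff_mk,
      hilb_baseUcal, finrank_Vm]
    push_cast
    rfl
  rw [h2]
  unfold ucalWeight
  linear_combination (PowerSeries.C ((p : ℚ) ^ (∑ j, kExp p m j) *
    (Module.finrank K (ResSep m) : ℚ))) * h1

theorem poincare_baseUcal : poincare (Fin n) (baseUcal (tensorIso ε K) p m) =
    (1 - PowerSeries.X) * poincare (NegIdx ε) (Submodule.span K {(1 : MvPolynomial (NegIdx ε) K)}) *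
      poincare (PosIdx ε) (baseU p m) := by
  have h1 := poincare_baseUcal_mul (p := p) m
  have h2 : poincare (NegIdx ε) (Submodule.span K {(1 : MvPolynomial (NegIdx ε) K)}) *
      (1 - PowerSeries.X) ^ (Fintype.card (NegIdx ε) + 1) = 1 := by
    have h := mk_wcount_mul (fun _ : NegIdx ε => 1) (fun _ => one_pos)
    simp only [pow_one, Finset.prod_const, Finset.card_univ, ← hilb_span_one K] at h
    rw [pow_succ']
    exact h
  have h3 : poincare (PosIdx ε) (baseU p m) * ((1 - PowerSeries.X) *
      ∏ j, (1 - PowerSeries.X ^ p ^ kExp p m j)) =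
      PowerSeries.C ((p : ℚ) ^ (∑ j, kExp p m j) * (Module.finrank K (ResSep m) : ℚ)) := by
    have h := mk_wcount_mul (fun j => p ^ kExp p m j) (fun j => pow_kExp_pos m j)
    have h4 : poincare (PosIdx ε) (baseU p m) =
        PowerSeries.C ((p : ℚ) ^ (∑ j, kExp p m j) * (Module.finrank K (ResSep m) : ℚ)) *
          PowerSeries.mk fun i => (wcount (fun j => p ^ kExp p m j) i : ℚ) := by
      ext i
      rw [poincare, PowerSeries.coeff_mk, PowerSeries.coeff_C_mul, PowerSeries.coeff_mk]
      change ((hilb (PosIdx ε) (LinearMap.range (uι p m)) i : ℕ) : ℚ) = _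
      rw [hilb_range_uι, finrank_Vm]
      push_cast
      rfl
    rw [h4]
    linear_combination (PowerSeries.C ((p : ℚ) ^ (∑ j, kExp p m j) *
      (Module.finrank K (ResSep m) : ℚ))) * h
  have h5 := mk_wcount_mul (ucalWeight p m) (ucalWeight_pos m)
  rw [Fintype.prod_sum_type] at h5
  simp only [ucalWeight, Sum.elim_inl, Sum.elim_inr, pow_one, Finset.prod_const,
    Finset.card_univ] at h5
  generalize poincare (Fin n) (baseUcal (tensorIso ε K) p m) = A at *
  generalize poincare (NegIdx ε) (Submodule.span K {(1 : MvPolynomial (NegIdx ε) K)}) = B at *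
  generalize poincare (PosIdx ε) (baseU p m) = E at *
  generalize PowerSeries.C ((p : ℚ) ^ (∑ j, kExp p m j) * (Module.finrank K (ResSep m) : ℚ)) = c
    at *
  generalize (∏ j, (1 - PowerSeries.X ^ p ^ kExp p m j) : PowerSeries ℚ) = Q at *
  generalize (1 - PowerSeries.X : PowerSeries ℚ) = Y at *
  generalize (PowerSeries.mk _ : PowerSeries ℚ) = G at *
  -- Both sides agree after multiplication by (1 - X)^{t+1} ∏ (1 - X^{p^{k_j}}), which is cancelled
  -- below by means of its inverse G.
  have h6 : (A - Y * B * E) * (Y ^ (Fintype.card (NegIdx ε) + 1) * Q) = 0 := by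
    linear_combination h1 - Y * Q * E * h2 - h3
  linear_combination G * h6 - (A - Y * B * E) * h5

end Hilbert
end
end TinyDMod

namespace TinyDMod
noncomputable section

/-! ### Maximal ideals of Λ_ε and associated primes of 𝒰(m) -/

section LamIdeals

set_option linter.unusedSectionVars false

open MvPolynomial

variable {K : Type u} [Field K] {n : ℕ} {ε : Fin n → ℤˣ}

theorem tensorIso_commute (a : DP K (NegIdx ε)) (b : DP K (PosIdx ε)) :
    Commute (tensorIso ε K (a ⊗ₜ 1)) (tensorIso ε K (1 ⊗ₜ b)) := by
  rw [Commute, SemiconjBy, ← map_mul, ← map_mul, Algebra.TensorProduct.tmul_mul_tmul,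
    Algebra.TensorProduct.tmul_mul_tmul]
  simp only [one_mul, mul_one]

theorem partialPow_eq {i : Fin n} (hi : ε i = -1) (j : ℕ) :
    partialPow K i j = tensorIso ε K (partialPow K (⟨i, hi⟩ : NegIdx ε) j ⊗ₜ 1) :=
  (tensorIso_partialPow K (⟨i, hi⟩ : NegIdx ε) j).symm

theorem mulOp_X_eq {i : Fin n} (hi : ε i = 1) :
    mulOp K (X i) = psIncl K ε (X ⟨i, hi⟩) := by
  rw [psIncl, AlgHom.comp_apply, rename_X]

theorem Lam_mul_comm (a b : Lam K ε) : a * b = b * a := by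
  have : IsMulCommutative (Lam K ε) := by
    refine Algebra.isMulCommutative_adjoin K ?_
    have key : ∀ {i k : Fin n} (_ : ε i = 1) (_ : ε k = -1) (j : ℕ),
        Commute (partialPow K k j) (mulOp K (X i)) := fun hi hk j => by
      rw [partialPow_eq hk, mulOp_X_eq hi, ← tensorIso_mulOp_right]
      exact tensorIso_commute _ _
    rintro _ (⟨i, hi, rfl⟩ | ⟨i, j, hi, rfl⟩) _ (⟨k, hk, rfl⟩ | ⟨k, l, hk, rfl⟩)
    · exact mulOp_commute _ _
    · exact (key hi hk l).symm
    · exact key hk hi j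
    · exact hasse_comm _ _
  exact this.is_comm.comm a b

theorem isPrime_of_isMaximal {I : Ideal (Lam K ε)} (hI : I.IsMaximal) : I.IsPrime := by
  refine ⟨hI.ne_top, fun {x y} hxy => or_iff_not_imp_left.2 fun hx => ?_⟩
  obtain ⟨a, i, hi, h⟩ := hI.exists_inv hx
  have : y = a * (x * y) + y * i := by
    rw [Lam_mul_comm y i, ← mul_assoc, ← add_mul, h, one_mul]
  rw [this]
  exact add_mem (I.mul_mem_left _ hxy) (I.mul_mem_left _ hi)

/-- The inclusion of `P_s` into `Λ_ε`. -/
def psLam : MvPolynomial (PosIdx ε) K →ₐ[K] Lam K ε :=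
  (psIncl K ε).codRestrict (Lam K ε) (psIncl_mem_Lam K)

/-- Modulo an ideal containing the `∂_i^[j]`, every element of `Λ_ε` is congruent to an element
of `P_s`. -/
theorem exists_sub_psLam_mem {I : Ideal (Lam K ε)}
    (hI : ∀ a : Lam K ε, ∀ i j, ε i = -1 → 0 < j → (a : DP K (Fin n)) = partialPow K i j → a ∈ I)
    (a : Lam K ε) : ∃ g, a - psLam g ∈ I := by
  obtain ⟨a, ha⟩ := a
  induction ha using Algebra.adjoin_induction with
  | mem a ha =>
    rcases ha with ⟨i, hi, rfl⟩ | ⟨i, j, hi, rfl⟩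
    · refine ⟨X ⟨i, hi⟩, ?_⟩
      convert I.zero_mem
      rw [sub_eq_zero]
      exact Subtype.ext (mulOp_X_eq hi)
    · rcases Nat.eq_zero_or_pos j with rfl | hj
      · refine ⟨1, ?_⟩
        convert I.zero_mem
        rw [sub_eq_zero, map_one]
        refine Subtype.ext ?_
        change partialPow K i 0 = 1
        rw [partialPow, Finsupp.single_zero, hasse_zero]
      · refine ⟨0, ?_⟩
        rw [map_zero, sub_zero]
        exact hI _ i j hi hj rfl
  | algebraMap c =>
    refine ⟨algebraMap K _ c, ?_⟩
    convert I.zero_mem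
    rw [sub_eq_zero, AlgHom.commutes]
    rfl
  | add a b ha hb iha ihb =>
    obtain ⟨g, hg⟩ := iha
    obtain ⟨h, hh⟩ := ihb
    refine ⟨g + h, ?_⟩
    have := add_mem hg hh
    rw [sub_add_sub_comm, ← map_add] at this
    exact this
  | mul a b ha hb iha ihb =>
    obtain ⟨g, hg⟩ := iha
    obtain ⟨h, hh⟩ := ihb
    refine ⟨g * h, ?_⟩
    have := add_mem (I.mul_mem_left ⟨a, ha⟩ hh) (I.mul_mem_left (psLam h) hg)
    have e : ∀ A B G H : Lam K ε, A * B - G * H = A * (B - H) + H * (A - G) := fun A B G H => by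
      rw [mul_sub, mul_sub, Lam_mul_comm H A, Lam_mul_comm H G, sub_add_sub_cancel]
    rw [← e, ← map_mul] at this
    exact this

theorem partialPow_mem_lamIdeal (m : MaximalSpectrum (MvPolynomial (PosIdx ε) K)) {a : Lam K ε}
    {i : Fin n} {j : ℕ} (hi : ε i = -1) (hj : 0 < j) (ha : (a : DP K (Fin n)) = partialPow K i j) :
    a ∈ lamIdeal ε m :=
  Ideal.subset_span (Or.inl ⟨i, j, hi, hj, ha⟩)

theorem psLam_mem_lamIdeal {m : MaximalSpectrum (MvPolynomial (PosIdx ε) K)}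
    {g : MvPolynomial (PosIdx ε) K} (hg : g ∈ m.asIdeal) : psLam g ∈ lamIdeal ε m :=
  Ideal.subset_span (Or.inr ⟨g, hg, rfl⟩)

theorem lamIdeal_le {m : MaximalSpectrum (MvPolynomial (PosIdx ε) K)} {I : Ideal (Lam K ε)}
    (h1 : ∀ a : Lam K ε, ∀ i j, ε i = -1 → 0 < j → (a : DP K (Fin n)) = partialPow K i j → a ∈ I)
    (h2 : ∀ g ∈ m.asIdeal, psLam g ∈ I) : lamIdeal ε m ≤ I := by
  refine Ideal.span_le.2 ?_
  rintro a (⟨i, j, hi, hj, ha⟩ | ⟨g, hg, ha⟩)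
  · exact h1 a i j hi hj ha
  · have : a = psLam g := Subtype.ext ha
    rw [this]
    exact h2 g hg

theorem exists_annihilated_Um (p : ℕ) [Fact p.Prime] [CharP K p]
    {σ : Type} [Fintype σ] (m : MaximalSpectrum (MvPolynomial σ K)) :
    ∃ u : Um p m, u ≠ 0 ∧ ∀ g ∈ m.asIdeal, mulOp K g • u = 0 := by
  have : Nontrivial (Vm p m) := IsSimpleModule.nontrivial (Am p m) _
  obtain ⟨v, hv⟩ := exists_ne (0 : Vm p m)
  have h : uι p m v ≠ 0 := fun h => hv (uι_injective p m (by rw [h, map_zero]))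
  obtain ⟨f, h1, h2⟩ := exists_mulOp_smul_ne_zero h
  exact ⟨_, h1, h2⟩

/-- The vector is 1 ⊗ u with u ≠ 0 in U(m) killed by m. Besides computing associated primes it shows
that `lamIdeal` is proper. -/
theorem exists_annihilated_Ucal (p : ℕ) [Fact p.Prime] [CharP K p]
    (m : MaximalSpectrum (MvPolynomial (PosIdx ε) K)) : ∃ x : Ucal (tensorIso ε K) p m, x ≠ 0 ∧
    (∀ g ∈ m.asIdeal, psIncl K ε g • x = 0) ∧ ∀ a ∈ lamIdeal ε m, (a : DP K (Fin n)) • x = 0 := by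
  obtain ⟨u, hu, h⟩ := exists_annihilated_Um p m
  have h1 : ∀ g ∈ m.asIdeal, psIncl K ε g •
      Outer.tmul (tensorIso ε K) (1 : MvPolynomial (NegIdx ε) K) u = 0 := fun g hg => by
    rw [psIncl_smul_tmul, h g hg, map_zero]
  refine ⟨Outer.tmul (tensorIso ε K) 1 u, fun h0 => hu
    (Outer.tmul_one_injective _ _ (by rw [h0, map_zero])), h1, fun a ha => ?_⟩
  induction ha using Submodule.span_induction with
  | zero => rw [ZeroMemClass.coe_zero, zero_smul]
  | add x y _ _ hx hy => rw [Subalgebra.coe_add, add_smul, hx, hy, add_zero]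
  | smul c x _ hx => rw [smul_eq_mul, Subalgebra.coe_mul, mul_smul, hx, smul_zero]
  | mem x hx =>
    rcases hx with ⟨i, j, hi, hj, hx⟩ | ⟨g, hg, hx⟩
    · rw [hx, partialPow_eq hi]
      refine hasse_smul_tmul_one (tensorIso ε K) ?_ _
      rw [Ne, Finsupp.single_eq_zero]
      exact hj.ne'
    · rw [hx, h1 g hg]

theorem lamIdeal_ne_top (p : ℕ) [Fact p.Prime] [CharP K p]
    (m : MaximalSpectrum (MvPolynomial (PosIdx ε) K)) : lamIdeal ε m ≠ ⊤ := by
  obtain ⟨x, hx, -, h⟩ := exists_annihilated_Ucal p m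
  intro ht
  have := h 1 (ht ▸ Submodule.mem_top)
  rw [OneMemClass.coe_one, one_smul] at this
  exact hx this

/-- Modulo this ideal each element is congruent to some g in P_s, and g is invertible modulo m
unless it lies in m. -/
theorem lamIdeal_isMaximal (p : ℕ) [Fact p.Prime] [CharP K p]
    (m : MaximalSpectrum (MvPolynomial (PosIdx ε) K)) : (lamIdeal ε m).IsMaximal := by
  rw [Ideal.isMaximal_iff]
  refine ⟨(Ideal.ne_top_iff_one _).1 (lamIdeal_ne_top p m), fun J a hJ ha haJ => ?_⟩
  obtain ⟨g, hg⟩ := exists_sub_psLam_mem (I := lamIdeal ε m)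
    (fun a i j hi hj h => partialPow_mem_lamIdeal m hi hj h) a
  have hgm : g ∉ m.asIdeal := fun h => ha (by
    have := add_mem hg (psLam_mem_lamIdeal h)
    rwa [sub_add_cancel] at this)
  obtain ⟨b, i, hi, hb⟩ := m.isMaximal.exists_inv hgm
  have hgJ : psLam g ∈ J := by
    have := sub_mem haJ (hJ hg)
    rwa [sub_sub_cancel] at this
  have : (1 : Lam K ε) = psLam b * psLam g + psLam i := by
    rw [← map_mul, ← map_add, hb, map_one]
  rw [this]
  exact add_mem (J.mul_mem_left _ hgJ) (hJ (psLam_mem_lamIdeal hi))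

theorem psLam_mem_lamIdeal_iff (p : ℕ) [Fact p.Prime] [CharP K p]
    (m : MaximalSpectrum (MvPolynomial (PosIdx ε) K)) {g : MvPolynomial (PosIdx ε) K} :
    psLam g ∈ lamIdeal ε m ↔ g ∈ m.asIdeal := by
  refine ⟨fun h => ?_, psLam_mem_lamIdeal⟩
  by_contra hg
  obtain ⟨b, i, hi, hb⟩ := m.isMaximal.exists_inv hg
  refine lamIdeal_ne_top p m ((Ideal.eq_top_iff_one _).2 ?_)
  have : (1 : Lam K ε) = psLam b * psLam g + psLam i := by
    rw [← map_mul, ← map_add, hb, map_one]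
  rw [this]
  exact add_mem (Ideal.mul_mem_left _ _ h) (psLam_mem_lamIdeal hi)

theorem lamIdeal_injective (p : ℕ) [Fact p.Prime] [CharP K p]
    {m m' : MaximalSpectrum (MvPolynomial (PosIdx ε) K)}
    (h : lamIdeal ε m = lamIdeal ε m') : m = m' := by
  refine MaximalSpectrum.ext (Ideal.ext fun g => ?_)
  rw [← psLam_mem_lamIdeal_iff p m, h, psLam_mem_lamIdeal_iff p m']

theorem partialPow_mem_of_isPrime (p : ℕ) [Fact p.Prime] [CharP K p]
    {I : Ideal (Lam K ε)} (hI : I.IsPrime) {a : Lam K ε} {i : Fin n}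
    {j : ℕ} (hj : 0 < j) (ha : (a : DP K (Fin n)) = partialPow K i j) : a ∈ I := by
  refine hI.mem_of_pow_mem p ?_
  have : a ^ p = 0 := Subtype.ext (by
    rw [Subalgebra.coe_pow, ha, partialPow_pow_eq_zero p i hj]
    rfl)
  rw [this]
  exact I.zero_mem

/-- A maximal ideal is prime, so it contains the nilpotent ∂_i^[j]; thus Λ_ε = P_s + I, the
contraction of I to P_s is maximal, and I contains the corresponding maximal ideal. -/
theorem exists_eq_lamIdeal (p : ℕ) [Fact p.Prime] [CharP K p]
    {I : Ideal (Lam K ε)} (hI : I.IsMaximal) :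
    ∃ m : MaximalSpectrum (MvPolynomial (PosIdx ε) K), lamIdeal ε m = I := by
  have hP := isPrime_of_isMaximal hI
  have hp : ∀ a : Lam K ε, ∀ i j, ε i = -1 → 0 < j → (a : DP K (Fin n)) = partialPow K i j →
      a ∈ I := fun a i j _ hj h => partialPow_mem_of_isPrime p hP hj h
  have hmax : (I.comap (psLam : MvPolynomial (PosIdx ε) K →ₐ[K] Lam K ε)).IsMaximal := by
    rw [Ideal.isMaximal_iff]
    refine ⟨fun h => ?_, fun J g hJ hg hgJ => ?_⟩
    · rw [Ideal.mem_comap, map_one] at h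
      exact hI.ne_top ((Ideal.eq_top_iff_one _).2 h)
    · obtain ⟨a, i, hi, ha⟩ := hI.exists_inv (x := psLam g) hg
      obtain ⟨h, hh⟩ := exists_sub_psLam_mem hp a
      have h1 : 1 - h * g ∈ I.comap (psLam : MvPolynomial (PosIdx ε) K →ₐ[K] Lam K ε) := by
        rw [Ideal.mem_comap, map_sub, map_one, map_mul, ← ha]
        have e : a * psLam g + i - psLam h * psLam g = psLam g * (a - psLam h) + i := by
          rw [mul_sub, Lam_mul_comm (psLam g) a, Lam_mul_comm (psLam g) (psLam h)]
          abel
        rw [e]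
        exact add_mem (I.mul_mem_left _ hh) hi
      have h2 := add_mem (hJ h1) (J.mul_mem_left h hgJ)
      rwa [sub_add_cancel] at h2
  refine ⟨⟨_, hmax⟩, (lamIdeal_isMaximal p _).eq_of_le hI.ne_top (lamIdeal_le hp fun g hg => hg)⟩

/-- Every vector is killed by p^N-th powers of elements of m, so a prime annihilator contains m.
Conversely a nonzero vector killed by m has annihilator exactly m. -/
theorem assPrimes_psIncl_Ucal (p : ℕ) [Fact p.Prime] [CharP K p]
    (m : MaximalSpectrum (MvPolynomial (PosIdx ε) K)) :
    assPrimes (psIncl K ε).toRingHom (Ucal (tensorIso ε K) p m) = {m.asIdeal} := by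
  ext I
  rw [Set.mem_singleton_iff]
  constructor
  · rintro ⟨hI, x, hx⟩
    obtain ⟨N, hN⟩ := exists_psIncl_pow_smul_eq_zero x
    exact (m.isMaximal.eq_of_le hI.ne_top fun f hf =>
      hI.mem_of_pow_mem (p ^ N) ((hx _).2 (hN f hf))).symm
  · rintro rfl
    obtain ⟨x, hx, h, -⟩ := exists_annihilated_Ucal p m
    refine ⟨m.isMaximal.isPrime, x, fun g => ⟨h g, fun hg => ?_⟩⟩
    by_contra hgm
    obtain ⟨b, i, hi, hb⟩ := m.isMaximal.exists_inv hgm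
    refine hx ?_
    have : (1 : DP K (Fin n)) = psIncl K ε b * psIncl K ε g + psIncl K ε i := by
      rw [← map_mul, ← map_add, hb, map_one]
    have hg' : psIncl K ε g • x = 0 := hg
    rw [← one_smul (DP K (Fin n)) x, this, add_smul, mul_smul, hg', h i hi, smul_zero, add_zero]

theorem assPrimes_Lam_Ucal (p : ℕ) [Fact p.Prime] [CharP K p]
    (m : MaximalSpectrum (MvPolynomial (PosIdx ε) K)) :
    assPrimes (Lam K ε).val.toRingHom (Ucal (tensorIso ε K) p m) = {lamIdeal ε m} := by
  have hmax := lamIdeal_isMaximal p m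
  ext I
  rw [Set.mem_singleton_iff]
  constructor
  · rintro ⟨hI, x, hx⟩
    obtain ⟨N, hN⟩ := exists_psIncl_pow_smul_eq_zero x
    refine (hmax.eq_of_le hI.ne_top (lamIdeal_le
      (fun a i j _ hj h => partialPow_mem_of_isPrime p hI hj h) fun g hg => ?_)).symm
    refine hI.mem_of_pow_mem (p ^ N) ((hx _).2 ?_)
    rw [← map_pow]
    exact hN g hg
  · rintro rfl
    obtain ⟨x, hx, -, h⟩ := exists_annihilated_Ucal p m
    refine ⟨isPrime_of_isMaximal hmax, x, fun a => ⟨h a, fun ha => ?_⟩⟩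
    by_contra ham
    obtain ⟨b, i, hi, hb⟩ := hmax.exists_inv ham
    refine hx ?_
    have : (1 : DP K (Fin n)) = b * a + i := congrArg Subtype.val hb.symm
    have ha' : (a : DP K (Fin n)) • x = 0 := ha
    rw [← one_smul (DP K (Fin n)) x, this, add_smul, mul_smul, ha', h i hi, smul_zero, add_zero]

theorem assPrimes_congr {R D : Type u} [Ring R] [Ring D] (ρ : R →+* D) {M M' : Type u}
    [AddCommGroup M] [Module D M] [AddCommGroup M'] [Module D M'] (e : M ≃ₗ[D] M') :
    assPrimes ρ M = assPrimes ρ M' := by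
  have key : ∀ {M M' : Type u} [AddCommGroup M] [Module D M] [AddCommGroup M'] [Module D M']
      (_ : M ≃ₗ[D] M'), assPrimes ρ M ⊆ assPrimes ρ M' := by
    rintro M M' _ _ _ _ e I ⟨hI, v, hv⟩
    refine ⟨hI, e v, fun r => ?_⟩
    rw [hv, ← map_smul, map_eq_zero_iff e e.injective]
  exact Set.Subset.antisymm (key e) (key e.symm)

end LamIdeals
end
end TinyDMod

namespace TinyDMod
noncomputable section

/-! ### Simple locally finite modules are the 𝒰(m) -/

section Classification

set_option linter.unusedSectionVars false

open MvPolynomial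

variable {K : Type u} [Field K] {n : ℕ} {ε : Fin n → ℤˣ}

theorem hasse_eq_erase_mul {σ : Type} [Fintype σ] (β : σ →₀ ℕ) (i : σ) :
    hasse K β = hasse K (β.erase i) * partialPow K i (β i) := by
  classical
  rw [partialPow, hasse_mul_hasse, Finsupp.erase_add_single]
  have : multiChoose β (β.erase i) = 1 := Finset.prod_eq_one fun k _ => by
    by_cases h : k = i
    · rw [h, Finsupp.erase_same, Nat.choose_zero_right]
    · rw [Finsupp.erase_ne h, Nat.choose_self]
  rw [this, one_smul]

theorem IsLocFinite.of_equiv {M M' : Type u} [AddCommGroup M] [Module K M]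
    [Module (DP K (Fin n)) M] [IsScalarTower K (DP K (Fin n)) M] [AddCommGroup M'] [Module K M']
    [Module (DP K (Fin n)) M'] [IsScalarTower K (DP K (Fin n)) M'] (e : M ≃ₗ[DP K (Fin n)] M')
    (h : IsLocFinite (K := K) M ε) : IsLocFinite (K := K) M' ε := by
  intro v
  have := h (e.symm v)
  have h1 : Submodule.span K {w : M' | ∃ a ∈ Lam K ε, w = a • v} =
      (Submodule.span K {w : M | ∃ a ∈ Lam K ε, w = a • e.symm v}).map
        (e.restrictScalars K).toLinearMap := by
    rw [Submodule.map_span]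
    congr 1
    ext w
    constructor
    · rintro ⟨a, ha, rfl⟩
      refine ⟨a • e.symm v, ⟨a, ha, rfl⟩, ?_⟩
      change e (a • e.symm v) = _
      rw [map_smul, e.apply_symm_apply]
    · rintro ⟨_, ⟨a, ha, rfl⟩, rfl⟩
      refine ⟨a, ha, ?_⟩
      change e (a • e.symm v) = _
      rw [map_smul, e.apply_symm_apply]
  rw [h1]
  exact Module.Finite.map _ _

/-- Locally finite modules contain elements whose annihilator in `Λ_ε` is maximal. -/
theorem exists_isMaximal_annihilator {M : Type u} [AddCommGroup M] [Module K M]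
    [Module (DP K (Fin n)) M] [IsScalarTower K (DP K (Fin n)) M] [Nontrivial M]
    (h : IsLocFinite (K := K) M ε) : ∃ v : M, v ≠ 0 ∧ ∃ I : Ideal (Lam K ε), I.IsMaximal ∧
      ∀ a ∈ I, (a : DP K (Fin n)) • v = 0 := by
  let E : M → Submodule K M := fun v => Submodule.span K {w : M | ∃ a ∈ Lam K ε, w = a • v}
  have hE : ∀ v x, x ∈ E v → ∃ a ∈ Lam K ε, x = a • v := fun v x hx => by
    induction hx using Submodule.span_induction with
    | zero => exact ⟨0, zero_mem _, (zero_smul _ _).symm⟩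
    | mem x hx => exact hx
    | add x y _ _ hx hy =>
      obtain ⟨a, ha, rfl⟩ := hx
      obtain ⟨b, hb, rfl⟩ := hy
      exact ⟨a + b, add_mem ha hb, (add_smul _ _ _).symm⟩
    | smul c x _ hx =>
      obtain ⟨a, ha, rfl⟩ := hx
      exact ⟨c • a, Subalgebra.smul_mem _ ha c, (smul_assoc _ _ _).symm⟩
  have : Nonempty {v : M // v ≠ 0} := nonempty_subtype.2 (exists_ne 0)
  -- Minimality of dim Λ_ε v gives Λ_ε a v = Λ_ε v whenever a v ≠ 0, so v = b a v for some b and a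
  -- is invertible modulo the annihilator.
  let v := Function.argmin fun v : {v : M // v ≠ 0} => Module.finrank K (E v)
  have hv : ∀ w : M, w ≠ 0 → Module.finrank K (E v) ≤ Module.finrank K (E w) := fun w hw =>
    not_lt.1 (Function.not_lt_argmin (fun v : {v : M // v ≠ 0} => Module.finrank K (E v)) ⟨w, hw⟩)
  refine ⟨v, v.2, LinearMap.ker (LinearMap.toSpanSingleton (Lam K ε) M v), ?_, fun a ha => ha⟩
  rw [Ideal.isMaximal_iff]
  refine ⟨fun h1 => v.2 ?_, fun J a hJ ha haJ => ?_⟩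
  · have h2 : (1 : Lam K ε) • (v : M) = 0 := h1
    rwa [one_smul] at h2
  · have ha' : (a : DP K (Fin n)) • (v : M) ≠ 0 := ha
    have : FiniteDimensional K (E v) := h v
    have hle : E ((a : DP K (Fin n)) • (v : M)) ≤ E v := Submodule.span_le.2 (by
      rintro _ ⟨b, hb, rfl⟩
      rw [← mul_smul]
      exact Submodule.subset_span ⟨_, mul_mem hb a.2, rfl⟩)
    have heq := Submodule.eq_of_le_of_finrank_le hle (hv _ ha')
    have hmem : (v : M) ∈ E ((a : DP K (Fin n)) • (v : M)) := by
      rw [heq]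
      exact Submodule.subset_span ⟨1, one_mem _, (one_smul _ _).symm⟩
    obtain ⟨b, hb, hb'⟩ := hE _ _ hmem
    have h1 : 1 - (⟨b, hb⟩ : Lam K ε) * a ∈ J := hJ (by
      change (1 - b * (a : DP K (Fin n))) • (v : M) = 0
      rw [sub_smul, one_smul, mul_smul, ← hb', sub_self])
    have h2 := add_mem h1 (J.mul_mem_left ⟨b, hb⟩ haJ)
    rwa [sub_add_cancel] at h2

/-- Modulo the left ideal generated by the ∂^[β], β ≠ 0, an operator c equals multiplication by
c(1); this is the presentation of P_t as a quotient of D(P_t). -/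
theorem smul_eq_mulOp_smul {M : Type u} [AddCommGroup M] [Module K M]
    [Module (DP K (Fin n)) M] [IsScalarTower K (DP K (Fin n)) M] {w : M}
    (hw : ∀ β : NegIdx ε →₀ ℕ, β ≠ 0 → tensorIso ε K (hasse K β ⊗ₜ 1) • w = 0)
    (c : DP K (NegIdx ε)) : tensorIso ε K (c ⊗ₜ 1) • w =
      tensorIso ε K (mulOp K (c • (1 : MvPolynomial (NegIdx ε) K)) ⊗ₜ 1) • w := by
  induction c using DP.induction_mul_hasse with
  | hadd a b ha hb =>
    rw [TensorProduct.add_tmul, map_add, add_smul, ha, hb, add_smul, map_add,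
      TensorProduct.add_tmul, map_add, add_smul]
  | hsmul c a ha =>
    rw [smul_assoc c a, map_smul, ← TensorProduct.smul_tmul', ← TensorProduct.smul_tmul', map_smul,
      map_smul, smul_assoc, smul_assoc, ha]
  | h α β =>
    by_cases hβ : β = 0
    · rw [hβ, hasse_zero, mul_one, mulOp_smul, mul_one]
    · rw [mul_smul, hasse_smul_one hβ, smul_zero, map_zero, TensorProduct.zero_tmul, map_zero,
        zero_smul]
      have : (mulOp K (monomial α (1 : K)) * hasse K β) ⊗ₜ[K] (1 : DP K (PosIdx ε)) =
          (mulOp K (monomial α (1 : K)) ⊗ₜ 1) * (hasse K β ⊗ₜ 1) := by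
        rw [Algebra.TensorProduct.tmul_mul_tmul, mul_one]
      rw [this, map_mul, mul_smul, hw β hβ, smul_zero]

variable {p : ℕ} [Fact p.Prime] [CharP K p] {m : MaximalSpectrum (MvPolynomial (PosIdx ε) K)}

/-- The relations for D(P_s) give ψ from U(m), whose image stays killed by the ∂^[β] ⊗ 1 because the
two tensor factors commute. The map is f ⊗ u ↦ f ψ(u), compatible with D(P_t) by
`smul_eq_mulOp_smul`. -/
theorem exists_Ucal_hom {M : Type u} [AddCommGroup M] [Module K M]
    [Module (DP K (Fin n)) M] [IsScalarTower K (DP K (Fin n)) M] [Module (DP K (PosIdx ε)) M]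
    [IsScalarTower K (DP K (PosIdx ε)) M]
    (hcompat : ∀ (b : DP K (PosIdx ε)) (x : M), b • x = tensorIso ε K (1 ⊗ₜ b) • x) {w : M}
    (h1 : ∀ z ∈ Zm p m, z ∈ m.asIdeal → mulOp K z • w = 0)
    (h2 : ∀ β : PosIdx ε →₀ ℕ, β ≠ 0 → (∀ i, β i < p ^ kExp p m i) → hasse K β • w = 0)
    (h3 : ∀ β : NegIdx ε →₀ ℕ, β ≠ 0 → tensorIso ε K (hasse K β ⊗ₜ 1) • w = 0) :
    ∃ θ : Ucal (tensorIso ε K) p m →ₗ[DP K (Fin n)] M, θ (ucalOne p m) = w := by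
  obtain ⟨ψ, hψ⟩ := exists_uLift w h1 h2
  have hψ3 : ∀ (u : Um p m) (β : NegIdx ε →₀ ℕ), β ≠ 0 →
      tensorIso ε K (hasse K β ⊗ₜ 1) • ψ u = 0 := fun u β hβ => by
    obtain ⟨d, rfl⟩ := exists_smul_uι_vOne p m u
    rw [map_smul, hψ, hcompat, ← mul_smul, (tensorIso_commute _ _).eq, mul_smul, h3 β hβ, smul_zero]
  let B : MvPolynomial (NegIdx ε) K →ₗ[K] Um p m →ₗ[K] M :=
    LinearMap.mk₂ K (fun f u => tensorIso ε K (mulOp K f ⊗ₜ 1) • ψ u)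
      (fun f g u => by rw [map_add, TensorProduct.add_tmul, map_add, add_smul])
      (fun c f u => by rw [map_smul, ← TensorProduct.smul_tmul', map_smul, smul_assoc])
      (fun f u u' => by rw [map_add, smul_add])
      (fun c f u => by rw [LinearMap.map_smul_of_tower, smul_comm])
  let F : Outer (tensorIso ε K) (MvPolynomial (NegIdx ε) K) (Um p m) →ₗ[K] M :=
    TensorProduct.lift B
  have hF : ∀ f u, F (Outer.tmul (tensorIso ε K) f u) = tensorIso ε K (mulOp K f ⊗ₜ 1) • ψ u :=
    fun f u => TensorProduct.lift.tmul _ _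
  refine ⟨Outer.lift (M := MvPolynomial (NegIdx ε) K) (N := Um p m) F fun a b f u => ?_, ?_⟩
  · rw [hF, hF, map_smul ψ, hcompat]
    have e1 : a • f = (a * mulOp K f) • (1 : MvPolynomial (NegIdx ε) K) := by
      rw [mul_smul, mulOp_smul, mul_one]
    have h4 : ∀ β : NegIdx ε →₀ ℕ, β ≠ 0 →
        tensorIso ε K (hasse K β ⊗ₜ 1) • tensorIso ε K (1 ⊗ₜ b) • ψ u = 0 := fun β hβ => by
      rw [← mul_smul, (tensorIso_commute _ _).eq, mul_smul, hψ3 u β hβ, smul_zero]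
    rw [e1, ← smul_eq_mulOp_smul h4, ← mul_smul, ← mul_smul, ← map_mul, ← map_mul,
      Algebra.TensorProduct.tmul_mul_tmul, Algebra.TensorProduct.tmul_mul_tmul, mul_one, one_mul,
      mul_one]
  · rw [Outer.lift_apply]
    change F (Outer.tmul (tensorIso ε K) 1 (uι p m (vOne p m))) = w
    rw [hF, hψ, map_one, ← Algebra.TensorProduct.one_def, map_one, one_smul]

/-- A vector with maximal annihilator in Λ_ε is killed by some m and by the divided powers in the
variables of P_t. Applying ∂^[β₀] in those of P_s gives the remaining relations of 𝒰(m), and a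
nonzero map between simple modules is bijective. -/
theorem exists_Ucal_equiv (p : ℕ) [Fact p.Prime] [CharP K p] {M : Type u} [AddCommGroup M]
    [Module K M] [Module (DP K (Fin n)) M] [IsScalarTower K (DP K (Fin n)) M]
    [IsSimpleModule (DP K (Fin n)) M] (h : IsLocFinite (K := K) M ε) :
    ∃ m : MaximalSpectrum (MvPolynomial (PosIdx ε) K),
      Nonempty (Ucal (tensorIso ε K) p m ≃ₗ[DP K (Fin n)] M) := by
  have : Nontrivial M := IsSimpleModule.nontrivial (DP K (Fin n)) M
  obtain ⟨v, hv, I, hI, hIv⟩ := exists_isMaximal_annihilator h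
  obtain ⟨m, rfl⟩ := exists_eq_lamIdeal p hI
  -- M is regarded as a D(P_s)-module through 1 ⊗ D(P_s), so that the universal property of U(m)
  -- applies.
  let _ : Module (DP K (PosIdx ε)) M := Module.compHom M
    ((tensorIso ε K : DP K (NegIdx ε) ⊗[K] DP K (PosIdx ε) →ₐ[K] DP K (Fin n)).comp
      (Algebra.TensorProduct.includeRight : DP K (PosIdx ε) →ₐ[K] _)).toRingHom
  have hcompat : ∀ (b : DP K (PosIdx ε)) (x : M), b • x = tensorIso ε K (1 ⊗ₜ b) • x :=
    fun b x => rfl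
  have : IsScalarTower K (DP K (PosIdx ε)) M := ⟨fun c b x => by
    rw [hcompat, hcompat, TensorProduct.tmul_smul, map_smul, smul_assoc]⟩
  have hv1 : ∀ g ∈ m.asIdeal, mulOp K g • v = 0 := fun g hg => by
    rw [hcompat, tensorIso_mulOp_right]
    exact hIv _ (psLam_mem_lamIdeal hg)
  have hv2 : ∀ β : NegIdx ε →₀ ℕ, β ≠ 0 → tensorIso ε K (hasse K β ⊗ₜ 1) • v = 0 :=
      fun β hβ => by
    obtain ⟨i, hi⟩ : ∃ i, β i ≠ 0 := by
      by_contra! h0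
      exact hβ (Finsupp.ext h0)
    have e : hasse K β ⊗ₜ[K] (1 : DP K (PosIdx ε)) =
        (hasse K (β.erase i) ⊗ₜ 1) * (partialPow K i (β i) ⊗ₜ 1) := by
      rw [Algebra.TensorProduct.tmul_mul_tmul, mul_one, ← hasse_eq_erase_mul]
    rw [e, map_mul, mul_smul, tensorIso_partialPow]
    have h0 : partialPow K (i : Fin n) (β i) • v = 0 :=
      hIv ⟨_, partialPow_mem_Lam K i.2 _⟩
        (partialPow_mem_lamIdeal m i.2 (Nat.pos_of_ne_zero hi) rfl)
    rw [h0, smul_zero]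
  obtain ⟨β₀, hw, h1, h2⟩ := exists_hasse_annihilated p m hv fun z _ hz => hv1 z hz
  obtain ⟨θ, hθ⟩ := exists_Ucal_hom hcompat h1 h2 fun β hβ => by
    rw [hcompat, ← mul_smul, (tensorIso_commute _ _).eq, mul_smul, hv2 β hβ, smul_zero]
  refine ⟨m, ⟨LinearEquiv.ofBijective θ (LinearMap.bijective_of_ne_zero fun h0 => hw ?_)⟩⟩
  rw [← hθ, h0, LinearMap.zero_apply]

end Classification
end
end TinyDMod

namespace TinyDMod
noncomputable section

/-! ### Isomorphism classes and the inverse bijections -/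

section Assembly

open scoped ModuleCat

variable {K : Type u} [Field K] {n : ℕ} (ε : Fin n → ℤˣ) (p : ℕ) [Fact p.Prime] [CharP K p]

theorem IsLocFinite.of_equiv_moduleCat {ε : Fin n → ℤˣ} {M : Type u} [AddCommGroup M]
    [Module K M] [Module (DP K (Fin n)) M] [IsScalarTower K (DP K (Fin n)) M]
    (h : IsLocFinite (K := K) M ε) {N : ModuleCat.{u} (DP K (Fin n))} (e : M ≃ₗ[DP K (Fin n)] N) :
    IsLocFinite (K := K) N ε :=
  h.of_equiv e

/-- The module `𝒰(m)` as an element of the set of simple locally finite modules. -/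
def tinyUcal (m : MaximalSpectrum (MvPolynomial (PosIdx ε) K)) : TinyModule K ε :=
  ⟨ModuleCat.of (DP K (Fin n)) (Ucal (tensorIso ε K) p m), isSimpleModule_Ucal,
    (isLocFinite_Ucal m).of_equiv_moduleCat (N := ModuleCat.of (DP K (Fin n)) _)
      (LinearEquiv.refl (DP K (Fin n)) (Ucal (tensorIso ε K) p m))⟩

variable {ε}

theorem cls_tinyUcal_eq_iff {m : MaximalSpectrum (MvPolynomial (PosIdx ε) K)}
    {M : TinyModule K ε} : (tinyUcal ε p m).cls = M.cls ↔
      Nonempty (Ucal (tensorIso ε K) p m ≃ₗ[DP K (Fin n)] M.1) :=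
  Quotient.eq

theorem TinyModule.exists_equiv (M : TinyModule K ε) :
    ∃ m : MaximalSpectrum (MvPolynomial (PosIdx ε) K),
      Nonempty (Ucal (tensorIso ε K) p m ≃ₗ[DP K (Fin n)] M.1) := by
  have := M.2.1
  exact exists_Ucal_equiv p M.2.2

theorem cls_tinyUcal_eq_iff_assPrimes_psIncl (M : TinyModule K ε)
    (m : MaximalSpectrum (MvPolynomial (PosIdx ε) K)) : (tinyUcal ε p m).cls = M.cls ↔
      assPrimes (psIncl K ε).toRingHom M.1 = {m.asIdeal} := by
  rw [cls_tinyUcal_eq_iff]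
  constructor
  · rintro ⟨e⟩
    rw [← assPrimes_congr _ e, assPrimes_psIncl_Ucal]
  · intro h
    obtain ⟨m', ⟨e⟩⟩ := M.exists_equiv p
    rw [← assPrimes_congr _ e, assPrimes_psIncl_Ucal, Set.singleton_eq_singleton_iff] at h
    rw [← MaximalSpectrum.ext h]
    exact ⟨e⟩

theorem cls_tinyUcal_eq_iff_assPrimes_Lam (M : TinyModule K ε)
    (m : MaximalSpectrum (MvPolynomial (PosIdx ε) K)) : (tinyUcal ε p m).cls = M.cls ↔
      assPrimes (Lam K ε).val.toRingHom M.1 = {lamIdeal ε m} := by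
  rw [cls_tinyUcal_eq_iff]
  constructor
  · rintro ⟨e⟩
    rw [← assPrimes_congr _ e, assPrimes_Lam_Ucal]
  · intro h
    obtain ⟨m', ⟨e⟩⟩ := M.exists_equiv p
    rw [← assPrimes_congr _ e, assPrimes_Lam_Ucal, Set.singleton_eq_singleton_iff] at h
    rw [← lamIdeal_injective p h]
    exact ⟨e⟩

theorem bijective_cls_tinyUcal :
    Function.Bijective fun m : MaximalSpectrum (MvPolynomial (PosIdx ε) K) =>
      (tinyUcal ε p m).cls := by
  constructor
  · intro m m' h
    have h1 := (cls_tinyUcal_eq_iff_assPrimes_psIncl p (tinyUcal ε p m') m).1 h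
    have h2 : ({m'.asIdeal} : Set _) = {m.asIdeal} := (assPrimes_psIncl_Ucal p m').symm.trans h1
    exact MaximalSpectrum.ext (Set.singleton_eq_singleton_iff.1 h2).symm
  · intro c
    induction c using Quotient.inductionOn with
    | h M =>
      obtain ⟨m, hm⟩ := M.exists_equiv p
      exact ⟨m, (cls_tinyUcal_eq_iff p).2 hm⟩

variable (K ε) in
/-- The bijection `m ↦ Λ(t)_+ ⊗ P_s + Λ(t) ⊗ m`. -/
def lamIdealEquiv : MaximalSpectrum (MvPolynomial (PosIdx ε) K) ≃
    {I : Ideal (Lam K ε) // I.IsMaximal} :=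
  Equiv.ofBijective (fun m => ⟨lamIdeal ε m, lamIdeal_isMaximal p m⟩)
    ⟨fun _ _ h => lamIdeal_injective p (congrArg Subtype.val h), fun ⟨_, hI⟩ =>
      let ⟨m, hm⟩ := exists_eq_lamIdeal p hI
      ⟨m, Subtype.ext hm⟩⟩

theorem lamIdealEquiv_coe (m : MaximalSpectrum (MvPolynomial (PosIdx ε) K)) :
    (lamIdealEquiv K ε p m).1 = lamIdeal ε m := rfl

theorem TinyModule.isHolonomic (p : ℕ) [Fact p.Prime] [CharP K p] (M : TinyModule K ε) : M.IsHolonomic := by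
  obtain ⟨m, ⟨e⟩⟩ := M.exists_equiv p
  exact IsHolonomic.of_equiv e (isHolonomic_Ucal m)

theorem TinyModule.not_finitePresentation (p : ℕ) [Fact p.Prime] [CharP K p] {i : Fin n} (hi : ε i = -1) (M : TinyModule K ε) :
    ¬ Module.FinitePresentation (DP K (Fin n)) M.1 := by
  obtain ⟨m, ⟨e⟩⟩ := M.exists_equiv p
  intro h
  exact not_finitePresentation_Ucal (p := p) (m := m) hi (Module.FinitePresentation.of_equiv e.symm)

end Assembly
end
end TinyDMod

open TinyDMod

theorem mainTheorem11 {K : Type u} [Field K] (p : ℕ) [Fact p.Prime] [CharP K p]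
    (n : ℕ) (ε : Fin n → ℤˣ) (hε : ε ≠ fun _ => 1) :
    ∃ Φ : DP K (NegIdx ε) ⊗[K] DP K (PosIdx ε) ≃ₐ[K]
        DP K (Fin n),
      -- `D(P_n) = D(P_t) ⊗ D(P_s)` and `Λ_ε = Λ(t) ⊗ P_s`
      (∀ (a : DP K (NegIdx ε)) (b : DP K (PosIdx ε)) (f : MvPolynomial (NegIdx ε) K)
          (g : MvPolynomial (PosIdx ε) K), Φ (a ⊗ₜ[K] b) •
          (MvPolynomial.rename Subtype.val f * MvPolynomial.rename Subtype.val g :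
            MvPolynomial (Fin n) K) =
        MvPolynomial.rename Subtype.val (a • f) * MvPolynomial.rename Subtype.val (b • g)) ∧
      (lamTensor ε).map (Φ : _ →ₐ[K] DP K (Fin n)) = Lam K ε ∧
      -- `V(m)` is the unique simple `A(m)`-module on which `K[x_i^(p^k_i)]` acts through `P_s / m`
      (∀ m : MaximalSpectrum (MvPolynomial (PosIdx ε) K),
        IsSimpleModule (Am p m) (Vm p m) ∧
        (∀ a ∈ centralSet p m, ∀ v : Vm p m, a • v = 0) ∧
        ∀ (W : Type u) [AddCommGroup W] [Module (Am p m) W],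
          IsSimpleModule (Am p m) W →
          (∀ a ∈ centralSet p m, ∀ w : W, a • w = 0) →
          Nonempty (W ≃ₗ[Am p m] Vm p m)) ∧
      -- each `𝒰(m)` is simple and locally finite over `Λ_ε`
      ∃ U : MaximalSpectrum (MvPolynomial (PosIdx ε) K) → TinyModule K ε,
        (∀ m, (U m).1 = ModuleCat.of (DP K (Fin n)) (Ucal Φ p m)) ∧
        -- 1. `m ↦ 𝒰(m)` is a bijection with inverse `M ↦ ass_{P_s}(M)`
        (Function.Bijective (fun m => (U m).cls) ∧
          (∀ (M : TinyModule K ε) m, (U m).cls = M.cls ↔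
            assPrimes (psIncl K ε).toRingHom M.1 = {m.asIdeal}) ∧
          ∀ m, assPrimes (psIncl K ε).toRingHom (Ucal Φ p m) =
            {m.asIdeal}) ∧
        -- 2. `Λ(t)_+ ⊗ P_s + Λ(t) ⊗ m ↦ 𝒰(m)` is a bijection with inverse `M ↦ ass_{Λ_ε}(M)`
        (∃ J : MaximalSpectrum (MvPolynomial (PosIdx ε) K) →
            {I : Ideal (Lam K ε) // I.IsMaximal},
          ∃ Ψ : {I : Ideal (Lam K ε) // I.IsMaximal} → TinyClass K ε,
            (∀ m, (J m).1 = lamIdeal ε m) ∧ Function.Bijective J ∧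
            (∀ m, Ψ (J m) = (U m).cls) ∧ Function.Bijective Ψ ∧
            (∀ (M : TinyModule K ε) I, Ψ I = M.cls ↔
              assPrimes (Lam K ε).val.toRingHom M.1 = {I.1}) ∧
            ∀ m, assPrimes (Lam K ε).val.toRingHom (Ucal Φ p m) =
              {lamIdeal ε m}) ∧
        -- 3. holonomic, not finitely presented
        (∀ M : TinyModule K ε, M.IsHolonomic ∧
          ¬ Module.FinitePresentation (DP K (Fin n)) M.1) ∧
        -- 4. the endomorphism algebras
        (∀ m,
          (∃ φ : Module.End (DP K (NegIdx ε))
                (MvPolynomial (NegIdx ε) K) ⊗[K]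
              Module.End (DP K (PosIdx ε)) (Um p m) ≃ₐ[K]
              Module.End (DP K (Fin n)) (Ucal Φ p m),
            ∀ f g x u, φ (f ⊗ₜ[K] g) (Outer.tmul Φ x u) =
              Outer.tmul Φ (f x) (g u)) ∧
          Nonempty (Module.End (DP K (NegIdx ε))
            (MvPolynomial (NegIdx ε) K) ≃ₐ[K] K) ∧
          Nonempty (Module.End (DP K (PosIdx ε)) (Um p m) ≃ₐ[K]
            ResSep m) ∧
          Nonempty (Module.End (DP K (Fin n)) (Ucal Φ p m) ≃ₐ[K]
            K ⊗[K] ResSep m) ∧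
          Nonempty (Module.End (DP K (Fin n)) (Ucal Φ p m) ≃ₐ[K]
            ResSep m)) ∧
        -- 5. the filtration `𝒰(m)_i = F_i (1 ⊗ 1 ⊗ V(m))`
        (∀ m,
          FiniteDimensional K (baseUcal Φ p m) ∧
          Submodule.span (DP K (Fin n))
            (baseUcal Φ p m : Set (Ucal Φ p m)) = ⊤ ∧
          (∀ α γ, Function.Injective (summandMap Φ p m α γ)) ∧
          DirectSum.IsInternal
            (fun x : (NegIdx ε →₀ ℕ) × (PosIdx ε → ℕ) =>
              LinearMap.range (summandMap Φ p m x.1 x.2)) ∧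
          (∀ i : ℕ, mulSpace (canonFil K (σ := Fin n) i) (baseUcal Φ p m) =
            ⨆ (α : NegIdx ε →₀ ℕ) (γ : PosIdx ε → ℕ)
              (_ : α.degree + ∑ j, γ j * p ^ kExp p m j ≤ i),
              LinearMap.range (summandMap Φ p m α γ)) ∧
          -- (a) the Poincare series
          poincare (Fin n) (baseUcal Φ p m) =
            (1 - PowerSeries.X) *
              poincare (NegIdx ε)
                (Submodule.span K {(1 : MvPolynomial (NegIdx ε) K)}) *
              poincare (PosIdx ε) (baseU p m) ∧
          poincare (Fin n) (baseUcal Φ p m) *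
              ((1 - PowerSeries.X) ^ (Fintype.card (NegIdx ε) + 1) *
                ∏ j, (1 - PowerSeries.X ^ p ^ kExp p m j)) =
            PowerSeries.C ((p : ℚ) ^ (∑ j, kExp p m j) *
              (Module.finrank K (ResSep m) : ℚ)) ∧
          -- (b) the multiplicity
          (∃ e₁ e₂ : ℝ,
            HasMultiplicity K (NegIdx ε)
              (MvPolynomial (NegIdx ε) K) (Fintype.card (NegIdx ε)) e₁ ∧
            HasMultiplicity K (PosIdx ε) (Um p m)
              (Fintype.card (PosIdx ε)) e₂ ∧
            HasMultiplicity K (Fin n) (Ucal Φ p m) n (e₁ * e₂) ∧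
            e₁ * e₂ = (Module.finrank K (ResSep m) : ℝ) ∧
            e₁ * e₂ = (Module.finrank K
              (Module.End (DP K (Fin n)) (Ucal Φ p m)) : ℝ)) ∧
          -- (c) the Hilbert function
          IsAlmostPolynomial (hilb (Fin n) (baseUcal Φ p m))
            (p ^ Finset.univ.sup (kExp p m)) n
            ((Module.finrank K (ResSep m) : ℚ) / (n.factorial : ℚ))) := by
  -- An index with ε_i = -1 is needed only for the failure of finite presentation.
  obtain ⟨i, hi⟩ : ∃ i, ε i = -1 := by
    by_contra! h
    exact hε (funext fun i => (Int.units_eq_one_or (ε i)).resolve_right (h i))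
  refine ⟨tensorIso ε K, tensorIso_smul K, lamTensor_map_tensorIso K, fun m =>
    ⟨inferInstance, fun a ha v => centralSet_smul p m ha v, fun W _ _ _ hW =>
      nonempty_equiv_Vm p m hW⟩, tinyUcal ε p, fun m => rfl,
    ⟨bijective_cls_tinyUcal p, cls_tinyUcal_eq_iff_assPrimes_psIncl p, assPrimes_psIncl_Ucal p⟩,
    ⟨lamIdealEquiv K ε p, fun I => (tinyUcal ε p ((lamIdealEquiv K ε p).symm I)).cls,
      lamIdealEquiv_coe p, (lamIdealEquiv K ε p).bijective, fun m => ?_,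
      (bijective_cls_tinyUcal p).comp (lamIdealEquiv K ε p).symm.bijective, fun M I => ?_,
      assPrimes_Lam_Ucal p⟩,
    fun M => ⟨M.isHolonomic p, M.not_finitePresentation p hi⟩, fun m => ⟨⟨outerEndEquiv _,
      outerEndEquiv_tmul _⟩, ⟨(endPolyEquiv K _).symm⟩, ⟨endUmEquiv p m⟩,
      ⟨(endUcalEquiv p m).trans (Algebra.TensorProduct.lid K _).symm⟩, ⟨endUcalEquiv p m⟩⟩,
    fun m => ⟨inferInstance, span_baseUcal p m, fun α γ => ?_, ?_, mulSpace_canonFil_baseUcal p m,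
      poincare_baseUcal m, poincare_baseUcal_mul m, ⟨1, Module.finrank K (ResSep m),
        hasMultiplicity_poly _, hasMultiplicity_Um m, ?_, one_mul _, ?_⟩,
      isAlmostPolynomial_baseUcal m⟩⟩
  · exact congrArg (fun m => (tinyUcal ε p m).cls) ((lamIdealEquiv K ε p).symm_apply_apply m)
  · obtain ⟨m, rfl⟩ := (lamIdealEquiv K ε p).surjective I
    have h := (lamIdealEquiv K ε p).symm_apply_apply m
    refine Iff.trans ?_ (cls_tinyUcal_eq_iff_assPrimes_Lam p M m)
    exact iff_of_eq (congrArg (fun m => (tinyUcal ε p m).cls = M.cls) h)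
  · exact injective_of_lsum (lsum_summandMap_bijective p m).1 (α, γ)
  · exact isInternal_of_lsum (lsum_summandMap_bijective p m)
  · rw [one_mul]
    exact hasMultiplicity_Ucal m
  · rw [one_mul, (endUcalEquiv p m).toLinearEquiv.finrank_eq]
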